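/- Let $(M,\eta,\xi,\varphi,g)$ be a $3$-dimensional Sasaki manifold: $\eta$ is a contact form with Reeb field $\xi$, $\varphi^2=-I+\eta\otimes\xi$, $g(\varphi X,\varphi Y)=g(X,Y)-\eta(X)\eta(Y)$, $g(\xi,\cdot)=\eta$, $d\eta(X,Y)=2g(X,\varphi Y)$ with $d\eta(X,Y)=X\eta(Y)-Y\eta(X)-\eta([X,Y])$, and $(\nabla_X\varphi)Y=g(X,Y)\xi-\eta(Y)X$ for the Levi-Civita connection $\nabla$ of $g$. Assume that $M$ is regular: $\xi$ is complete and the orbit space $\bar M=M/K$ of the one-parameter group $K$ generated by $\xi$ is a smooth surface for which the projection $\pi:M\to\bar M$ is a submersion; give $\bar M$ the Riemannian metric that makes $\pi$ a Riemannian submersion. Let $\bar\gamma:J\to\bar M$ be a smooth curve parametrised by arc length on a nonempty open interval $J$, and let $\iota:S=S_{\bar\gamma}\to M$ be the Hopf cylinder over $\bar\gamma$, that is, the inverse image $\pi^{-1}(\bar\gamma)$, regarded as an immersed surface with the induced metric. Let $\mathbb H=\frac12\operatorname{trace}I\!I$ be its mean curvature vector field, $\mathbb H=H\mathbf n$ with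 $\mathbf n$ a unit normal and $H$ the mean curvature, and let $\Delta=-\operatorname{trace}\nabla^2$ be the Laplace operator on sections of $\iota^*TM$. A Riemannian circle is a unit speed curve with constant positive curvature and no torsion: $\bar\nabla_{\bar\gamma'}\bar\gamma'=\kappa Y$ and $\bar\nabla_{\bar\gamma'}Y=-\kappa\bar\gamma'$ with a constant $\kappa>0$ and a unit vector field $Y$ along $\bar\gamma$ that is orthogonal to $\bar\gamma'$. Then: 1. There is a constant $\lambda\in\mathbb R$ with $\Delta\mathbb H=\lambda\mathbb H$ on $S$ if and only if $\bar\gamma$ is a geodesic or a Riemannian circle. 2. $\Delta\mathbb H=0$ if and only if $\bar\gamma$ is a geodesic; in that case $\mathbb H=0$. 3. If $\bar\gamma$ is a Riemannian circle, then there is exactly one $\lambda\in\mathbb R$ with $\Delta\mathbb H=\lambda\mathbb H$, it satisfies $\lambda>2$ (so $\lambda\neq0$), and $\lambda=4H^2+2$ at every point of $S$. -/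

import Mathlib

open Bundle Set FiberBundle VectorField
open scoped Manifold ContDiff Topology InnerProductSpace

noncomputable section

namespace RiemGeom

set_option linter.unusedSectionVars false

section TangentSpace

variable {E : Type*} [NormedAddCommGroup E] [NormedSpace ℝ E] [FiniteDimensional ℝ E]
  {H : Type*} [TopologicalSpace H] {I : ModelWithCorners ℝ E H}
  {M : Type*} [TopologicalSpace M] [ChartedSpace H M]

instance instFiniteDimensionalTangentSpace (x : M) : FiniteDimensional ℝ (TangentSpace I x) :=
  inferInstanceAs (FiniteDimensional ℝ E)

end TangentSpace

section LeviCivita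

variable {E : Type*} [NormedAddCommGroup E] [NormedSpace ℝ E] [FiniteDimensional ℝ E]
  {H : Type*} [TopologicalSpace H] {I : ModelWithCorners ℝ E H}
  {M : Type*} [TopologicalSpace M] [ChartedSpace H M] [IsManifold I ∞ M]
  [RiemannianBundle (fun x : M => TangentSpace I x)]
  [IsContMDiffRiemannianBundle I ∞ E (fun x : M => TangentSpace I x)]

theorem mdiff_inner {X Y : Π x : M, TangentSpace I x} {x : M}
    (hX : MDiffAt (T% X) x) (hY : MDiffAt (T% Y) x) : MDiffAt (fun y => ⟪X y, Y y⟫_ℝ) x :=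
  MDifferentiableAt.inner_bundle (E := fun x : M => TangentSpace I x) (F := E) (b := id) hX hY

/-- The right-hand side of the Koszul formula for `2⟪∇_X Y, Z⟫`. -/
def koszul (X Y Z : Π x : M, TangentSpace I x) (x : M) : ℝ :=
  d% (fun y => ⟪Y y, Z y⟫_ℝ) x (X x) + d% (fun y => ⟪X y, Z y⟫_ℝ) x (Y x)
    - d% (fun y => ⟪X y, Y y⟫_ℝ) x (Z x)
    + ⟪mlieBracket I X Y x, Z x⟫_ℝ - ⟪mlieBracket I X Z x, Y x⟫_ℝ
    - ⟪mlieBracket I Y Z x, X x⟫_ℝ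

theorem koszul_tensorial_left {Y Z : Π x : M, TangentSpace I x} {x : M}
    (hY : MDiffAt (T% Y) x) (hZ : MDiffAt (T% Z) x) :
    TensorialAt I E (fun X => koszul X Y Z x) x where
  smul {f X} hf hX := by
    have h1 := mvfderiv_fun_mul hf (mdiff_inner hX hZ)
    have h2 := mvfderiv_fun_mul hf (mdiff_inner hX hY)
    simp [koszul, mlieBracket_smul_left hf hX, inner_add_left, inner_smul_left,
      inner_smul_right, h1, h2]
    ring
  add {X X'} hX hX' := by
    have h1 := mvfderiv_fun_add (mdiff_inner hX hZ) (mdiff_inner hX' hZ)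
    have h2 := mvfderiv_fun_add (mdiff_inner hX hY) (mdiff_inner hX' hY)
    simp [koszul, mlieBracket_add_left hX hX', inner_add_left, inner_add_right, h1, h2]
    ring

theorem koszul_tensorial_right {X Y : Π x : M, TangentSpace I x} {x : M}
    (hX : MDiffAt (T% X) x) (hY : MDiffAt (T% Y) x) :
    TensorialAt I E (fun Z => koszul X Y Z x) x where
  smul {f Z} hf hZ := by
    have h1 := mvfderiv_fun_mul hf (mdiff_inner hX hZ)
    have h2 := mvfderiv_fun_mul hf (mdiff_inner hY hZ)
    simp [koszul, mlieBracket_smul_right hf hZ, inner_add_left, inner_smul_left,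
      inner_smul_right, h1, h2, real_inner_comm]
    ring
  add {Z Z'} hZ hZ' := by
    have h1 := mvfderiv_fun_add (mdiff_inner hX hZ) (mdiff_inner hX hZ')
    have h2 := mvfderiv_fun_add (mdiff_inner hY hZ) (mdiff_inner hY hZ')
    simp [koszul, mlieBracket_add_right hZ hZ', inner_add_left, inner_add_right, h1, h2]
    ring

theorem koszul_smul_mid {X Y Z : Π x : M, TangentSpace I x} {f : M → ℝ} {x : M}
    (hX : MDiffAt (T% X) x) (hY : MDiffAt (T% Y) x) (hZ : MDiffAt (T% Z) x) (hf : MDiffAt f x) :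
    koszul X (f • Y) Z x = f x * koszul X Y Z x + 2 * (d% f x (X x) * ⟪Y x, Z x⟫_ℝ) := by
  have h1 := mvfderiv_fun_mul hf (mdiff_inner hY hZ)
  have h2 := mvfderiv_fun_mul hf (mdiff_inner hX hY)
  simp [koszul, mlieBracket_smul_left hf hY, mlieBracket_smul_right hf hY, inner_add_left,
    inner_smul_left, inner_smul_right, h1, h2, real_inner_comm]
  ring

theorem koszul_add_mid {X Y Y' Z : Π x : M, TangentSpace I x} {x : M}
    (hX : MDiffAt (T% X) x) (hY : MDiffAt (T% Y) x) (hY' : MDiffAt (T% Y') x)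
    (hZ : MDiffAt (T% Z) x) :
    koszul X (Y + Y') Z x = koszul X Y Z x + koszul X Y' Z x := by
  have h1 := mvfderiv_fun_add (mdiff_inner hY hZ) (mdiff_inner hY' hZ)
  have h2 := mvfderiv_fun_add (mdiff_inner hX hY) (mdiff_inner hX hY')
  simp [koszul, mlieBracket_add_left hY hY', mlieBracket_add_right hY hY', inner_add_left,
    inner_add_right, h1, h2]
  ring

open Classical in
/-- The vector `∇_v Y` at `x`, characterised through the Riesz representation by
`2⟪∇_v Y, Z⟫ = koszul X Y Z`, where `X` extends `v` (junk value `0` if `Y` is not differentiable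
at `x`). -/
def leviCivitaFun (Y : Π x : M, TangentSpace I x) (x : M) :
    TangentSpace I x →L[ℝ] TangentSpace I x :=
  if hY : MDiffAt (T% Y) x then
    letI T : TangentSpace I x →L[ℝ] TangentSpace I x →L[ℝ] ℝ :=
      TensorialAt.mkHom₂ (fun X Z => koszul X Y Z x) x
        (fun _ hZ => koszul_tensorial_left hY hZ) (fun _ hX => koszul_tensorial_right hX hY)
    LinearMap.toContinuousLinearMap
      { toFun := fun v => (InnerProductSpace.toDual ℝ (TangentSpace I x)).symm ((1 / 2 : ℝ) • T v)
        map_add' := fun v w => by simp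
        map_smul' := fun c v => by simp [smul_comm c] }
  else 0

theorem two_inner_leviCivitaFun {X Y Z : Π x : M, TangentSpace I x} {x : M}
    (hX : MDiffAt (T% X) x) (hY : MDiffAt (T% Y) x) (hZ : MDiffAt (T% Z) x) :
    2 * ⟪leviCivitaFun Y x (X x), Z x⟫_ℝ = koszul X Y Z x := by
  have h := TensorialAt.mkHom₂_apply (Φ := fun X Z => koszul X Y Z x)
    (fun _ hZ => koszul_tensorial_left hY hZ) (fun _ hX => koszul_tensorial_right hX hY) hX hZ
  simp only [leviCivitaFun, hY, dif_pos]
  simp [-map_smul, h]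

theorem ext_inner_extend {x : M} {a b : TangentSpace I x}
    (h : ∀ Z : Π x : M, TangentSpace I x, MDiffAt (T% Z) x → ⟪a, Z x⟫_ℝ = ⟪b, Z x⟫_ℝ) : a = b := by
  refine ext_inner_right ℝ fun v => ?_
  simpa using h (FiberBundle.extend E v) (mdifferentiableAt_extend ..)

variable (I M) in
/-- The Levi-Civita connection of a Riemannian manifold; `leviCivita I M Y x v` is `∇_v Y` at `x`. -/
def leviCivita : CovariantDerivative I E (TangentSpace I : M → Type _) where
  toFun := leviCivitaFun
  isCovariantDerivativeOnUniv :=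
    { add := by
        intro Y Y' x hY hY' _
        ext v
        obtain ⟨X, hX, rfl⟩ : ∃ X : Π x : M, TangentSpace I x, MDiffAt (T% X) x ∧ X x = v :=
          ⟨FiberBundle.extend E v, mdifferentiableAt_extend .., by simp⟩
        refine ext_inner_extend fun Z hZ => ?_
        have h := two_inner_leviCivitaFun hX (mdifferentiableAt_add_section hY hY') hZ
        rw [koszul_add_mid hX hY hY' hZ, ← two_inner_leviCivitaFun hX hY hZ,
          ← two_inner_leviCivitaFun hX hY' hZ] at h
        simp only [add_apply, inner_add_left]
        linarith
      leibniz := by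
        intro Y f x hY hf _
        ext v
        obtain ⟨X, hX, rfl⟩ : ∃ X : Π x : M, TangentSpace I x, MDiffAt (T% X) x ∧ X x = v :=
          ⟨FiberBundle.extend E v, mdifferentiableAt_extend .., by simp⟩
        refine ext_inner_extend fun Z hZ => ?_
        have h := two_inner_leviCivitaFun hX (hf.smul_section hY) hZ
        rw [koszul_smul_mid hX hY hZ hf, ← two_inner_leviCivitaFun hX hY hZ] at h
        simp only [add_apply, inner_add_left, smul_apply,
          inner_smul_left, ContinuousLinearMap.smulRight_apply]
        simp
        linarith }

theorem leviCivita_koszul {X Y Z : Π x : M, TangentSpace I x} {x : M}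
    (hX : MDiffAt (T% X) x) (hY : MDiffAt (T% Y) x) (hZ : MDiffAt (T% Z) x) :
    2 * ⟪leviCivita I M Y x (X x), Z x⟫_ℝ = koszul X Y Z x :=
  two_inner_leviCivitaFun hX hY hZ

theorem leviCivita_torsion : (leviCivita I M).torsion = 0 := by
  rw [CovariantDerivative.torsion_eq_zero_iff]
  intro X Y x hX hY
  refine ext_inner_extend fun Z hZ => ?_
  have h1 := leviCivita_koszul hX hY hZ
  have h2 := leviCivita_koszul hY hX hZ
  simp only [koszul] at h1 h2
  rw [mlieBracket_swap_apply (V := Y) (W := X)] at h2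
  simp only [real_inner_comm (Y _) (X _), inner_neg_left] at h1 h2
  rw [inner_sub_left]
  linarith

theorem leviCivita_metric {X Y Z : Π x : M, TangentSpace I x} {x : M}
    (hX : MDiffAt (T% X) x) (hY : MDiffAt (T% Y) x) (hZ : MDiffAt (T% Z) x) :
    d% (fun y => ⟪Y y, Z y⟫_ℝ) x (X x) =
      ⟪leviCivita I M Y x (X x), Z x⟫_ℝ + ⟪Y x, leviCivita I M Z x (X x)⟫_ℝ := by
  have h1 := leviCivita_koszul hX hY hZ
  have h2 := leviCivita_koszul hX hZ hY
  simp only [koszul] at h1 h2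
  rw [mlieBracket_swap_apply (V := Z) (W := Y)] at h2
  simp only [real_inner_comm (Y _) (Z _), inner_neg_left] at h1 h2
  rw [real_inner_comm (leviCivita I M Z x (X x)) (Y x)]
  linarith

end LeviCivita

section AlongMaps

variable {E : Type*} [NormedAddCommGroup E] [NormedSpace ℝ E] [FiniteDimensional ℝ E]
  {H : Type*} [TopologicalSpace H] {I : ModelWithCorners ℝ E H}
  {M : Type*} [TopologicalSpace M] [ChartedSpace H M] [IsManifold I ∞ M]
  [RiemannianBundle (fun x : M => TangentSpace I x)]
  [IsContMDiffRiemannianBundle I ∞ E (fun x : M => TangentSpace I x)]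
  {F : Type*} [NormedAddCommGroup F] [NormedSpace ℝ F] [FiniteDimensional ℝ F]
  {G : Type*} [TopologicalSpace G] {J : ModelWithCorners ℝ F G}
  {N : Type*} [TopologicalSpace N] [ChartedSpace G N]

variable (I J) in
/-- The connection of the pull-back bundle `f^*TM` induced by the Levi-Civita connection of `M`:
`covAlong I J f V x v` is the covariant derivative of the section `V` of `f^*TM` in the direction
`v ∈ T_x N`. If `V = ∑ aᵢ (eᵢ ∘ f)` for the local frame `eᵢ` of `TM` given by the trivialization at
`f x`, it is `∑ daᵢ(v) eᵢ + ∑ aᵢ ∇_{df v} eᵢ`. -/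
def covAlong (f : N → M) (V : Π x : N, TangentSpace I (f x)) (x : N) :
    TangentSpace J x →L[ℝ] TangentSpace I (f x) :=
  letI e := trivializationAt E (TangentSpace I : M → Type _) (f x)
  letI coord : N → E := fun y => (e ⟨f y, V y⟩).2
  (e.symmL ℝ (f x)) ∘L (d% coord x : TangentSpace J x →L[ℝ] E) +
    (leviCivita I M (FiberBundle.extend E (V x)) (f x)) ∘L (mfderiv J I f x)

variable [IsManifold J ∞ N] [RiemannianBundle (fun x : N => TangentSpace J x)]
  [IsContMDiffRiemannianBundle J ∞ F (fun x : N => TangentSpace J x)]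

variable (I J) in
/-- The second covariant derivative `(∇²V)(v, w) = D_v D_W V - D_{∇_v W} V` of a section `V` of
`f^*TM`, where `W` is a local extension of `w`. -/
def covAlong₂ (f : N → M) (V : Π x : N, TangentSpace I (f x)) (x : N) (v w : TangentSpace J x) :
    TangentSpace I (f x) :=
  covAlong I J f (fun y => covAlong I J f V y (FiberBundle.extend F w y)) x v -
    covAlong I J f V x (leviCivita J N (FiberBundle.extend F w) x v)

variable (I J) in
/-- The Laplace operator `Δ V = -trace (∇²V)` on sections of `f^*TM`, for `f` a map from a Riemannian
manifold `N`. -/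
def roughLaplacian (f : N → M) (V : Π x : N, TangentSpace I (f x)) (x : N) :
    TangentSpace I (f x) :=
  -∑ i, covAlong₂ I J f V x (stdOrthonormalBasis ℝ (TangentSpace J x) i)
    (stdOrthonormalBasis ℝ (TangentSpace J x) i)

variable (I J) in
/-- The (vector valued) second fundamental form `D_v (df W) - df (∇_v W)` of an isometric immersion,
where `W` is a local extension of `w`. -/
def secondFundamentalForm (f : N → M) (x : N) (v w : TangentSpace J x) : TangentSpace I (f x) :=
  covAlong I J f (fun y => mfderiv J I f y (FiberBundle.extend F w y)) x v -
    mfderiv J I f x (leviCivita J N (FiberBundle.extend F w) x v)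

variable (I J) in
/-- The mean curvature vector field `ℍ = (1 / dim N) trace II` of an isometric immersion. -/
def meanCurvatureVector (f : N → M) (x : N) : TangentSpace I (f x) :=
  (Module.finrank ℝ F : ℝ)⁻¹ • ∑ i, secondFundamentalForm I J f x
    (stdOrthonormalBasis ℝ (TangentSpace J x) i) (stdOrthonormalBasis ℝ (TangentSpace J x) i)

end AlongMaps

section Curves

variable {E : Type*} [NormedAddCommGroup E] [NormedSpace ℝ E] [FiniteDimensional ℝ E]
  {H : Type*} [TopologicalSpace H] (I : ModelWithCorners ℝ E H)
  {M : Type*} [TopologicalSpace M] [ChartedSpace H M] [IsManifold I ∞ M]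
  [RiemannianBundle (fun x : M => TangentSpace I x)]
  [IsContMDiffRiemannianBundle I ∞ E (fun x : M => TangentSpace I x)]

/-- The velocity field of a curve. -/
def velocity (γ : ℝ → M) (s : ℝ) : TangentSpace I (γ s) :=
  mfderiv 𝓘(ℝ, ℝ) I γ s (1 : ℝ)

/-- The covariant derivative of a vector field along a curve. -/
def covCurve (γ : ℝ → M) (V : Π s : ℝ, TangentSpace I (γ s)) (s : ℝ) : TangentSpace I (γ s) :=
  covAlong I 𝓘(ℝ, ℝ) γ V s (1 : ℝ)

/-- `γ` is a smooth curve parametrised by arc length on `J`. -/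
def IsUnitSpeedOn (γ : ℝ → M) (J : Set ℝ) : Prop :=
  ContMDiffOn 𝓘(ℝ, ℝ) I ∞ γ J ∧ ∀ s ∈ J, ‖velocity I γ s‖ = 1

/-- `γ` is a geodesic on `J`. -/
def IsGeodesicOn (γ : ℝ → M) (J : Set ℝ) : Prop :=
  ∀ s ∈ J, covCurve I γ (velocity I γ) s = 0

/-- The unit speed curve `γ` is a Riemannian circle on `J`: it satisfies the Frenet equations
with constant curvature `κ > 0` and no torsion. -/
def IsRiemannianCircleOn (γ : ℝ → M) (J : Set ℝ) : Prop :=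
  ∃ κ : ℝ, 0 < κ ∧ ∃ Y : Π s : ℝ, TangentSpace I (γ s),
    ContMDiffOn 𝓘(ℝ, ℝ) I.tangent ∞ (fun s => (⟨γ s, Y s⟩ : TangentBundle I M)) J ∧
    ∀ s ∈ J, ‖Y s‖ = 1 ∧ ⟪velocity I γ s, Y s⟫_ℝ = 0 ∧
      covCurve I γ (velocity I γ) s = κ • Y s ∧
      covCurve I γ Y s = -(κ • velocity I γ s)

end Curves

section OneForm

variable {E : Type*} [NormedAddCommGroup E] [NormedSpace ℝ E]
  {H : Type*} [TopologicalSpace H] {I : ModelWithCorners ℝ E H}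
  {M : Type*} [TopologicalSpace M] [ChartedSpace H M] [IsManifold I ∞ M]

/-- The exterior derivative of a one-form, `dη(V, W) = V(η(W)) - W(η(V)) - η([V, W])`, where `V`, `W`
are local extensions of the tangent vectors `v`, `w`. -/
def extDerivOneForm (η : Π x : M, TangentSpace I x →L[ℝ] ℝ) (x : M)
    (v w : TangentSpace I x) : ℝ :=
  letI V : Π y : M, TangentSpace I y := FiberBundle.extend E v
  letI W : Π y : M, TangentSpace I y := FiberBundle.extend E w
  d% (fun y => η y (W y)) x v - d% (fun y => η y (V y)) x w - η x (mlieBracket I V W x)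

end OneForm

section Contact

variable (M : Type*) [TopologicalSpace M] [ChartedSpace (EuclideanSpace ℝ (Fin 3)) M]
  [IsManifold (𝓡 3) ∞ M]
  [RiemannianBundle (fun x : M => TangentSpace (𝓡 3) x)]
  [IsContMDiffRiemannianBundle (𝓡 3) ∞ (EuclideanSpace ℝ (Fin 3))
    (fun x : M => TangentSpace (𝓡 3) x)]

/-- A contact Riemannian structure `(η, ξ, φ, g)` on a `3`-manifold, where `g` is the given
Riemannian metric. -/
structure ContactRiemannianStructure where
  /-- the contact form -/
  η : Π x : M, TangentSpace (𝓡 3) x →L[ℝ] ℝ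
  /-- the Reeb vector field -/
  ξ : Π x : M, TangentSpace (𝓡 3) x
  /-- the endomorphism field -/
  φ : Π x : M, TangentSpace (𝓡 3) x →L[ℝ] TangentSpace (𝓡 3) x
  smooth_η : ContMDiff (𝓡 3) ((𝓡 3).prod 𝓘(ℝ, EuclideanSpace ℝ (Fin 3) →L[ℝ] ℝ)) ∞
    (fun x => TotalSpace.mk' (EuclideanSpace ℝ (Fin 3) →L[ℝ] ℝ)
      (E := fun x : M => TangentSpace (𝓡 3) x →L[ℝ] Bundle.Trivial M ℝ x) x (η x))
  smooth_ξ : ContMDiff (𝓡 3) (𝓡 3).tangent ∞ (fun x => (⟨x, ξ x⟩ : TangentBundle (𝓡 3) M))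
  smooth_φ : ContMDiff (𝓡 3)
    ((𝓡 3).prod 𝓘(ℝ, EuclideanSpace ℝ (Fin 3) →L[ℝ] EuclideanSpace ℝ (Fin 3))) ∞
    (fun x => TotalSpace.mk' (EuclideanSpace ℝ (Fin 3) →L[ℝ] EuclideanSpace ℝ (Fin 3))
      (E := fun x : M => TangentSpace (𝓡 3) x →L[ℝ] TangentSpace (𝓡 3) x) x (φ x))
  /-- `η ∧ dη` vanishes nowhere -/
  contact : ∀ x, ∃ u v w : TangentSpace (𝓡 3) x,
    η x u * extDerivOneForm η x v w + η x v * extDerivOneForm η x w u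
      + η x w * extDerivOneForm η x u v ≠ 0
  η_ξ : ∀ x, η x (ξ x) = 1
  dη_ξ : ∀ x v, extDerivOneForm η x (ξ x) v = 0
  φ_φ : ∀ x v, φ x (φ x v) = -v + η x v • ξ x
  inner_φ_φ : ∀ x v w, ⟪φ x v, φ x w⟫_ℝ = ⟪v, w⟫_ℝ - η x v * η x w
  inner_ξ : ∀ x v, ⟪ξ x, v⟫_ℝ = η x v
  associated : ∀ x v w, extDerivOneForm η x v w = 2 * ⟪v, φ x w⟫_ℝ

variable {M}

/-- The Sasaki condition `(∇_X φ) Y = g(X, Y) ξ - η(Y) X`, where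
`(∇_X φ) Y = ∇_X (φ Y) - φ (∇_X Y)`. -/
def ContactRiemannianStructure.IsSasaki (C : ContactRiemannianStructure M) : Prop :=
  ∀ (x : M) (v : TangentSpace (𝓡 3) x) (Y : Π y : M, TangentSpace (𝓡 3) y),
    ContMDiffAt (𝓡 3) (𝓡 3).tangent ∞ (fun y => (⟨y, Y y⟩ : TangentBundle (𝓡 3) M)) x →
    leviCivita (𝓡 3) M (fun y => C.φ y (Y y)) x v - C.φ x (leviCivita (𝓡 3) M Y x v) =
      ⟪v, Y x⟫_ℝ • C.ξ x - C.η x (Y x) • v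

variable {B : Type*} [TopologicalSpace B] [ChartedSpace (EuclideanSpace ℝ (Fin 2)) B]
  [IsManifold (𝓡 2) ∞ B]
  [RiemannianBundle (fun x : B => TangentSpace (𝓡 2) x)]

/-- The structure `C` on `M` is regular, with Boothby-Wang fibration `pr : M → B`: the Reeb field is
complete, hence generates a one-parameter group `K` of transformations of `M`, and `B` with `pr` is
the orbit space `M / K`, as a smooth manifold (`pr` is a surjective submersion whose fibres are the
`K`-orbits) and as a Riemannian manifold (`dpr` is isometric on the orthogonal complement of `ξ`). -/
structure IsBoothbyWangFibration (C : ContactRiemannianStructure M) (pr : M → B) : Prop where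
  complete : ∀ p : M, ∃ c : ℝ → M, IsMIntegralCurve c C.ξ ∧ c 0 = p
  smooth : ContMDiff (𝓡 3) (𝓡 2) ∞ pr
  surjective : Function.Surjective pr
  submersion : ∀ p, Function.Surjective (mfderiv (𝓡 3) (𝓡 2) pr p)
  fibre : ∀ p q : M, pr p = pr q ↔
    ∃ c : ℝ → M, IsMIntegralCurve c C.ξ ∧ c 0 = p ∧ ∃ u : ℝ, c u = q
  isometric : ∀ (p : M) (v w : TangentSpace (𝓡 3) p), C.η p v = 0 → C.η p w = 0 →
    ⟪mfderiv (𝓡 3) (𝓡 2) pr p v, mfderiv (𝓡 3) (𝓡 2) pr p w⟫_ℝ = ⟪v, w⟫_ℝ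

variable {S : Type*} [TopologicalSpace S] [ChartedSpace (EuclideanSpace ℝ (Fin 2)) S]
  [IsManifold (𝓡 2) ∞ S]
  [RiemannianBundle (fun x : S => TangentSpace (𝓡 2) x)]

/-- On the open neighbourhood `U` of `x`, the map `pr ∘ ι` runs along `γ`, at the parameter `σ`. -/
structure IsParameterNear (pr : M → B) (γ : ℝ → B) (J : Set ℝ) (ι : S → M) (x : S)
    (U : Set S) (σ : S → ℝ) : Prop where
  isOpen : IsOpen U
  mem : x ∈ U
  smooth : ContMDiffOn (𝓡 2) 𝓘(ℝ, ℝ) ∞ σ U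
  mapsTo : MapsTo σ U J
  lift : ∀ y ∈ U, pr (ι y) = γ (σ y)

/-- `ι : S → M` is the Hopf cylinder `pr⁻¹(γ)` over the curve `γ` defined on `J`, with its induced
metric. Self-intersecting and closed curves are allowed, so the inverse image is taken
in the sense of immersed surfaces: `ι` is an isometric immersion, `pr ∘ ι` locally runs along `γ`,
and every point `p` over `γ s` is attained on the sheet of `S` that belongs to the parameter `s`.
Examples are the pull-back `{(s, p) ∈ J × M | γ s = pr p}` with `ι (s, p) = p`, and the
surface `pr⁻¹(γ(J)) ⊆ M` itself if `γ(J)` is an embedded (open or closed) curve. -/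
structure IsHopfCylinder (pr : M → B) (γ : ℝ → B) (J : Set ℝ) (ι : S → M) : Prop where
  smooth : ContMDiff (𝓡 2) (𝓡 3) ∞ ι
  isometric : ∀ (x : S) (v w : TangentSpace (𝓡 2) x),
    ⟪mfderiv (𝓡 2) (𝓡 3) ι x v, mfderiv (𝓡 2) (𝓡 3) ι x w⟫_ℝ = ⟪v, w⟫_ℝ
  parameter : ∀ x : S, ∃ U σ, IsParameterNear pr γ J ι x U σ
  attained : ∀ s ∈ J, ∀ p : M, pr p = γ s →
    ∃ x : S, ι x = p ∧ ∃ U σ, IsParameterNear pr γ J ι x U σ ∧ σ x = s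

theorem IsHopfCylinder.range_eq {pr : M → B} {γ : ℝ → B} {J : Set ℝ} {ι : S → M}
    (h : IsHopfCylinder pr γ J ι) : range ι = pr ⁻¹' (γ '' J) := by
  ext p
  constructor
  · rintro ⟨x, rfl⟩
    obtain ⟨U, σ, hσ⟩ := h.parameter x
    exact ⟨σ x, hσ.mapsTo hσ.mem, (hσ.lift x hσ.mem).symm⟩
  · rintro ⟨s, hs, hp⟩
    obtain ⟨x, hx, -⟩ := h.attained s hs p hp.symm
    exact ⟨x, hx⟩

variable [IsContMDiffRiemannianBundle (𝓡 2) ∞ (EuclideanSpace ℝ (Fin 2))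
    (fun x : S => TangentSpace (𝓡 2) x)]

/-- The mean curvature vector field of the surface `ι : S → M` satisfies `Δ ℍ = μ ℍ` in `ι^*TM`. -/
def MeanCurvatureEigen (ι : S → M) (μ : ℝ) : Prop :=
  ∀ x : S, roughLaplacian (𝓡 3) (𝓡 2) ι (meanCurvatureVector (𝓡 3) (𝓡 2) ι) x =
    μ • meanCurvatureVector (𝓡 3) (𝓡 2) ι x

/-- `n` is a unit normal vector of the surface `ι : S → M` at `x`. -/
def IsUnitNormal (ι : S → M) (x : S) (n : TangentSpace (𝓡 3) (ι x)) : Prop :=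
  ‖n‖ = 1 ∧ ∀ v : TangentSpace (𝓡 2) x, ⟪mfderiv (𝓡 2) (𝓡 3) ι x v, n⟫_ℝ = 0

/-- The mean curvature `H` with respect to the unit normal `n`, so that `ℍ = H n`. -/
def meanCurvature (ι : S → M) (x : S) (n : TangentSpace (𝓡 3) (ι x)) : ℝ :=
  ⟪meanCurvatureVector (𝓡 3) (𝓡 2) ι x, n⟫_ℝ

end Contact

end RiemGeom

end

open RiemGeom

noncomputable section

namespace RiemGeom

set_option linter.unusedSectionVars false

section AlongCalculus

variable {E : Type*} [NormedAddCommGroup E] [NormedSpace ℝ E] [FiniteDimensional ℝ E]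
  {H : Type*} [TopologicalSpace H] {I : ModelWithCorners ℝ E H}
  {M : Type*} [TopologicalSpace M] [ChartedSpace H M] [IsManifold I ∞ M]

variable (I) in
/-- The section of the tangent bundle that is constant equal to `a` in the trivialization at `p`. -/
def frameField (p : M) (a : E) (z : M) : TangentSpace I z :=
  (trivializationAt E (TangentSpace I : M → Type _) p).symmL ℝ z a

variable (I) in
/-- The coordinates of tangent vectors in the trivialization at `p`. -/
def coordAt (p : M) (z : M) : TangentSpace I z →L[ℝ] E :=
  (trivializationAt E (TangentSpace I : M → Type _) p).continuousLinearMapAt ℝ z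

theorem baseSet_mem_nhds (p : M) :
    (trivializationAt E (TangentSpace I : M → Type _) p).baseSet ∈ 𝓝 p :=
  (trivializationAt E (TangentSpace I : M → Type _) p).open_baseSet.mem_nhds
    (mem_baseSet_trivializationAt' p)

theorem coordAt_apply {p z : M} (hz : z ∈ (trivializationAt E (TangentSpace I : M → Type _) p).baseSet)
    (v : TangentSpace I z) :
    coordAt I p z v = ((trivializationAt E (TangentSpace I : M → Type _) p) ⟨z, v⟩).2 := by
  rw [coordAt, Trivialization.continuousLinearMapAt_apply, Trivialization.coe_linearMapAt_of_mem _ hz]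

theorem frameField_coordAt {p z : M}
    (hz : z ∈ (trivializationAt E (TangentSpace I : M → Type _) p).baseSet) (v : TangentSpace I z) :
    frameField I p (coordAt I p z v) z = v :=
  Trivialization.symmL_continuousLinearMapAt _ hz v

theorem coordAt_frameField {p z : M}
    (hz : z ∈ (trivializationAt E (TangentSpace I : M → Type _) p).baseSet) (a : E) :
    coordAt I p z (frameField I p a z) = a :=
  Trivialization.continuousLinearMapAt_symmL _ hz a

theorem frameField_add (p : M) (a b : E) :
    frameField I p (a + b) = frameField I p a + frameField I p b := by
  ext z; simp [frameField]

theorem frameField_smul (p : M) (c : ℝ) (a : E) :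
    frameField I p (c • a) = c • frameField I p a := by
  ext z; simp [frameField]

theorem frameField_smul_apply (p : M) (c : ℝ) (a : E) (z : M) :
    frameField I p (c • a) z = c • frameField I p a z := by
  simp [frameField]

theorem frameField_sum_apply {κ : Type*} (s : Finset κ) (p : M) (a : κ → E) (z : M) :
    frameField I p (∑ i ∈ s, a i) z = ∑ i ∈ s, frameField I p (a i) z := by
  simp [frameField]

theorem contMDiffOn_frameField (p : M) (a : E) :
    ContMDiffOn I I.tangent ∞ (fun z => (⟨z, frameField I p a z⟩ : TangentBundle I M))
      (trivializationAt E (TangentSpace I : M → Type _) p).baseSet := by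
  have h : ContMDiffOn I I.tangent ∞
      (T% (fun z => frameField I p a z))
      (trivializationAt E (TangentSpace I : M → Type _) p).baseSet := by
    rw [Trivialization.contMDiffOn_section_baseSet_iff]
    refine (contMDiffOn_const (c := a)).congr fun z hz => ?_
    rw [← coordAt_apply hz, coordAt_frameField hz]
  exact h

theorem contMDiffAt_frameField {p z : M}
    (hz : z ∈ (trivializationAt E (TangentSpace I : M → Type _) p).baseSet) (a : E) :
    ContMDiffAt I I.tangent ∞ (fun z => (⟨z, frameField I p a z⟩ : TangentBundle I M)) z :=
  (contMDiffOn_frameField p a).contMDiffAt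
    ((trivializationAt E (TangentSpace I : M → Type _) p).open_baseSet.mem_nhds hz)

theorem extend_eventuallyEq_frameField {p : M} (v : TangentSpace I p) :
    (FiberBundle.extend E v : Π z : M, TangentSpace I z) =ᶠ[𝓝 p] frameField I p (coordAt I p p v) := by
  filter_upwards [baseSet_mem_nhds (I := I) p] with z hz
  rw [coordAt_apply (mem_baseSet_trivializationAt' p)]
  exact (Trivialization.symmL_apply (R := ℝ) _ hz _).symm

variable {F : Type*} [NormedAddCommGroup F] [NormedSpace ℝ F]
  {G : Type*} [TopologicalSpace G] {J : ModelWithCorners ℝ F G}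
  {N : Type*} [TopologicalSpace N] [ChartedSpace G N]

variable (I J) in
/-- The section `V` of `f^*TM` is smooth at `x`. -/
def SmoothAlong (f : N → M)
    (V : Π x : N, TangentSpace I (f x)) (x : N) : Prop :=
  ContMDiffAt J I.tangent ∞ (fun y => (⟨f y, V y⟩ : TangentBundle I M)) x

theorem smoothAlong_iff {f : N → M} {V : Π x : N, TangentSpace I (f x)} {x : N} :
    SmoothAlong I J f V x ↔
      ContMDiffAt J I ∞ f x ∧ ContMDiffAt J 𝓘(ℝ, E) ∞ (fun y => coordAt I (f x) (f y) (V y)) x := by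
  rw [SmoothAlong, contMDiffAt_totalSpace]
  refine and_congr_right fun h => ?_
  refine Filter.EventuallyEq.contMDiffAt_iff ?_
  filter_upwards [h.continuousAt (baseSet_mem_nhds (I := I) (f x))] with y hy
  exact (coordAt_apply hy _).symm

theorem SmoothAlong.base {f : N → M} {V : Π x : N, TangentSpace I (f x)} {x : N}
    (h : SmoothAlong I J f V x) : ContMDiffAt J I ∞ f x := (smoothAlong_iff.1 h).1

theorem SmoothAlong.coord {f : N → M} {V : Π x : N, TangentSpace I (f x)} {x : N}
    (h : SmoothAlong I J f V x) :
    ContMDiffAt J 𝓘(ℝ, E) ∞ (fun y => coordAt I (f x) (f y) (V y)) x := (smoothAlong_iff.1 h).2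

theorem SmoothAlong.congr {f : N → M} {V W : Π x : N, TangentSpace I (f x)} {x : N}
    (h : SmoothAlong I J f V x) (hVW : ∀ᶠ y in 𝓝 x, W y = V y) : SmoothAlong I J f W x :=
  ContMDiffAt.congr_of_eventuallyEq h (hVW.mono fun y hy => by simp [hy])

theorem SmoothAlong.add {f : N → M} {V W : Π x : N, TangentSpace I (f x)} {x : N}
    (hV : SmoothAlong I J f V x) (hW : SmoothAlong I J f W x) :
    SmoothAlong I J f (fun y => V y + W y) x :=
  smoothAlong_iff.2 ⟨hV.base, by
    simp only [map_add]; exact hV.coord.add hW.coord⟩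

theorem SmoothAlong.smul {f : N → M} {V : Π x : N, TangentSpace I (f x)} {x : N} {a : N → ℝ}
    (ha : ContMDiffAt J 𝓘(ℝ, ℝ) ∞ a x) (hV : SmoothAlong I J f V x) :
    SmoothAlong I J f (fun y => a y • V y) x :=
  smoothAlong_iff.2 ⟨hV.base, by
    simp only [map_smul]; exact ha.smul hV.coord⟩

theorem SmoothAlong.const_smul {f : N → M} {V : Π x : N, TangentSpace I (f x)} {x : N} (a : ℝ)
    (hV : SmoothAlong I J f V x) : SmoothAlong I J f (fun y => a • V y) x :=
  hV.smul contMDiffAt_const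

theorem SmoothAlong.neg {f : N → M} {V : Π x : N, TangentSpace I (f x)} {x : N}
    (hV : SmoothAlong I J f V x) : SmoothAlong I J f (fun y => -V y) x := by
  simpa using hV.const_smul (-1)

theorem SmoothAlong.sub {f : N → M} {V W : Π x : N, TangentSpace I (f x)} {x : N}
    (hV : SmoothAlong I J f V x) (hW : SmoothAlong I J f W x) :
    SmoothAlong I J f (fun y => V y - W y) x := by
  simpa [sub_eq_add_neg] using hV.add hW.neg

theorem smoothAlong_zero {f : N → M} {x : N} (hf : ContMDiffAt J I ∞ f x) :
    SmoothAlong I J f (fun y => (0 : TangentSpace I (f y))) x :=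
  smoothAlong_iff.2 ⟨hf, by simpa using contMDiffAt_const⟩

theorem SmoothAlong.sum {κ : Type*} (s : Finset κ) {f : N → M}
    {V : κ → Π x : N, TangentSpace I (f x)} {x : N} (hf : ContMDiffAt J I ∞ f x)
    (hV : ∀ i ∈ s, SmoothAlong I J f (V i) x) :
    SmoothAlong I J f (fun y => ∑ i ∈ s, V i y) x := by
  classical
  induction s using Finset.induction_on with
  | empty => simpa using smoothAlong_zero hf
  | insert i s hi ih =>
    simp only [Finset.sum_insert hi]
    exact (hV i (by simp)).add (ih fun j hj => hV j (by simp [hj]))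

theorem SmoothAlong.comp_section {f : N → M} {Y : Π z : M, TangentSpace I z} {x : N}
    (hf : ContMDiffAt J I ∞ f x)
    (hY : ContMDiffAt I I.tangent ∞ (fun z => (⟨z, Y z⟩ : TangentBundle I M)) (f x)) :
    SmoothAlong I J f (fun y => Y (f y)) x :=
  ContMDiffAt.comp x hY hf

/-- Local expansion of a section along a map in a frame of the ambient manifold. -/
theorem eventually_eq_sum_frameField {f : N → M} {x : N} (hf : ContinuousAt f x)
    (V : Π x : N, TangentSpace I (f x)) :
    ∀ᶠ y in 𝓝 x, V y = ∑ i, (Module.finBasis ℝ E).repr (coordAt I (f x) (f y) (V y)) i •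
      frameField I (f x) (Module.finBasis ℝ E i) (f y) := by
  filter_upwards [hf (baseSet_mem_nhds (I := I) (f x))] with y hy
  simp_rw [← frameField_smul_apply]
  rw [← frameField_sum_apply, (Module.finBasis ℝ E).sum_repr, frameField_coordAt hy]

theorem contMDiffAt_repr {g : N → E} {x : N} (hg : ContMDiffAt J 𝓘(ℝ, E) ∞ g x)
    (i : Fin (Module.finrank ℝ E)) :
    ContMDiffAt J 𝓘(ℝ, ℝ) ∞ (fun y => (Module.finBasis ℝ E).repr (g y) i) x := by
  let L : E →L[ℝ] ℝ := LinearMap.toContinuousLinearMap ((Module.finBasis ℝ E).coord i)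
  exact L.contMDiff.contMDiffAt.comp x hg

/-- Smooth sections along `f` are generated by the restrictions of the frame fields. -/
theorem SmoothAlong.induction_frame {f : N → M} {x : N} {P : (Π y : N, TangentSpace I (f y)) → Prop}
    (congr : ∀ V W, SmoothAlong I J f V x → (∀ᶠ y in 𝓝 x, W y = V y) → P V → P W)
    (hadd : ∀ V W, SmoothAlong I J f V x → SmoothAlong I J f W x → P V → P W →
      P (fun y => V y + W y))
    (smul : ∀ (a : N → ℝ) V, ContMDiffAt J 𝓘(ℝ, ℝ) ∞ a x → SmoothAlong I J f V x → P V →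
      P (fun y => a y • V y))
    (frame : ∀ a : E, P (fun y => frameField I (f x) a (f y)))
    {V : Π y : N, TangentSpace I (f y)} (hV : SmoothAlong I J f V x) : P V := by
  classical
  have hf := hV.base
  have hfr : ∀ i, SmoothAlong I J f (fun y => frameField I (f x) (Module.finBasis ℝ E i) (f y)) x :=
    fun i => .comp_section hf (contMDiffAt_frameField (mem_baseSet_trivializationAt' (f x)) _)
  have hc : ∀ i, ContMDiffAt J 𝓘(ℝ, ℝ) ∞
      (fun y => (Module.finBasis ℝ E).repr (coordAt I (f x) (f y) (V y)) i) x :=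
    fun i => contMDiffAt_repr hV.coord i
  have hterm : ∀ i, SmoothAlong I J f (fun y =>
      (Module.finBasis ℝ E).repr (coordAt I (f x) (f y) (V y)) i •
      frameField I (f x) (Module.finBasis ℝ E i) (f y)) x := fun i => (hfr i).smul (hc i)
  have key : ∀ s : Finset (Fin (Module.finrank ℝ E)), P (fun y => ∑ i ∈ s,
      (Module.finBasis ℝ E).repr (coordAt I (f x) (f y) (V y)) i •
      frameField I (f x) (Module.finBasis ℝ E i) (f y)) := by
    intro s
    induction s using Finset.induction_on with
    | empty =>
      simp only [Finset.sum_empty]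
      convert frame 0 using 2
      simp [frameField]
    | insert i s hi ih =>
      simp only [Finset.sum_insert hi]
      refine hadd _ _ (hterm i) (.sum s hf fun j _ => hterm j) (smul _ _ (hc i) (hfr i) (frame _)) ih
  exact congr _ _ (.sum _ hf fun j _ => hterm j)
    (eventually_eq_sum_frameField hf.continuousAt V) (key Finset.univ)

/-- Smooth sections along `f` are generated by the restrictions of smooth vector fields. -/
theorem SmoothAlong.induction {f : N → M} {x : N} {P : (Π y : N, TangentSpace I (f y)) → Prop}
    (congr : ∀ V W, SmoothAlong I J f V x → (∀ᶠ y in 𝓝 x, W y = V y) → P V → P W)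
    (hadd : ∀ V W, SmoothAlong I J f V x → SmoothAlong I J f W x → P V → P W →
      P (fun y => V y + W y))
    (smul : ∀ (a : N → ℝ) V, ContMDiffAt J 𝓘(ℝ, ℝ) ∞ a x → SmoothAlong I J f V x → P V →
      P (fun y => a y • V y))
    (comp : ∀ Y : Π z : M, TangentSpace I z,
      (∀ᶠ z in 𝓝 (f x), ContMDiffAt I I.tangent ∞ (fun z => (⟨z, Y z⟩ : TangentBundle I M)) z) →
      P (fun y => Y (f y)))
    {V : Π y : N, TangentSpace I (f y)} (hV : SmoothAlong I J f V x) : P V := by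
  refine hV.induction_frame congr hadd smul fun a => comp _ ?_
  filter_upwards [baseSet_mem_nhds (I := I) (f x)] with z hz
  exact contMDiffAt_frameField hz _

theorem mdiffAt_section {X : Π z : M, TangentSpace I z} {p : M}
    (hX : ContMDiffAt I I.tangent ∞ (fun z => (⟨z, X z⟩ : TangentBundle I M)) p) :
    MDiffAt (T% X) p := ContMDiffAt.mdifferentiableAt hX (by simp)

end AlongCalculus

section AlongCov

variable {E : Type*} [NormedAddCommGroup E] [NormedSpace ℝ E] [FiniteDimensional ℝ E]
  {H : Type*} [TopologicalSpace H] {I : ModelWithCorners ℝ E H}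
  {M : Type*} [TopologicalSpace M] [ChartedSpace H M] [IsManifold I ∞ M]
  [RiemannianBundle (fun x : M => TangentSpace I x)]
  [IsContMDiffRiemannianBundle I ∞ E (fun x : M => TangentSpace I x)]
  {F : Type*} [NormedAddCommGroup F] [NormedSpace ℝ F] [FiniteDimensional ℝ F]
  {G : Type*} [TopologicalSpace G] {J : ModelWithCorners ℝ F G}
  {N : Type*} [TopologicalSpace N] [ChartedSpace G N]

theorem leviCivita_congr {X Y : Π z : M, TangentSpace I z} {p : M} (hX : MDiffAt (T% X) p)
    (h : X =ᶠ[𝓝 p] Y) : leviCivita I M X p = leviCivita I M Y p :=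
  (leviCivita I M).isCovariantDerivativeOnUniv.congr_of_eventuallyEq hX
    (hX.congr_of_eventuallyEq (f₁ := T% Y) (h.mono fun y hy => by simp [hy])) Filter.univ_mem h

theorem mdiffAt_frameField {p z : M}
    (hz : z ∈ (trivializationAt E (TangentSpace I : M → Type _) p).baseSet) (a : E) :
    MDiffAt (T% (frameField I p a)) z :=
  (contMDiffAt_frameField hz a).mdifferentiableAt (by simp)

theorem leviCivita_extend {p : M} (v : TangentSpace I p) :
    leviCivita I M (FiberBundle.extend E v) p =
      leviCivita I M (frameField I p (coordAt I p p v)) p :=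
  leviCivita_congr (mdifferentiableAt_extend ..) (extend_eventuallyEq_frameField v)

theorem covAlong_eq {f : N → M} {V : Π x : N, TangentSpace I (f x)} {x : N}
    (hf : ContinuousAt f x) (v : TangentSpace J x) :
    covAlong I J f V x v =
      frameField I (f x) (d% (fun y => coordAt I (f x) (f y) (V y)) x v) (f x) +
        leviCivita I M (frameField I (f x) (coordAt I (f x) (f x) (V x))) (f x)
          (mfderiv J I f x v) := by
  have : d% (fun y => ((trivializationAt E (TangentSpace I : M → Type _) (f x)) ⟨f y, V y⟩).2) x
      = d% (fun y => coordAt I (f x) (f y) (V y)) x := by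
    apply Filter.EventuallyEq.mfderiv_eq
    filter_upwards [hf (baseSet_mem_nhds (I := I) (f x))] with y hy
    exact (coordAt_apply hy _).symm
  rw [← leviCivita_extend, ← this]
  rfl

theorem covAlong_congr {f : N → M} {V W : Π x : N, TangentSpace I (f x)} {x : N}
    (h : ∀ᶠ y in 𝓝 x, V y = W y) : covAlong I J f V x = covAlong I J f W x := by
  have h1 : d% (fun y => ((trivializationAt E (TangentSpace I : M → Type _) (f x)) ⟨f y, V y⟩).2) x
      = d% (fun y => ((trivializationAt E (TangentSpace I : M → Type _) (f x)) ⟨f y, W y⟩).2) x :=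
    Filter.EventuallyEq.mfderiv_eq (h.mono fun y hy => by simp [hy])
  simp only [covAlong, h1, h.self_of_nhds]

theorem SmoothAlong.mdiff_coord {f : N → M} {V : Π x : N, TangentSpace I (f x)} {x : N}
    (h : SmoothAlong I J f V x) : MDiffAt (fun y => coordAt I (f x) (f y) (V y)) x :=
  h.coord.mdifferentiableAt (by simp)

theorem covAlong_add {f : N → M} {V W : Π x : N, TangentSpace I (f x)} {x : N}
    (hV : SmoothAlong I J f V x) (hW : SmoothAlong I J f W x) :
    covAlong I J f (fun y => V y + W y) x = covAlong I J f V x + covAlong I J f W x := by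
  have hb := mem_baseSet_trivializationAt' (F := E) (E := (TangentSpace I : M → Type _)) (f x)
  ext v
  rw [add_apply, covAlong_eq hV.base.continuousAt, covAlong_eq hV.base.continuousAt,
    covAlong_eq hV.base.continuousAt]
  simp only [map_add]
  rw [mvfderiv_fun_add hV.mdiff_coord hW.mdiff_coord, frameField_add,
    (leviCivita I M).isCovariantDerivativeOnUniv.add (mdiffAt_frameField hb _)
      (mdiffAt_frameField hb _)]
  simp only [add_apply, frameField_add, Pi.add_apply]
  abel

theorem covAlong_smul {f : N → M} {V : Π x : N, TangentSpace I (f x)} {x : N} {a : N → ℝ}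
    (ha : ContMDiffAt J 𝓘(ℝ, ℝ) ∞ a x) (hV : SmoothAlong I J f V x) (v : TangentSpace J x) :
    covAlong I J f (fun y => a y • V y) x v = d% a x v • V x + a x • covAlong I J f V x v := by
  have hb := mem_baseSet_trivializationAt' (F := E) (E := (TangentSpace I : M → Type _)) (f x)
  rw [covAlong_eq hV.base.continuousAt, covAlong_eq hV.base.continuousAt]
  simp only [map_smul]
  rw [mvfderiv_fun_smul (ha.mdifferentiableAt (by simp)) hV.mdiff_coord, frameField_smul,
    (leviCivita I M).isCovariantDerivativeOnUniv.smul_const _ (mdiffAt_frameField hb _)]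
  simp only [add_apply, smul_apply, ContinuousLinearMap.smulRight_apply, frameField_add,
    Pi.add_apply, frameField_smul_apply, frameField_coordAt hb, smul_add]
  abel

theorem covAlong_const_smul {f : N → M} {V : Π x : N, TangentSpace I (f x)} {x : N} (a : ℝ)
    (hV : SmoothAlong I J f V x) (v : TangentSpace J x) :
    covAlong I J f (fun y => a • V y) x v = a • covAlong I J f V x v := by
  rw [covAlong_smul contMDiffAt_const hV, mvfderiv_const]; simp

theorem covAlong_zero {f : N → M} {x : N} (hf : ContMDiffAt J I ∞ f x) :
    covAlong I J f (fun y => (0 : TangentSpace I (f y))) x = 0 := by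
  ext v
  simpa using covAlong_const_smul 0 (smoothAlong_zero hf) v

theorem covAlong_id {X : Π z : M, TangentSpace I z} {p : M}
    (hX : ContMDiffAt I I.tangent ∞ (fun z => (⟨z, X z⟩ : TangentBundle I M)) p) :
    covAlong I I (fun z : M => z) X p = leviCivita I M X p := by
  have hb := mem_baseSet_trivializationAt' (F := E) (E := (TangentSpace I : M → Type _)) p
  have hX' : SmoothAlong I I (fun z : M => z) X p := hX
  refine hX'.induction_frame (P := fun X => covAlong I I (fun z : M => z) X p = leviCivita I M X p)
    (fun V W hV h ih => ?_) (fun V W hV hW ihV ihW => ?_) (fun a V ha hV ih => ?_) fun a => ?_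
  · rw [covAlong_congr h, ih]
    exact leviCivita_congr (mdiffAt_section hV) (h.mono fun y hy => hy.symm)
  · rw [covAlong_add hV hW, ihV, ihW]
    exact ((leviCivita I M).isCovariantDerivativeOnUniv.add (mdiffAt_section hV)
      (mdiffAt_section hW)).symm
  · ext v
    rw [covAlong_smul ha hV, ih]
    have := (leviCivita I M).isCovariantDerivativeOnUniv.leibniz (mdiffAt_section hV)
      (ha.mdifferentiableAt (by simp)) (mem_univ p)
    have h2 := congrArg (fun L => L v) this
    refine Eq.trans ?_ h2.symm
    simp only [add_apply, smul_apply, ContinuousLinearMap.smulRight_apply]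
    abel
  · ext v
    rw [covAlong_eq (f := fun z : M => z) continuousAt_id]
    have : d% (fun y => coordAt I p y (frameField I p a y)) p = 0 := by
      rw [← mvfderiv_const a]
      apply Filter.EventuallyEq.mfderiv_eq
      filter_upwards [baseSet_mem_nhds (I := I) p] with y hy
      exact coordAt_frameField hy a
    have h2 : mfderiv I I (fun z : M => z) p = ContinuousLinearMap.id ℝ _ := mfderiv_id
    have h0 : frameField I p (0 : E) p = 0 := by simp [frameField]
    rw [this, coordAt_frameField hb, h2, zero_apply, h0, zero_add]
    rfl

theorem covAlong_comp_map {N' : Type*} [TopologicalSpace N'] {F' : Type*} [NormedAddCommGroup F']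
    [NormedSpace ℝ F'] [FiniteDimensional ℝ F'] {G' : Type*} [TopologicalSpace G'] {J' : ModelWithCorners ℝ F' G'}
    [ChartedSpace G' N'] {f : N → M} {V : Π x : N, TangentSpace I (f x)} {h : N' → N} {x : N'}
    (hh : MDiffAt h x) (hV : SmoothAlong I J f V (h x)) (v : TangentSpace J' x) :
    covAlong I J' (fun y => f (h y)) (fun y => V (h y)) x v =
      covAlong I J f V (h x) (mfderiv J' J h x v) := by
  rw [covAlong_eq hV.base.continuousAt,
    covAlong_eq (f := fun y => f (h y)) (hV.base.continuousAt.comp (f := h) hh.continuousAt)]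
  have h1 := mfderiv_comp_apply x (f := h) hV.mdiff_coord hh v
  have h2 := mfderiv_comp_apply x (f := h) (hV.base.mdifferentiableAt (by simp)) hh v
  congr 1
  · congr 1
  · congr 1

theorem covAlong_comp_section {f : N → M} {Y : Π z : M, TangentSpace I z} {x : N}
    (hf : MDiffAt f x)
    (hY : ContMDiffAt I I.tangent ∞ (fun z => (⟨z, Y z⟩ : TangentBundle I M)) (f x))
    (v : TangentSpace J x) :
    covAlong I J f (fun y => Y (f y)) x v = leviCivita I M Y (f x) (mfderiv J I f x v) := by
  rw [← covAlong_id hY]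
  exact covAlong_comp_map (f := fun z : M => z) (V := Y) hf hY v

end AlongCov

section AlongMetric

variable {E : Type*} [NormedAddCommGroup E] [NormedSpace ℝ E] [FiniteDimensional ℝ E]
  {H : Type*} [TopologicalSpace H] {I : ModelWithCorners ℝ E H}
  {M : Type*} [TopologicalSpace M] [ChartedSpace H M] [IsManifold I ∞ M]
  [RiemannianBundle (fun x : M => TangentSpace I x)]
  [IsContMDiffRiemannianBundle I ∞ E (fun x : M => TangentSpace I x)]
  {F : Type*} [NormedAddCommGroup F] [NormedSpace ℝ F] [FiniteDimensional ℝ F]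
  {G : Type*} [TopologicalSpace G] {J : ModelWithCorners ℝ F G}
  {N : Type*} [TopologicalSpace N] [ChartedSpace G N]

theorem SmoothAlong.inner {f : N → M} {V W : Π x : N, TangentSpace I (f x)} {x : N}
    (hV : SmoothAlong I J f V x) (hW : SmoothAlong I J f W x) :
    ContMDiffAt J 𝓘(ℝ, ℝ) ∞ (fun y => ⟪V y, W y⟫_ℝ) x :=
  ContMDiffAt.inner_bundle (E := fun x : M => TangentSpace I x) (F := E) (b := f) hV hW

/-- The pulled back connection is metric. -/
theorem mvfderiv_inner_along {f : N → M} {V W : Π x : N, TangentSpace I (f x)} {x : N}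
    (hV : SmoothAlong I J f V x) (hW : SmoothAlong I J f W x) (v : TangentSpace J x) :
    d% (fun y => ⟪V y, W y⟫_ℝ) x v =
      ⟪covAlong I J f V x v, W x⟫_ℝ + ⟪V x, covAlong I J f W x v⟫_ℝ := by
  have hf := hV.base
  have hfd : MDiffAt f x := hf.mdifferentiableAt (by simp)
  have md : ∀ {V W : Π x : N, TangentSpace I (f x)}, SmoothAlong I J f V x →
      SmoothAlong I J f W x → MDiffAt (fun y => ⟪V y, W y⟫_ℝ) x :=
    fun hV hW => (hV.inner hW).mdifferentiableAt (by simp)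
  refine hV.induction (P := fun V => d% (fun y => ⟪V y, W y⟫_ℝ) x v =
      ⟪covAlong I J f V x v, W x⟫_ℝ + ⟪V x, covAlong I J f W x v⟫_ℝ)
    (fun V V' hV h ih => ?_) (fun V V' hV hV' ih ih' => ?_) (fun a V ha hV ih => ?_) fun Y hY => ?_
  · rw [covAlong_congr h, h.self_of_nhds, ← ih]
    congr 1
    exact Filter.EventuallyEq.mfderiv_eq (h.mono fun y hy => by simp [hy])
  · simp only [inner_add_left]
    rw [mvfderiv_fun_add (md hV hW) (md hV' hW), covAlong_add hV hV']
    simp only [add_apply, inner_add_left, ih, ih']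
    ring
  · simp only [real_inner_smul_left]
    rw [mvfderiv_fun_mul (ha.mdifferentiableAt (by simp)) (md hV hW), covAlong_smul ha hV]
    simp only [add_apply, smul_apply, inner_add_left, real_inner_smul_left, ih, smul_eq_mul]
    ring
  · have hYs := SmoothAlong.comp_section hf hY.self_of_nhds
    refine hW.induction (P := fun W => d% (fun y => ⟪Y (f y), W y⟫_ℝ) x v =
        ⟪covAlong I J f (fun y => Y (f y)) x v, W x⟫_ℝ + ⟪Y (f x), covAlong I J f W x v⟫_ℝ)
      (fun V V' hV h ih => ?_) (fun V V' hV hV' ih ih' => ?_) (fun a V ha hV ih => ?_)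
      fun Z hZ => ?_
    · rw [covAlong_congr h, h.self_of_nhds, ← ih]
      congr 1
      exact Filter.EventuallyEq.mfderiv_eq (h.mono fun y hy => by simp [hy])
    · simp only [inner_add_right]
      rw [mvfderiv_fun_add (md hYs hV) (md hYs hV'), covAlong_add hV hV']
      simp only [add_apply, inner_add_right, ih, ih']
      ring
    · simp only [real_inner_smul_right]
      rw [mvfderiv_fun_mul (ha.mdifferentiableAt (by simp)) (md hYs hV), covAlong_smul ha hV]
      simp only [add_apply, smul_apply, inner_add_right, real_inner_smul_right, ih, smul_eq_mul]
      ring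
    · have hYd := mdiffAt_section hY.self_of_nhds
      have hZd := mdiffAt_section hZ.self_of_nhds
      rw [covAlong_comp_section hfd hY.self_of_nhds, covAlong_comp_section hfd hZ.self_of_nhds]
      have h1 := mvfderiv_comp_apply x (mdiff_inner hYd hZd) hfd v
      have h2 := leviCivita_metric (X := FiberBundle.extend E (mfderiv J I f x v))
        (mdifferentiableAt_extend ..) hYd hZd
      simp only [extend_apply_self] at h2
      exact h1.trans h2

/-- A section along `f` is smooth if its inner products with smooth vector fields are. -/
theorem smoothAlong_of_inner {f : N → M} {V : Π x : N, TangentSpace I (f x)} {x : N}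
    (hf : ContMDiffAt J I ∞ f x)
    (h : ∀ Y : Π z : M, TangentSpace I z,
      (∀ᶠ z in 𝓝 (f x), ContMDiffAt I I.tangent ∞ (fun z => (⟨z, Y z⟩ : TangentBundle I M)) z) →
      ContMDiffAt J 𝓘(ℝ, ℝ) ∞ (fun y => ⟪V y, Y (f y)⟫_ℝ) x) :
    SmoothAlong I J f V x := by
  classical
  set b := Module.finBasis ℝ E with hbdef
  set p := f x with hp
  have hbase := mem_baseSet_trivializationAt' (F := E) (E := (TangentSpace I : M → Type _)) p
  let dual : Fin (Module.finrank ℝ E) → (E →L[ℝ] ℝ) := fun i =>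
    LinearMap.toContinuousLinearMap (b.coord i)
  have hdual : ∀ i c, dual i c = b.repr c i := fun i c => rfl
  let e : Fin (Module.finrank ℝ E) → Π z : M, TangentSpace I z := fun i => frameField I p (b i)
  have he : ∀ i, ContMDiffAt I I.tangent ∞ (fun z => (⟨z, e i z⟩ : TangentBundle I M)) p :=
    fun i => contMDiffAt_frameField hbase _
  have hev : ∀ i, ∀ᶠ z in 𝓝 p,
      ContMDiffAt I I.tangent ∞ (fun z => (⟨z, e i z⟩ : TangentBundle I M)) z := fun i => by
    filter_upwards [baseSet_mem_nhds (I := I) p] with z hz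
    exact contMDiffAt_frameField hz _
  let gram : M → (E →L[ℝ] (E →L[ℝ] ℝ)) := fun z =>
    ∑ i, ∑ j, ⟪e i z, e j z⟫_ℝ • (dual i).smulRight (dual j)
  have hgram_apply : ∀ z a c, gram z a c = ⟪frameField I p a z, frameField I p c z⟫_ℝ := by
    intro z a c
    have ha : frameField I p a z = ∑ i, b.repr a i • e i z := by
      conv_lhs => rw [← b.sum_repr a, frameField_sum_apply]
      simp only [frameField_smul_apply, e]
    have hc : frameField I p c z = ∑ i, b.repr c i • e i z := by
      conv_lhs => rw [← b.sum_repr c, frameField_sum_apply]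
      simp only [frameField_smul_apply, e]
    rw [ha, hc]
    simp only [gram, sum_apply, smul_apply,
      ContinuousLinearMap.smulRight_apply, sum_inner, inner_sum, real_inner_smul_left,
      real_inner_smul_right, hdual, smul_eq_mul]
    rw [Finset.sum_comm]
    exact Finset.sum_congr rfl fun i _ => Finset.sum_congr rfl fun j _ => by ring
  have hgram : ContMDiffAt I 𝓘(ℝ, E →L[ℝ] (E →L[ℝ] ℝ)) ∞ gram p := by
    refine ContMDiffAt.sum fun i _ => ContMDiffAt.sum fun j _ => ?_
    have h1 : ContMDiffAt I 𝓘(ℝ, ℝ) ∞ (fun z => ⟪e i z, e j z⟫_ℝ) p :=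
      ContMDiffAt.inner_bundle (E := fun x : M => TangentSpace I x) (F := E) (b := id)
        (he i) (he j)
    exact h1.smul contMDiffAt_const
  let ℓ : N → (E →L[ℝ] ℝ) := fun y => ∑ j, ⟪V y, e j (f y)⟫_ℝ • dual j
  have hℓ : ContMDiffAt J 𝓘(ℝ, E →L[ℝ] ℝ) ∞ ℓ x :=
    ContMDiffAt.sum fun j _ => ContMDiffAt.smul (h (e j) (hev j)) contMDiffAt_const
  have hinj : ∀ z ∈ (trivializationAt E (TangentSpace I : M → Type _) p).baseSet,
      Function.Injective (gram z) := by
    intro z hz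
    refine (injective_iff_map_eq_zero _).2 fun a ha => ?_
    have : gram z a a = 0 := by rw [ha]; rfl
    rw [hgram_apply, inner_self_eq_zero] at this
    rw [← coordAt_frameField hz a, this, map_zero]
  have hequiv : ∀ z ∈ (trivializationAt E (TangentSpace I : M → Type _) p).baseSet,
      ∃ A : E ≃L[ℝ] (E →L[ℝ] ℝ), (A : E →L[ℝ] (E →L[ℝ] ℝ)) = gram z := by
    intro z hz
    have hdim : Module.finrank ℝ E = Module.finrank ℝ (E →L[ℝ] ℝ) := by
      rw [← (LinearMap.toContinuousLinearMap : (E →ₗ[ℝ] ℝ) ≃ₗ[ℝ] _).finrank_eq]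
      exact (Subspace.dual_finrank_eq (K := ℝ) (V := E)).symm
    refine ⟨(LinearEquiv.ofInjectiveOfFinrankEq (gram z : E →ₗ[ℝ] (E →L[ℝ] ℝ)) (hinj z hz)
      hdim).toContinuousLinearEquiv, ?_⟩
    ext a : 1
    rfl
  have hVℓ : ∀ᶠ y in 𝓝 x, coordAt I p (f y) (V y) = (gram (f y)).inverse (ℓ y) := by
    filter_upwards [hf.continuousAt (baseSet_mem_nhds (I := I) p)] with y hy
    obtain ⟨A, hA⟩ := hequiv _ hy
    have h1 : gram (f y) (coordAt I p (f y) (V y)) = ℓ y := by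
      ext c
      rw [hgram_apply, frameField_coordAt hy]
      conv_lhs => rw [← b.sum_repr c, frameField_sum_apply]
      simp only [frameField_smul_apply, inner_sum, real_inner_smul_right, ℓ, hdual,
        sum_apply, smul_apply, smul_eq_mul, e]
      exact Finset.sum_congr rfl fun j _ => mul_comm _ _
    rw [← h1, ← hA, ContinuousLinearMap.inverse_equiv]
    exact (A.symm_apply_apply _).symm
  refine smoothAlong_iff.2 ⟨hf, ?_⟩
  refine ContMDiffAt.congr_of_eventuallyEq ?_ hVℓ
  obtain ⟨A, hA⟩ := hequiv p hbase
  have hinv : ContMDiffAt J 𝓘(ℝ, (E →L[ℝ] ℝ) →L[ℝ] E) ∞ (fun y => (gram (f y)).inverse) x := by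
    have h1 : ContDiffAt ℝ ∞ ContinuousLinearMap.inverse (gram (f x)) := by
      rw [← hp, ← hA]
      exact contDiffAt_map_inverse A
    exact h1.contMDiffAt.comp x (hgram.comp x hf)
  exact hinv.clm_apply hℓ

end AlongMetric

section Torsion

variable {F : Type*} [NormedAddCommGroup F] [NormedSpace ℝ F] [FiniteDimensional ℝ F]
  {G : Type*} [TopologicalSpace G] {J : ModelWithCorners ℝ F G} [J.Boundaryless]
  {N : Type*} [TopologicalSpace N] [ChartedSpace G N] [IsManifold J ∞ N]
  {E : Type*} [NormedAddCommGroup E] [NormedSpace ℝ E]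

/-- The representation of a vector field in the preferred chart at `x`. -/
theorem eventually_mfderiv_extChartAt_apply (V : Π y : N, TangentSpace J y) (x : N) :
    ∀ᶠ y in 𝓝 x, mfderiv J 𝓘(ℝ, F) (extChartAt J x) y (V y) =
      mpullbackWithin 𝓘(ℝ, F) J (extChartAt J x).symm V (range J) (extChartAt J x y) := by
  have h := eventuallyEq_mpullback_mpullbackWithin_extChartAt (I := J) (s := univ) (x := x) V
  rw [nhdsWithin_univ] at h
  filter_upwards [h, extChartAt_source_mem_nhds (I := J) x] with y hy hys
  obtain ⟨A, hA⟩ := isInvertible_mfderiv_extChartAt (I := J) hys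
  rw [mpullback_apply, ← hA, ContinuousLinearMap.inverse_equiv] at hy
  rw [← hA]
  exact (congrArg A hy).trans (A.apply_symm_apply _)

theorem mvfderiv_mvfderiv_sub {g : N → E} {U V : Π y : N, TangentSpace J y} {x : N}
    (hg : ContMDiffAt J 𝓘(ℝ, E) ∞ g x) (hU : MDiffAt (T% U) x) (hV : MDiffAt (T% V) x) :
    d% (fun y => d% g y (V y)) x (U x) - d% (fun y => d% g y (U y)) x (V x) =
      d% g x (mlieBracket J U V x) := by
  set φ := extChartAt J x with hφ
  set g' : F → E := g ∘ φ.symm with hg'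
  let hat : (Π y : N, TangentSpace J y) → F → F := fun W =>
    mpullbackWithin 𝓘(ℝ, F) J φ.symm W (range J)
  have hg's : ContDiffAt ℝ ∞ g' (φ x) := by
    have h := (contMDiffAt_iff.1 hg).2
    rw [J.range_eq_univ, contDiffWithinAt_univ] at h
    simpa only [extChartAt_model_space_eq_id, PartialEquiv.refl_coe, Function.id_comp] using h
  have hrange : φ.symm ⁻¹' univ ∩ range J = univ := by simp [J.range_eq_univ]
  have hφx : x ∈ φ.source := mem_extChartAt_source x
  have hdg : ∀ᶠ y in 𝓝 x, ∀ v : TangentSpace J y,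
      d% g y v = fderiv ℝ g' (φ y) (mfderiv J 𝓘(ℝ, F) φ y v) := by
    have h1 : ∀ᶠ q in 𝓝 (φ x), DifferentiableAt ℝ g' q := by
      have := (hg's.of_le (m := 1) (by norm_cast)).eventually (by simp)
      exact this.mono fun q hq => hq.differentiableAt (by simp)
    filter_upwards [(continuousAt_extChartAt (I := J) x).eventually h1,
      (isOpen_extChartAt_source (I := J) x).mem_nhds hφx] with y hy hys v
    have hφd : MDiffAt φ y := mdifferentiableAt_extChartAt (by rwa [← extChartAt_source (I := J)])
    have hc : g =ᶠ[𝓝 y] g' ∘ φ := by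
      filter_upwards [(isOpen_extChartAt_source (I := J) x).mem_nhds hys] with z hz
      exact congrArg g ((extChartAt J x).left_inv hz).symm
    have h2 : mfderiv J 𝓘(ℝ, E) g y = (mfderiv 𝓘(ℝ, F) 𝓘(ℝ, E) g' (φ y)).comp
        (mfderiv J 𝓘(ℝ, F) φ y) := by
      rw [hc.mfderiv_eq]
      exact mfderiv_comp y hy.mdifferentiableAt hφd
    have h3 : d% g y v = mfderiv J 𝓘(ℝ, E) g y v := rfl
    rw [h3, h2, mfderiv_eq_fderiv]
    rfl
  have hhat : ∀ W : Π y : N, TangentSpace J y, ∀ᶠ y in 𝓝 x,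
      d% g y (W y) = fderiv ℝ g' (φ y) (hat W (φ y)) := fun W => by
    filter_upwards [hdg, eventually_mfderiv_extChartAt_apply W x] with y h1 h2
    rw [h1, h2]
  have hdiff : ∀ W : Π y : N, TangentSpace J y, MDiffAt (T% W) x →
      DifferentiableAt ℝ (hat W) (φ x) := fun W hW => by
    rw [← mdifferentiableWithinAt_univ] at hW
    have h : DifferentiableWithinAt ℝ (hat W) (φ.symm ⁻¹' univ ∩ range J) (φ x) :=
      MDifferentiableWithinAt.differentiableWithinAt_mpullbackWithin_vectorField hW
    rw [hrange] at h
    exact differentiableWithinAt_univ.1 h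
  have hd2 : DifferentiableAt ℝ (fderiv ℝ g') (φ x) :=
    ((hg's.fderiv_right (m := 1) (by norm_cast)).differentiableAt (by simp))
  have main : ∀ W W' : Π y : N, TangentSpace J y, MDiffAt (T% W) x →
      d% (fun y => d% g y (W y)) x (W' x) =
        fderiv ℝ (fderiv ℝ g') (φ x) (hat W' (φ x)) (hat W (φ x)) +
          fderiv ℝ g' (φ x) (fderiv ℝ (hat W) (φ x) (hat W' (φ x))) := fun W W' hW => by
    have hφd : MDiffAt φ x := mdifferentiableAt_extChartAt (mem_chart_source G x)
    have hk : HasFDerivAt (fun q => fderiv ℝ g' q (hat W q)) _ (φ x) :=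
      hd2.hasFDerivAt.clm_apply (hdiff W hW).hasFDerivAt
    have h2 : mfderiv J 𝓘(ℝ, E) (fun y => d% g y (W y)) x =
        (mfderiv 𝓘(ℝ, F) 𝓘(ℝ, E) (fun q => fderiv ℝ g' q (hat W q)) (φ x)).comp
        (mfderiv J 𝓘(ℝ, F) φ x) := by
      rw [Filter.EventuallyEq.mfderiv_eq (hhat W)]
      exact mfderiv_comp x hk.differentiableAt.mdifferentiableAt hφd
    have h3 : d% (fun y => d% g y (W y)) x (W' x) =
      mfderiv J 𝓘(ℝ, E) (fun y => d% g y (W y)) x (W' x) := rfl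
    rw [h3, h2, mfderiv_eq_fderiv, hk.fderiv]
    have h4 := (eventually_mfderiv_extChartAt_apply W' x).self_of_nhds
    have h5 : mfderiv J 𝓘(ℝ, F) φ x (W' x) = hat W' (φ x) := h4
    change (fderiv ℝ g' (φ x) ∘SL fderiv ℝ (hat W) (φ x) +
      (fderiv ℝ (fderiv ℝ g') (φ x)).flip (hat W (φ x))) (mfderiv J 𝓘(ℝ, F) φ x (W' x)) = _
    rw [h5]
    exact add_comm _ _
  have hlie : mfderiv J 𝓘(ℝ, F) φ x (mlieBracket J U V x) =
      lieBracket ℝ (hat U) (hat V) (φ x) := by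
    obtain ⟨A, hA⟩ := isInvertible_mfderiv_extChartAt (I := J) hφx
    have h0 : lieBracketWithin ℝ (hat U) (hat V) (φ.symm ⁻¹' univ ∩ range J) (φ x) =
        lieBracket ℝ (hat U) (hat V) (φ x) := by rw [hrange, lieBracketWithin_univ]
    have h : mlieBracket J U V x = (mfderiv J 𝓘(ℝ, F) φ x).inverse
        (id (lieBracket ℝ (hat U) (hat V) (φ x) : F)) :=
      congrArg (mfderiv J 𝓘(ℝ, F) φ x).inverse h0
    rw [h, ← hA, ContinuousLinearMap.inverse_equiv]
    exact A.apply_symm_apply _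
  rw [main V U hV, main U V hU, hdg.self_of_nhds, hlie, lieBracket_eq, map_sub]
  have hsymm : IsSymmSndFDerivAt ℝ g' (φ x) :=
    hg's.isSymmSndFDerivAt (by simp only [minSmoothness_of_isRCLikeNormedField]; norm_cast)
  rw [hsymm.eq (hat U (φ x)) (hat V (φ x))]
  abel

end Torsion

section TorsionAlong

variable {E : Type*} [NormedAddCommGroup E] [NormedSpace ℝ E] [FiniteDimensional ℝ E]
  {H : Type*} [TopologicalSpace H] {I : ModelWithCorners ℝ E H} [I.Boundaryless]
  {M : Type*} [TopologicalSpace M] [ChartedSpace H M] [IsManifold I ∞ M]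
  [RiemannianBundle (fun x : M => TangentSpace I x)]
  [IsContMDiffRiemannianBundle I ∞ E (fun x : M => TangentSpace I x)]
  {F : Type*} [NormedAddCommGroup F] [NormedSpace ℝ F] [FiniteDimensional ℝ F]
  {G : Type*} [TopologicalSpace G] {J : ModelWithCorners ℝ F G} [J.Boundaryless]
  {N : Type*} [TopologicalSpace N] [ChartedSpace G N] [IsManifold J ∞ N]

theorem smoothAlong_mfderiv_of_eventually {f : N → M} {W : Π y : N, TangentSpace J y} {x : N}
    (hf : ∀ᶠ y in 𝓝 x, ContMDiffAt J I ∞ f y)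
    (hW : ContMDiffAt J J.tangent ∞ (fun y => (⟨y, W y⟩ : TangentBundle J N)) x) :
    SmoothAlong I J f (fun y => mfderiv J I f y (W y)) x := by
  obtain ⟨u, hu, huo, hxu⟩ := eventually_nhds_iff.1 hf
  have h1 : ContMDiffOn J I ∞ f u := fun y hy => (hu y hy).contMDiffWithinAt
  have h2 := h1.contMDiffOn_tangentMapWithin (m := ∞) (by simp) huo.uniqueMDiffOn
  have h3 : ContMDiffAt J.tangent I.tangent ∞ (tangentMapWithin J I f u) ⟨x, W x⟩ :=
    h2.contMDiffAt ((huo.preimage (FiberBundle.continuous_proj F _)).mem_nhds hxu)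
  have h4 : ContMDiffAt J I.tangent ∞
      (fun y => tangentMapWithin J I f u (⟨y, W y⟩ : TangentBundle J N)) x :=
    ContMDiffAt.comp x h3 hW
  refine h4.congr_of_eventuallyEq ?_
  filter_upwards [huo.mem_nhds hxu] with y hy
  simp only [tangentMapWithin]
  rw [mfderivWithin_of_isOpen huo hy]

theorem smoothAlong_mfderiv {f : N → M} (hf : ContMDiff J I ∞ f) {W : Π y : N, TangentSpace J y}
    {x : N} (hW : ContMDiffAt J J.tangent ∞ (fun y => (⟨y, W y⟩ : TangentBundle J N)) x) :
    SmoothAlong I J f (fun y => mfderiv J I f y (W y)) x :=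
  smoothAlong_mfderiv_of_eventually (.of_forall fun _ => hf.contMDiffAt) hW

theorem contMDiffAt_mvfderiv_apply {g : N → ℝ} {W : Π y : N, TangentSpace J y} {x : N}
    (hg : ∀ᶠ y in 𝓝 x, ContMDiffAt J 𝓘(ℝ, ℝ) ∞ g y)
    (hW : ContMDiffAt J J.tangent ∞ (fun y => (⟨y, W y⟩ : TangentBundle J N)) x) :
    ContMDiffAt J 𝓘(ℝ, ℝ) ∞ (fun y => d% g y (W y)) x := by
  have h := smoothAlong_mfderiv_of_eventually hg hW
  exact ((contMDiff_snd_tangentBundle_modelSpace ℝ 𝓘(ℝ, ℝ)).contMDiffAt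
    (x := (⟨g x, mfderiv J 𝓘(ℝ, ℝ) g x (W x)⟩ : TangentBundle 𝓘(ℝ, ℝ) ℝ))).comp x h

theorem coordAt_eq_mfderiv {p z : M}
    (hz : z ∈ (trivializationAt E (TangentSpace I : M → Type _) p).baseSet) (v : TangentSpace I z) :
    coordAt I p z v = d% (extChartAt I p) z v := by
  have h := TangentBundle.continuousLinearMapAt_trivializationAt (I := I) (𝕜 := ℝ) (x₀ := p)
    (x := z) (by simpa using hz)
  exact congrArg (fun L : TangentSpace I z →L[ℝ] E => L v) h

theorem mlieBracket_frameField (p : M) (a b : E) :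
    mlieBracket I (frameField I p a) (frameField I p b) p = 0 := by
  have hb := mem_baseSet_trivializationAt' (F := E) (E := (TangentSpace I : M → Type _)) p
  have hconst : ∀ (a : E) v, d% (fun y => d% (extChartAt I p) y (frameField I p a y)) p v = 0 := by
    intro a v
    have : d% (fun y => d% (extChartAt I p) y (frameField I p a y)) p = d% (fun _ : M => a) p := by
      apply Filter.EventuallyEq.mfderiv_eq
      filter_upwards [baseSet_mem_nhds (I := I) p] with z hz
      rw [← coordAt_eq_mfderiv hz, coordAt_frameField hz]
    rw [this, mvfderiv_const]; rfl
  have h := mvfderiv_mvfderiv_sub (g := extChartAt I p) (x := p) contMDiffAt_extChartAt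
    (mdiffAt_frameField hb a) (mdiffAt_frameField hb b)
  rw [hconst, hconst, sub_zero, ← coordAt_eq_mfderiv hb] at h
  rw [← frameField_coordAt hb (mlieBracket I (frameField I p a) (frameField I p b) p), ← h]
  simp [frameField]

theorem leviCivita_sub {X Y : Π z : M, TangentSpace I z} {p : M} (hX : MDiffAt (T% X) p)
    (hY : MDiffAt (T% Y) p) :
    leviCivita I M Y p (X p) - leviCivita I M X p (Y p) = mlieBracket I X Y p :=
  (CovariantDerivative.torsion_eq_zero_iff _).1 leviCivita_torsion hX hY

/-- The pulled back connection is torsion free. -/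
theorem covAlong_sub {f : N → M} (hf : ContMDiff J I ∞ f) {U V : Π y : N, TangentSpace J y} {x : N}
    (hU : ContMDiffAt J J.tangent ∞ (fun y => (⟨y, U y⟩ : TangentBundle J N)) x)
    (hV : ContMDiffAt J J.tangent ∞ (fun y => (⟨y, V y⟩ : TangentBundle J N)) x) :
    covAlong I J f (fun y => mfderiv J I f y (V y)) x (U x) -
      covAlong I J f (fun y => mfderiv J I f y (U y)) x (V x) =
        mfderiv J I f x (mlieBracket J U V x) := by
  set p := f x with hp
  have hb := mem_baseSet_trivializationAt' (F := E) (E := (TangentSpace I : M → Type _)) p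
  have hfx : ContinuousAt f x := hf.continuous.continuousAt
  let g : N → E := fun y => extChartAt I p (f y)
  have hg : ContMDiffAt J 𝓘(ℝ, E) ∞ g x :=
    ContMDiffAt.comp x (g := extChartAt I p) contMDiffAt_extChartAt hf.contMDiffAt
  have hdg : ∀ᶠ y in 𝓝 x, ∀ v : TangentSpace J y,
      coordAt I p (f y) (mfderiv J I f y v) = d% g y v := by
    filter_upwards [hfx (baseSet_mem_nhds (I := I) p)] with y hy v
    rw [coordAt_eq_mfderiv hy]
    exact (mfderiv_comp_apply (g := extChartAt I p) y
      (mdifferentiableAt_extChartAt (by simpa using hy))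
      (hf.contMDiffAt.mdifferentiableAt (by simp)) v).symm
  have hcoord : ∀ W : Π y : N, TangentSpace J y,
      d% (fun y => coordAt I p (f y) (mfderiv J I f y (W y))) x =
        d% (fun y => d% g y (W y)) x := fun W =>
    Filter.EventuallyEq.mfderiv_eq (hdg.mono fun y hy => hy _)
  have h1 := mvfderiv_mvfderiv_sub hg (mdiffAt_section hU) (mdiffAt_section hV)
  have h2 := leviCivita_sub (mdiffAt_frameField hb (coordAt I p p (mfderiv J I f x (U x))))
    (mdiffAt_frameField hb (coordAt I p p (mfderiv J I f x (V x))))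
  rw [mlieBracket_frameField, frameField_coordAt hb, frameField_coordAt hb] at h2
  rw [covAlong_eq hfx, covAlong_eq hfx, ← hp, hcoord, hcoord, add_sub_add_comm, h2, add_zero,
    ← frameField_coordAt hb (mfderiv J I f x (mlieBracket J U V x)), hdg.self_of_nhds, ← h1]
  simp [frameField]

theorem two_inner_covAlong_mfderiv {f : N → M} (hf : ContMDiff J I ∞ f)
    {U V W : Π y : N, TangentSpace J y} {x : N}
    (hU : ContMDiffAt J J.tangent ∞ (fun y => (⟨y, U y⟩ : TangentBundle J N)) x)
    (hV : ContMDiffAt J J.tangent ∞ (fun y => (⟨y, V y⟩ : TangentBundle J N)) x)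
    (hW : ContMDiffAt J J.tangent ∞ (fun y => (⟨y, W y⟩ : TangentBundle J N)) x) :
    2 * ⟪covAlong I J f (fun y => mfderiv J I f y (V y)) x (U x), mfderiv J I f x (W x)⟫_ℝ =
      d% (fun y => ⟪mfderiv J I f y (V y), mfderiv J I f y (W y)⟫_ℝ) x (U x)
      + d% (fun y => ⟪mfderiv J I f y (U y), mfderiv J I f y (W y)⟫_ℝ) x (V x)
      - d% (fun y => ⟪mfderiv J I f y (U y), mfderiv J I f y (V y)⟫_ℝ) x (W x)
      + ⟪mfderiv J I f x (mlieBracket J U V x), mfderiv J I f x (W x)⟫_ℝ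
      - ⟪mfderiv J I f x (mlieBracket J U W x), mfderiv J I f x (V x)⟫_ℝ
      - ⟪mfderiv J I f x (mlieBracket J V W x), mfderiv J I f x (U x)⟫_ℝ := by
  have sU := smoothAlong_mfderiv hf hU
  have sV := smoothAlong_mfderiv hf hV
  have sW := smoothAlong_mfderiv hf hW
  rw [mvfderiv_inner_along sV sW, mvfderiv_inner_along sU sW, mvfderiv_inner_along sU sV,
    ← covAlong_sub hf hU hV, ← covAlong_sub hf hU hW, ← covAlong_sub hf hV hW]
  simp only [inner_sub_left]
  rw [real_inner_comm (covAlong I J f (fun y => mfderiv J I f y (W y)) x (U x)),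
    real_inner_comm (covAlong I J f (fun y => mfderiv J I f y (W y)) x (V x)),
    real_inner_comm (covAlong I J f (fun y => mfderiv J I f y (V y)) x (W x))]
  ring

variable [RiemannianBundle (fun x : N => TangentSpace J x)]
  [IsContMDiffRiemannianBundle J ∞ F (fun x : N => TangentSpace J x)]

/-- A map that preserves the inner products of three vector fields and of their brackets with the
fields preserves the corresponding covariant derivative. -/
theorem inner_covAlong_mfderiv {f : N → M} (hf : ContMDiff J I ∞ f)
    {U V W : Π y : N, TangentSpace J y} {x : N}
    (hU : ContMDiffAt J J.tangent ∞ (fun y => (⟨y, U y⟩ : TangentBundle J N)) x)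
    (hV : ContMDiffAt J J.tangent ∞ (fun y => (⟨y, V y⟩ : TangentBundle J N)) x)
    (hW : ContMDiffAt J J.tangent ∞ (fun y => (⟨y, W y⟩ : TangentBundle J N)) x)
    (hiU : ∀ᶠ y in 𝓝 x, ∀ v, ⟪mfderiv J I f y v, mfderiv J I f y (U y)⟫_ℝ = ⟪v, U y⟫_ℝ)
    (hiV : ∀ᶠ y in 𝓝 x, ∀ v, ⟪mfderiv J I f y v, mfderiv J I f y (V y)⟫_ℝ = ⟪v, V y⟫_ℝ)
    (hiW : ∀ᶠ y in 𝓝 x, ∀ v, ⟪mfderiv J I f y v, mfderiv J I f y (W y)⟫_ℝ = ⟪v, W y⟫_ℝ) :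
    ⟪covAlong I J f (fun y => mfderiv J I f y (V y)) x (U x), mfderiv J I f x (W x)⟫_ℝ =
      ⟪leviCivita J N V x (U x), W x⟫_ℝ := by
  have h1 := two_inner_covAlong_mfderiv hf hU hV hW
  have h2 := leviCivita_koszul (mdiffAt_section hU) (mdiffAt_section hV) (mdiffAt_section hW)
  have e : ∀ {A B : Π y : N, TangentSpace J y},
      (∀ᶠ y in 𝓝 x, ∀ v, ⟪mfderiv J I f y v, mfderiv J I f y (B y)⟫_ℝ = ⟪v, B y⟫_ℝ) →
      d% (fun y => ⟪mfderiv J I f y (A y), mfderiv J I f y (B y)⟫_ℝ) x =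
        d% (fun y => ⟪A y, B y⟫_ℝ) x :=
    fun h => Filter.EventuallyEq.mfderiv_eq (h.mono fun y hy => hy _)
  rw [e hiW, e hiW, e hiV, hiW.self_of_nhds, hiV.self_of_nhds, hiU.self_of_nhds] at h1
  simp only [koszul] at h2
  linarith

end TorsionAlong

section SmoothCov

variable {E : Type*} [NormedAddCommGroup E] [NormedSpace ℝ E] [FiniteDimensional ℝ E]
  {H : Type*} [TopologicalSpace H] {I : ModelWithCorners ℝ E H} [I.Boundaryless]
  {M : Type*} [TopologicalSpace M] [ChartedSpace H M] [IsManifold I ∞ M]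
  [RiemannianBundle (fun x : M => TangentSpace I x)]
  [IsContMDiffRiemannianBundle I ∞ E (fun x : M => TangentSpace I x)]

theorem contMDiffAt_mlieBracket {X Y : Π z : M, TangentSpace I z} {p : M}
    (hX : ContMDiffAt I I.tangent ∞ (fun z => (⟨z, X z⟩ : TangentBundle I M)) p)
    (hY : ContMDiffAt I I.tangent ∞ (fun z => (⟨z, Y z⟩ : TangentBundle I M)) p) :
    ContMDiffAt I I.tangent ∞ (fun z => (⟨z, mlieBracket I X Y z⟩ : TangentBundle I M)) p := by
  have : IsManifold I (((⊤ : ℕ∞) : WithTop ℕ∞) + 1) M := inferInstanceAs (IsManifold I ∞ M)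
  have : IsManifold I (minSmoothness ℝ 2) M := by
    simp only [minSmoothness_of_isRCLikeNormedField]; infer_instance
  have : IsManifold I (minSmoothness ℝ 3) M := by
    simp only [minSmoothness_of_isRCLikeNormedField]; infer_instance
  exact ContMDiffAt.mlieBracket_vectorField (m := ⊤) (n := ⊤) hX hY
    (by simp only [minSmoothness_of_isRCLikeNormedField]; norm_cast)

theorem contMDiffAt_koszul {X Y Z : Π z : M, TangentSpace I z} {p : M}
    (hX : ∀ᶠ z in 𝓝 p, ContMDiffAt I I.tangent ∞ (fun z => (⟨z, X z⟩ : TangentBundle I M)) z)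
    (hY : ∀ᶠ z in 𝓝 p, ContMDiffAt I I.tangent ∞ (fun z => (⟨z, Y z⟩ : TangentBundle I M)) z)
    (hZ : ∀ᶠ z in 𝓝 p, ContMDiffAt I I.tangent ∞ (fun z => (⟨z, Z z⟩ : TangentBundle I M)) z) :
    ContMDiffAt I 𝓘(ℝ, ℝ) ∞ (koszul X Y Z) p := by
  have hin : ∀ {A B : Π z : M, TangentSpace I z} {q : M},
      ContMDiffAt I I.tangent ∞ (fun z => (⟨z, A z⟩ : TangentBundle I M)) q →
      ContMDiffAt I I.tangent ∞ (fun z => (⟨z, B z⟩ : TangentBundle I M)) q →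
      ContMDiffAt I 𝓘(ℝ, ℝ) ∞ (fun z => ⟪A z, B z⟫_ℝ) q := fun hA hB =>
    ContMDiffAt.inner_bundle (E := fun x : M => TangentSpace I x) (F := E) (b := id) hA hB
  have hd : ∀ {A B D : Π z : M, TangentSpace I z},
      (∀ᶠ z in 𝓝 p, ContMDiffAt I I.tangent ∞ (fun z => (⟨z, A z⟩ : TangentBundle I M)) z) →
      (∀ᶠ z in 𝓝 p, ContMDiffAt I I.tangent ∞ (fun z => (⟨z, B z⟩ : TangentBundle I M)) z) →
      (∀ᶠ z in 𝓝 p, ContMDiffAt I I.tangent ∞ (fun z => (⟨z, D z⟩ : TangentBundle I M)) z) →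
      ContMDiffAt I 𝓘(ℝ, ℝ) ∞ (fun z => d% (fun y => ⟪A y, B y⟫_ℝ) z (D z)) p :=
    fun hA hB hD => contMDiffAt_mvfderiv_apply
      (by filter_upwards [hA, hB] with z h1 h2; exact hin h1 h2) hD.self_of_nhds
  have hX0 := hX.self_of_nhds
  have hY0 := hY.self_of_nhds
  have hZ0 := hZ.self_of_nhds
  exact (((((hd hY hZ hX).add (hd hX hZ hY)).sub (hd hX hY hZ)).add
    (hin (contMDiffAt_mlieBracket hX0 hY0) hZ0)).sub
    (hin (contMDiffAt_mlieBracket hX0 hZ0) hY0)).sub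
    (hin (contMDiffAt_mlieBracket hY0 hZ0) hX0)

theorem contMDiffAt_leviCivita {X Y : Π z : M, TangentSpace I z} {p : M}
    (hX : ∀ᶠ z in 𝓝 p, ContMDiffAt I I.tangent ∞ (fun z => (⟨z, X z⟩ : TangentBundle I M)) z)
    (hY : ∀ᶠ z in 𝓝 p, ContMDiffAt I I.tangent ∞ (fun z => (⟨z, Y z⟩ : TangentBundle I M)) z) :
    ContMDiffAt I I.tangent ∞
      (fun z => (⟨z, leviCivita I M Y z (X z)⟩ : TangentBundle I M)) p := by
  refine smoothAlong_of_inner (f := fun z : M => z) contMDiffAt_id fun Z hZ => ?_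
  refine (contMDiffAt_const (c := (1 / 2 : ℝ)) |>.mul (contMDiffAt_koszul hX hY hZ)).congr_of_eventuallyEq ?_
  filter_upwards [hX, hY, hZ] with z h1 h2 h3
  have := leviCivita_koszul (mdiffAt_section h1) (mdiffAt_section h2) (mdiffAt_section h3)
  simp only [Pi.mul_apply, ← this]
  ring

theorem smoothAlong_velocity {γ : ℝ → M} {J : Set ℝ} (hJ : IsOpen J)
    (hγ : ContMDiffOn 𝓘(ℝ, ℝ) I ∞ γ J) {s : ℝ} (hs : s ∈ J) :
    SmoothAlong I 𝓘(ℝ, ℝ) γ (velocity I γ) s := by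
  refine smoothAlong_mfderiv_of_eventually (W := fun _ => (1 : ℝ)) ?_ ?_
  · filter_upwards [hJ.mem_nhds hs] with t ht
    exact hγ.contMDiffAt (hJ.mem_nhds ht)
  · exact contMDiffAt_vectorSpace_iff_contDiffAt.2 contDiffAt_const

theorem smoothAlong_covCurve {γ : ℝ → M} {J : Set ℝ} (hJ : IsOpen J)
    {V : Π s : ℝ, TangentSpace I (γ s)} (hV : ∀ s ∈ J, SmoothAlong I 𝓘(ℝ, ℝ) γ V s)
    {s : ℝ} (hs : s ∈ J) : SmoothAlong I 𝓘(ℝ, ℝ) γ (covCurve I γ V) s := by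
  have hγs : ∀ t ∈ J, ContMDiffAt 𝓘(ℝ, ℝ) I ∞ γ t := fun t ht => (hV t ht).base
  have hγ : ContMDiffOn 𝓘(ℝ, ℝ) I ∞ γ J := fun t ht => (hγs t ht).contMDiffWithinAt
  have hvel := smoothAlong_velocity hJ hγ hs
  have hone : ContMDiffAt 𝓘(ℝ, ℝ) 𝓘(ℝ, ℝ).tangent ∞
      (fun t => (⟨t, (1 : ℝ)⟩ : TangentBundle 𝓘(ℝ, ℝ) ℝ)) s :=
    contMDiffAt_vectorSpace_iff_contDiffAt.2 contDiffAt_const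
  refine smoothAlong_of_inner (hγs s hs) fun Y hY => ?_
  have hnear : ∀ᶠ t in 𝓝 s,
      ContMDiffAt I I.tangent ∞ (fun z => (⟨z, Y z⟩ : TangentBundle I M)) (γ t) :=
    (hγs s hs).continuousAt.eventually hY
  have hder : SmoothAlong I 𝓘(ℝ, ℝ) γ
      (fun t => leviCivita I M Y (γ t) (velocity I γ t)) s := by
    refine hvel.induction_frame
      (P := fun W => SmoothAlong I 𝓘(ℝ, ℝ) γ (fun t => leviCivita I M Y (γ t) (W t)) s)
      (fun V W _ h ih => ih.congr (h.mono fun t ht => by rw [ht]))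
      (fun V W _ _ h1 h2 => by simpa using h1.add h2)
      (fun a V ha _ h => by simpa using h.smul ha) fun a => ?_
    refine .comp_section (hγs s hs) (contMDiffAt_leviCivita ?_ hY)
    filter_upwards [baseSet_mem_nhds (I := I) (γ s)] with z hz
    exact contMDiffAt_frameField hz a
  have h1 : ContMDiffAt 𝓘(ℝ, ℝ) 𝓘(ℝ, ℝ) ∞
      (fun t => d% (fun t => ⟪V t, Y (γ t)⟫_ℝ) t (1 : ℝ)) s := by
    refine contMDiffAt_mvfderiv_apply (W := fun _ => (1 : ℝ)) ?_ hone
    filter_upwards [hJ.mem_nhds hs, hnear] with t ht hYt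
    exact (hV t ht).inner (.comp_section (hγs t ht) hYt)
  refine (h1.sub ((hV s hs).inner hder)).congr_of_eventuallyEq ?_
  filter_upwards [hJ.mem_nhds hs, hnear] with t ht hYt
  have h2 := mvfderiv_inner_along (hV t ht) (.comp_section (hγs t ht) hYt) (1 : ℝ)
  have h3 := covAlong_comp_section ((hγs t ht).mdifferentiableAt (by simp)) hYt (1 : ℝ)
  have h4 : d% (fun t => ⟪V t, Y (γ t)⟫_ℝ) t (1 : ℝ) = ⟪covCurve I γ V t, Y (γ t)⟫_ℝ +
      ⟪V t, leviCivita I M Y (γ t) (velocity I γ t)⟫_ℝ :=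
    h2.trans (congrArg (fun w => ⟪covCurve I γ V t, Y (γ t)⟫_ℝ + ⟪V t, w⟫_ℝ) h3)
  exact eq_sub_of_add_eq h4.symm

end SmoothCov

section Cast

variable {E : Type*} [NormedAddCommGroup E] [NormedSpace ℝ E] [FiniteDimensional ℝ E]
  {H : Type*} [TopologicalSpace H] {I : ModelWithCorners ℝ E H}
  {M : Type*} [TopologicalSpace M] [ChartedSpace H M] [IsManifold I ∞ M]
  {F : Type*} [NormedAddCommGroup F] [NormedSpace ℝ F] [FiniteDimensional ℝ F]
  {G : Type*} [TopologicalSpace G] {J : ModelWithCorners ℝ F G}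
  {N : Type*} [TopologicalSpace N] [ChartedSpace G N]

/-- Transport of tangent vectors between equal base points; meaningless for different points. -/
def castTangent {p : M} (q : M) (v : TangentSpace I p) : TangentSpace I q := (v : E)

theorem mk_castTangent {p q : M} (h : p = q) (v : TangentSpace I p) :
    (⟨q, castTangent q v⟩ : TangentBundle I M) = ⟨p, v⟩ := by
  subst h; rfl

theorem castTangent_smul {p q : M} (c : ℝ) (v : TangentSpace I p) :
    castTangent q (c • v) = c • castTangent q v := rfl

theorem SmoothAlong.cast {f f' : N → M} {x : N} (h : f =ᶠ[𝓝 x] f')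
    {V : Π y : N, TangentSpace I (f y)} (hV : SmoothAlong I J f V x) :
    SmoothAlong I J f' (fun y => castTangent (f' y) (V y)) x :=
  ContMDiffAt.congr_of_eventuallyEq hV (h.mono fun _ hy => mk_castTangent hy _)

variable [RiemannianBundle (fun x : M => TangentSpace I x)]

theorem inner_castTangent {p q : M} (h : p = q) (v w : TangentSpace I p) :
    ⟪castTangent q v, castTangent q w⟫_ℝ = ⟪v, w⟫_ℝ := by
  subst h; rfl

variable [IsContMDiffRiemannianBundle I ∞ E (fun x : M => TangentSpace I x)]

theorem covAlong_cast {f f' : N → M} {x : N} (h : f =ᶠ[𝓝 x] f')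
    (V : Π y : N, TangentSpace I (f y)) (v : TangentSpace J x) :
    covAlong I J f' (fun y => castTangent (f' y) (V y)) x v =
      castTangent (f' x) (covAlong I J f V x v) := by
  let aux : Π p : M, E → TangentSpace I p → TangentSpace I p → TangentSpace I p := fun p a w u =>
    (trivializationAt E (TangentSpace I : M → Type _) p).symmL ℝ p a +
      leviCivita I M (FiberBundle.extend E w) p u
  have hcast : ∀ {p q : M} (_ : p = q) (a : E) (w u : TangentSpace I p),
      castTangent q (aux p a w u) = aux q a (castTangent q w) (castTangent q u) := by
    intro p q hpq a w u; subst hpq; rfl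
  have hd : d% (fun y => ((trivializationAt E (TangentSpace I : M → Type _) (f' x))
        ⟨f' y, castTangent (f' y) (V y)⟩).2) x =
      d% (fun y => ((trivializationAt E (TangentSpace I : M → Type _) (f x)) ⟨f y, V y⟩).2) x := by
    apply Filter.EventuallyEq.mfderiv_eq
    filter_upwards [h] with y hy
    rw [mk_castTangent hy, h.self_of_nhds]
  have hm : mfderiv J I f' x v = castTangent (f' x) (mfderiv J I f x v) := by
    have := h.mfderiv_eq (I := J) (I' := I)
    exact congrArg (fun L : TangentSpace J x →L[ℝ] TangentSpace I (f' x) => L v) this.symm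
  have h1 : covAlong I J f V x v = aux (f x) (d% (fun y => ((trivializationAt E
      (TangentSpace I : M → Type _) (f x)) ⟨f y, V y⟩).2) x v) (V x) (mfderiv J I f x v) := rfl
  have h2 : covAlong I J f' (fun y => castTangent (f' y) (V y)) x v = aux (f' x)
      (d% (fun y => ((trivializationAt E (TangentSpace I : M → Type _) (f' x))
        ⟨f' y, castTangent (f' y) (V y)⟩).2) x v) (castTangent (f' x) (V x))
      (mfderiv J I f' x v) := rfl
  rw [h1, h2, hcast h.self_of_nhds, hd, hm]

end Cast

section Sasaki

variable {M : Type*} [TopologicalSpace M] [ChartedSpace (EuclideanSpace ℝ (Fin 3)) M]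
  [IsManifold (𝓡 3) ∞ M]
  [RiemannianBundle (fun x : M => TangentSpace (𝓡 3) x)]
  [IsContMDiffRiemannianBundle (𝓡 3) ∞ (EuclideanSpace ℝ (Fin 3))
    (fun x : M => TangentSpace (𝓡 3) x)]
  {F : Type*} [NormedAddCommGroup F] [NormedSpace ℝ F] [FiniteDimensional ℝ F]
  {G : Type*} [TopologicalSpace G] {J : ModelWithCorners ℝ F G}
  {N : Type*} [TopologicalSpace N] [ChartedSpace G N]

namespace ContactRiemannianStructure

variable (C : ContactRiemannianStructure M)

theorem inner_ξ_ξ (p : M) : ⟪C.ξ p, C.ξ p⟫_ℝ = 1 := by rw [C.inner_ξ, C.η_ξ]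

theorem φ_ξ (p : M) : C.φ p (C.ξ p) = 0 := by
  rw [← inner_self_eq_zero (𝕜 := ℝ), C.inner_φ_φ, C.inner_ξ_ξ, C.η_ξ]; ring

theorem ξ_ne_zero (p : M) : C.ξ p ≠ 0 := fun h => by
  have := C.inner_ξ_ξ p
  rw [h, inner_zero_left] at this
  exact zero_ne_one this

theorem η_φ (p : M) (v : TangentSpace (𝓡 3) p) : C.η p (C.φ p v) = 0 := by
  have h1 := C.φ_φ p (C.φ p v)
  rw [C.φ_φ p v, map_add, map_neg, map_smul, C.φ_ξ, smul_zero, add_zero, left_eq_add] at h1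
  exact (smul_eq_zero.1 h1).resolve_right (C.ξ_ne_zero p)

theorem inner_φ_left (p : M) (v w : TangentSpace (𝓡 3) p) :
    ⟪C.φ p v, w⟫_ℝ = -⟪v, C.φ p w⟫_ℝ := by
  have h := C.inner_φ_φ p v (C.φ p w)
  rw [C.φ_φ, C.η_φ, inner_add_right, inner_neg_right, real_inner_smul_right,
    real_inner_comm (C.ξ p), C.inner_ξ, C.η_φ] at h
  linarith

theorem inner_φ_self (p : M) (v : TangentSpace (𝓡 3) p) : ⟪v, C.φ p v⟫_ℝ = 0 := by
  have h := C.inner_φ_left p v v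
  rw [real_inner_comm] at h
  linarith

theorem smoothAlong_ξ {f : N → M} {x : N} (hf : ContMDiffAt J (𝓡 3) ∞ f x) :
    SmoothAlong (𝓡 3) J f (fun y => C.ξ (f y)) x :=
  .comp_section hf C.smooth_ξ.contMDiffAt

theorem contMDiffAt_η {f : N → M} {V : Π y : N, TangentSpace (𝓡 3) (f y)} {x : N}
    (hV : SmoothAlong (𝓡 3) J f V x) :
    ContMDiffAt J 𝓘(ℝ, ℝ) ∞ (fun y => C.η (f y) (V y)) x := by
  simpa only [C.inner_ξ] using (C.smoothAlong_ξ hV.base).inner hV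

theorem smoothAlong_φ {f : N → M} {V : Π y : N, TangentSpace (𝓡 3) (f y)} {x : N}
    (hV : SmoothAlong (𝓡 3) J f V x) :
    SmoothAlong (𝓡 3) J f (fun y => C.φ (f y) (V y)) x :=
  ContMDiffAt.clm_bundle_apply (F₁ := EuclideanSpace ℝ (Fin 3)) (F₂ := EuclideanSpace ℝ (Fin 3))
    (E₁ := fun x : M => TangentSpace (𝓡 3) x) (E₂ := fun x : M => TangentSpace (𝓡 3) x)
    (b := f) (ContMDiffAt.comp x C.smooth_φ.contMDiffAt hV.base) hV

variable {C}

theorem IsSasaki.leviCivita_ξ (hC : C.IsSasaki) (p : M) (u : TangentSpace (𝓡 3) p) :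
    leviCivita (𝓡 3) M C.ξ p u = -C.φ p u := by
  have hξ := C.smooth_ξ.contMDiffAt (x := p)
  have h1 := hC p u C.ξ hξ
  have h0 : (fun y => C.φ y (C.ξ y)) = 0 := funext fun y => C.φ_ξ y
  rw [h0, CovariantDerivative.zero, real_inner_comm, C.inner_ξ, C.η_ξ, one_smul] at h1
  have hz : (0 : Π x : M, TangentSpace (𝓡 3) x →L[ℝ] TangentSpace (𝓡 3) x) p u = 0 := rfl
  rw [hz, zero_sub] at h1
  have h2 := congrArg (C.φ p) h1
  rw [map_neg, C.φ_φ, map_sub, map_smul, C.φ_ξ, smul_zero, zero_sub] at h2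
  have h3 : C.η p (leviCivita (𝓡 3) M C.ξ p u) = 0 := by
    have hm := leviCivita_metric (X := FiberBundle.extend (EuclideanSpace ℝ (Fin 3)) u)
      (mdifferentiableAt_extend ..) (mdiffAt_section hξ) (mdiffAt_section hξ)
    simp only [C.inner_ξ_ξ, extend_apply_self] at hm
    rw [mvfderiv_const, real_inner_comm, C.inner_ξ] at hm
    have : (0 : TangentSpace (𝓡 3) p →L[ℝ] ℝ) u = 0 := rfl
    rw [this] at hm
    linarith
  rw [h3, zero_smul, add_zero, neg_neg] at h2
  exact h2

theorem IsSasaki.covAlong_ξ (hC : C.IsSasaki) {f : N → M} {x : N}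
    (hf : ContMDiffAt J (𝓡 3) ∞ f x) (v : TangentSpace J x) :
    covAlong (𝓡 3) J f (fun y => C.ξ (f y)) x v = -C.φ (f x) (mfderiv J (𝓡 3) f x v) := by
  rw [covAlong_comp_section (hf.mdifferentiableAt (by simp)) C.smooth_ξ.contMDiffAt,
    hC.leviCivita_ξ]

theorem IsSasaki.covAlong_φ (hC : C.IsSasaki) {f : N → M}
    {V : Π y : N, TangentSpace (𝓡 3) (f y)} {x : N}
    (hV : SmoothAlong (𝓡 3) J f V x) (v : TangentSpace J x) :
    covAlong (𝓡 3) J f (fun y => C.φ (f y) (V y)) x v =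
      C.φ (f x) (covAlong (𝓡 3) J f V x v) + ⟪mfderiv J (𝓡 3) f x v, V x⟫_ℝ • C.ξ (f x) -
        C.η (f x) (V x) • mfderiv J (𝓡 3) f x v := by
  refine hV.induction (P := fun V => covAlong (𝓡 3) J f (fun y => C.φ (f y) (V y)) x v =
      C.φ (f x) (covAlong (𝓡 3) J f V x v) + ⟪mfderiv J (𝓡 3) f x v, V x⟫_ℝ • C.ξ (f x) -
        C.η (f x) (V x) • mfderiv J (𝓡 3) f x v)
    (fun V W hV h ih => ?_) (fun V W hV hW ih ih' => ?_) (fun a V ha hV ih => ?_) fun Y hY => ?_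
  · rw [covAlong_congr h, covAlong_congr (W := fun y => C.φ (f y) (V y))
      (h.mono fun y hy => by rw [hy]), ih, h.self_of_nhds]
  · simp only [map_add]
    rw [covAlong_add (C.smoothAlong_φ hV) (C.smoothAlong_φ hW), covAlong_add hV hW, add_apply,
      ih, ih', add_apply, map_add, inner_add_right]
    module
  · simp only [map_smul]
    rw [covAlong_smul ha (C.smoothAlong_φ hV), covAlong_smul ha hV, ih, map_add, map_smul,
      map_smul, real_inner_smul_right, smul_eq_mul]
    module
  · have hf := hV.base.mdifferentiableAt (n := ∞) (by simp)
    have h1 : ContMDiffAt (𝓡 3) (𝓡 3).tangent ∞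
        (fun z => (⟨z, C.φ z (Y z)⟩ : TangentBundle (𝓡 3) M)) (f x) :=
      C.smoothAlong_φ (f := fun z : M => z) hY.self_of_nhds
    rw [covAlong_comp_section (Y := fun z => C.φ z (Y z)) hf h1,
      covAlong_comp_section hf hY.self_of_nhds]
    have h2 := hC (f x) (mfderiv J (𝓡 3) f x v) Y hY.self_of_nhds
    rw [sub_eq_iff_eq_add] at h2
    rw [h2]
    abel

end ContactRiemannianStructure

end Sasaki

section BoothbyWang

variable {M : Type*} [TopologicalSpace M] [ChartedSpace (EuclideanSpace ℝ (Fin 3)) M]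
  [IsManifold (𝓡 3) ∞ M]
  [RiemannianBundle (fun x : M => TangentSpace (𝓡 3) x)]
  [IsContMDiffRiemannianBundle (𝓡 3) ∞ (EuclideanSpace ℝ (Fin 3))
    (fun x : M => TangentSpace (𝓡 3) x)]
  {B : Type*} [TopologicalSpace B] [ChartedSpace (EuclideanSpace ℝ (Fin 2)) B]
  [IsManifold (𝓡 2) ∞ B]
  [RiemannianBundle (fun x : B => TangentSpace (𝓡 2) x)]
  {F : Type*} [NormedAddCommGroup F] [NormedSpace ℝ F] [FiniteDimensional ℝ F]
  {G : Type*} [TopologicalSpace G] {J : ModelWithCorners ℝ F G}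
  {N : Type*} [TopologicalSpace N] [ChartedSpace G N]

namespace IsBoothbyWangFibration

variable {C : ContactRiemannianStructure M} {pr : M → B}

theorem mfderiv_ξ (h : IsBoothbyWangFibration C pr) (p : M) :
    mfderiv (𝓡 3) (𝓡 2) pr p (C.ξ p) = 0 := by
  obtain ⟨c, hc, h0⟩ := h.complete p
  have hconst : pr ∘ c = fun _ => pr p :=
    funext fun u => ((h.fibre p (c u)).2 ⟨c, hc, h0, u, rfl⟩).symm
  have h1 := (h.smooth.contMDiffAt (x := c 0)).mdifferentiableAt (by simp) |>.hasMFDerivAt.comp 0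
    (hc 0)
  rw [hconst] at h1
  have h2 := hasMFDerivAt_unique h1 (hasMFDerivAt_const (pr p) (0 : ℝ))
  have h3 : mfderiv (𝓡 3) (𝓡 2) pr (c 0) ((1 : ℝ) • C.ξ (c 0)) = 0 :=
    congrArg (fun L => L (1 : ℝ)) h2
  subst h0
  rwa [one_smul] at h3

theorem inner_mfderiv (h : IsBoothbyWangFibration C pr) (p : M) (v w : TangentSpace (𝓡 3) p) :
    ⟪mfderiv (𝓡 3) (𝓡 2) pr p v, mfderiv (𝓡 3) (𝓡 2) pr p w⟫_ℝ =
      ⟪v, w⟫_ℝ - C.η p v * C.η p w := by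
  have hη : ∀ v, C.η p (v - C.η p v • C.ξ p) = 0 := fun v => by
    rw [map_sub, map_smul, C.η_ξ, smul_eq_mul, mul_one, sub_self]
  have hd : ∀ v, mfderiv (𝓡 3) (𝓡 2) pr p v =
      mfderiv (𝓡 3) (𝓡 2) pr p (v - C.η p v • C.ξ p) := fun v => by
    rw [map_sub, map_smul, h.mfderiv_ξ, smul_zero, sub_zero]
  rw [hd v, hd w, h.isometric p _ _ (hη v) (hη w)]
  simp only [inner_sub_left, inner_sub_right, real_inner_smul_left, real_inner_smul_right,
    C.inner_ξ, real_inner_comm (C.ξ p), C.η_ξ, map_smul, smul_eq_mul]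
  ring

theorem exists_horizontal (h : IsBoothbyWangFibration C pr) (p : M)
    (w : TangentSpace (𝓡 2) (pr p)) :
    ∃ v, C.η p v = 0 ∧ mfderiv (𝓡 3) (𝓡 2) pr p v = w := by
  obtain ⟨v, hv⟩ := h.submersion p w
  refine ⟨v - C.η p v • C.ξ p, ?_, ?_⟩
  · rw [map_sub, map_smul, C.η_ξ, smul_eq_mul, mul_one, sub_self]
  · rw [map_sub, map_smul, h.mfderiv_ξ, smul_zero, sub_zero, hv]

theorem eq_of_horizontal (h : IsBoothbyWangFibration C pr) {p : M} {v w : TangentSpace (𝓡 3) p}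
    (hv : C.η p v = 0) (hw : C.η p w = 0)
    (hd : mfderiv (𝓡 3) (𝓡 2) pr p v = mfderiv (𝓡 3) (𝓡 2) pr p w) : v = w := by
  have hη : C.η p (v - w) = 0 := by rw [map_sub, hv, hw, sub_zero]
  have h1 := h.isometric p _ _ hη hη
  rw [map_sub, hd, sub_self, inner_zero_left] at h1
  exact sub_eq_zero.1 (inner_self_eq_zero.1 h1.symm)

theorem smoothAlong_mfderiv_comp (h : IsBoothbyWangFibration C pr) {f : N → M}
    {V : Π y : N, TangentSpace (𝓡 3) (f y)} {x : N} (hV : SmoothAlong (𝓡 3) J f V x) :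
    SmoothAlong (𝓡 2) J (fun y => pr (f y)) (fun y => mfderiv (𝓡 3) (𝓡 2) pr (f y) (V y)) x :=
  ContMDiffAt.comp x (h.smooth.contMDiff_tangentMap (m := ∞) (by simp)).contMDiffAt hV

/-- The horizontal part of a smooth section is smooth. -/
theorem smoothAlong_horizontal {f : N → M} {V : Π y : N, TangentSpace (𝓡 3) (f y)} {x : N}
    (hV : SmoothAlong (𝓡 3) J f V x) :
    SmoothAlong (𝓡 3) J f (fun y => V y - C.η (f y) (V y) • C.ξ (f y)) x :=
  hV.sub ((C.smoothAlong_ξ hV.base).smul (C.contMDiffAt_η hV))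

variable [IsContMDiffRiemannianBundle (𝓡 2) ∞ (EuclideanSpace ℝ (Fin 2))
    (fun x : B => TangentSpace (𝓡 2) x)]

theorem covAlong_mfderiv_of_horizontal (h : IsBoothbyWangFibration C pr) {p : M}
    {Y : Π z : M, TangentSpace (𝓡 3) z}
    (hY : ContMDiffAt (𝓡 3) (𝓡 3).tangent ∞ (fun z => (⟨z, Y z⟩ : TangentBundle (𝓡 3) M)) p)
    (hηY : ∀ᶠ z in 𝓝 p, C.η z (Y z) = 0) {u : TangentSpace (𝓡 3) p} (hu : C.η p u = 0) :
    covAlong (𝓡 2) (𝓡 3) pr (fun z => mfderiv (𝓡 3) (𝓡 2) pr z (Y z)) p u =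
      mfderiv (𝓡 3) (𝓡 2) pr p (leviCivita (𝓡 3) M Y p u) := by
  let hor : TangentSpace (𝓡 3) p → Π z : M, TangentSpace (𝓡 3) z := fun w z =>
    (FiberBundle.extend (EuclideanSpace ℝ (Fin 3)) w : Π z : M, TangentSpace (𝓡 3) z) z -
      C.η z ((FiberBundle.extend (EuclideanSpace ℝ (Fin 3)) w : Π z : M, TangentSpace (𝓡 3) z) z) •
        C.ξ z
  have hhor : ∀ w, ContMDiffAt (𝓡 3) (𝓡 3).tangent ∞
      (fun z => (⟨z, hor w z⟩ : TangentBundle (𝓡 3) M)) p := fun w =>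
    smoothAlong_horizontal (C := C) (f := fun z : M => z) (contMDiffAt_extend (k := ∞) _ _ w)
  have hη : ∀ w z, C.η z (hor w z) = 0 := fun w z => by
    simp only [hor]
    rw [map_sub, map_smul, C.η_ξ, smul_eq_mul, mul_one, sub_self]
  have hp : ∀ w, C.η p w = 0 → hor w p = w := fun w hw => by
    simp only [hor, extend_apply_self]
    rw [hw, zero_smul, sub_zero]
  have hin : ∀ {A : Π z : M, TangentSpace (𝓡 3) z}, (∀ᶠ z in 𝓝 p, C.η z (A z) = 0) →
      ∀ᶠ z in 𝓝 p, ∀ v, ⟪mfderiv (𝓡 3) (𝓡 2) pr z v, mfderiv (𝓡 3) (𝓡 2) pr z (A z)⟫_ℝ =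
        ⟪v, A z⟫_ℝ := fun hA => hA.mono fun z hz v => by
    rw [h.inner_mfderiv, hz, mul_zero, sub_zero]
  refine ext_inner_right ℝ fun b => ?_
  obtain ⟨w, hw, rfl⟩ := h.exists_horizontal p b
  have key := inner_covAlong_mfderiv h.smooth (hhor u) hY (hhor w)
    (hin (.of_forall (hη u))) (hin hηY) (hin (.of_forall (hη w)))
  rw [hp u hu, hp w hw] at key
  rw [key, h.inner_mfderiv, hw, mul_zero, sub_zero]

theorem covAlong_mfderiv_ξ (h : IsBoothbyWangFibration C pr) (hC : C.IsSasaki) {p : M}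
    {Y : Π z : M, TangentSpace (𝓡 3) z}
    (hY : ContMDiffAt (𝓡 3) (𝓡 3).tangent ∞ (fun z => (⟨z, Y z⟩ : TangentBundle (𝓡 3) M)) p) :
    covAlong (𝓡 2) (𝓡 3) pr (fun z => mfderiv (𝓡 3) (𝓡 2) pr z (Y z)) p (C.ξ p) =
      mfderiv (𝓡 3) (𝓡 2) pr p (leviCivita (𝓡 3) M Y p (C.ξ p) + C.φ p (Y p)) := by
  have hξ := C.smooth_ξ.contMDiffAt (x := p)
  have h1 := covAlong_sub h.smooth hξ hY
  rw [← leviCivita_sub (mdiffAt_section hξ) (mdiffAt_section hY), hC.leviCivita_ξ,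
    covAlong_congr (W := fun y => 0) (.of_forall fun y => h.mfderiv_ξ y),
    covAlong_zero h.smooth.contMDiffAt, zero_apply, sub_zero, sub_neg_eq_add] at h1
  exact h1

/-- O'Neill's formula for the covariant derivative of projected vector fields. -/
theorem covAlong_mfderiv (h : IsBoothbyWangFibration C pr) (hC : C.IsSasaki) {p : M}
    {Y : Π z : M, TangentSpace (𝓡 3) z}
    (hY : ContMDiffAt (𝓡 3) (𝓡 3).tangent ∞ (fun z => (⟨z, Y z⟩ : TangentBundle (𝓡 3) M)) p)
    (u : TangentSpace (𝓡 3) p) :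
    covAlong (𝓡 2) (𝓡 3) pr (fun z => mfderiv (𝓡 3) (𝓡 2) pr z (Y z)) p u =
      mfderiv (𝓡 3) (𝓡 2) pr p (leviCivita (𝓡 3) M Y p u + C.η p u • C.φ p (Y p) +
        C.η p (Y p) • C.φ p u) := by
  have hYs : SmoothAlong (𝓡 3) (𝓡 3) (fun z : M => z) Y p := hY
  have hηs := C.contMDiffAt_η hYs
  have hξs := C.smoothAlong_ξ (f := fun z : M => z) (x := p) contMDiffAt_id
  let Z : Π z : M, TangentSpace (𝓡 3) z := fun z => Y z - C.η z (Y z) • C.ξ z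
  have hZ : SmoothAlong (𝓡 3) (𝓡 3) (fun z : M => z) Z p := smoothAlong_horizontal hYs
  have hηZ : ∀ z, C.η z (Z z) = 0 := fun z => by
    simp only [Z]; rw [map_sub, map_smul, C.η_ξ, smul_eq_mul, mul_one, sub_self]
  have hYZ : ∀ z, Y z = Z z + C.η z (Y z) • C.ξ z := fun z => by simp [Z]
  have h1 : leviCivita (𝓡 3) M Y p u = leviCivita (𝓡 3) M Z p u +
      (mvfderiv (𝓡 3) (fun z : M => C.η z (Y z)) p u • C.ξ p - C.η p (Y p) • C.φ p u) := by
    rw [← covAlong_id hY, ← covAlong_id hZ, covAlong_congr (.of_forall hYZ),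
      covAlong_add hZ (hξs.smul hηs), add_apply, covAlong_smul hηs hξs, covAlong_id hξs,
      hC.leviCivita_ξ]
    module
  have h2 : ∀ z, mfderiv (𝓡 3) (𝓡 2) pr z (Y z) = mfderiv (𝓡 3) (𝓡 2) pr z (Z z) := fun z => by
    simp only [Z]; rw [map_sub, map_smul, h.mfderiv_ξ, smul_zero, sub_zero]
  have hu : u = (u - C.η p u • C.ξ p) + C.η p u • C.ξ p := by abel
  have h3 : C.η p (u - C.η p u • C.ξ p) = 0 := by
    rw [map_sub, map_smul, C.η_ξ, smul_eq_mul, mul_one, sub_self]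
  have h4 : C.φ p (Z p) = C.φ p (Y p) := by
    simp only [Z]; rw [map_sub, map_smul, C.φ_ξ, smul_zero, sub_zero]
  rw [covAlong_congr (.of_forall h2), h1]
  have h5 : covAlong (𝓡 2) (𝓡 3) pr (fun z => mfderiv (𝓡 3) (𝓡 2) pr z (Z z)) p u =
      mfderiv (𝓡 3) (𝓡 2) pr p (leviCivita (𝓡 3) M Z p u + C.η p u • C.φ p (Y p)) := by
    conv_lhs => rw [hu]
    rw [map_add, map_smul, h.covAlong_mfderiv_of_horizontal hZ (.of_forall hηZ) h3,
      h.covAlong_mfderiv_ξ hC hZ, h4]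
    simp only [map_add, map_sub, map_smul]
    module
  rw [h5]
  simp only [map_add, map_sub, map_smul, h.mfderiv_ξ]
  module

theorem covAlong_mfderiv_comp (h : IsBoothbyWangFibration C pr) (hC : C.IsSasaki) {f : N → M}
    {V : Π y : N, TangentSpace (𝓡 3) (f y)} {x : N} (hV : SmoothAlong (𝓡 3) J f V x)
    (v : TangentSpace J x) :
    covAlong (𝓡 2) J (fun y => pr (f y)) (fun y => mfderiv (𝓡 3) (𝓡 2) pr (f y) (V y)) x v =
      mfderiv (𝓡 3) (𝓡 2) pr (f x) (covAlong (𝓡 3) J f V x v +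
        C.η (f x) (mfderiv J (𝓡 3) f x v) • C.φ (f x) (V x) +
        C.η (f x) (V x) • C.φ (f x) (mfderiv J (𝓡 3) f x v)) := by
  refine hV.induction (P := fun V => covAlong (𝓡 2) J (fun y => pr (f y))
      (fun y => mfderiv (𝓡 3) (𝓡 2) pr (f y) (V y)) x v =
      mfderiv (𝓡 3) (𝓡 2) pr (f x) (covAlong (𝓡 3) J f V x v +
        C.η (f x) (mfderiv J (𝓡 3) f x v) • C.φ (f x) (V x) +
        C.η (f x) (V x) • C.φ (f x) (mfderiv J (𝓡 3) f x v)))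
    (fun V W hV hVW ih => ?_) (fun V W hV hW ih ih' => ?_) (fun a V ha hV ih => ?_) fun Y hY => ?_
  · rw [covAlong_congr hVW, covAlong_congr (W := fun y => mfderiv (𝓡 3) (𝓡 2) pr (f y) (V y))
      (hVW.mono fun y hy => by rw [hy]), ih, hVW.self_of_nhds]
  · have h1 := covAlong_add (h.smoothAlong_mfderiv_comp hV) (h.smoothAlong_mfderiv_comp hW)
    simp only [map_add] at ih ih' ⊢
    rw [h1, covAlong_add hV hW]
    simp only [add_apply, ih, ih', map_add, add_smul, smul_add]
    abel
  · have h1 := covAlong_smul ha (h.smoothAlong_mfderiv_comp hV) v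
    simp only [map_smul] at ih ⊢
    rw [h1, covAlong_smul ha hV, ih]
    simp only [map_add, map_smul, smul_add, smul_smul, smul_eq_mul]
    module
  · have hf := hV.base.mdifferentiableAt (n := ∞) (by simp)
    have hYs := hY.self_of_nhds
    rw [covAlong_comp_section hf hYs, ← h.covAlong_mfderiv hC hYs]
    exact covAlong_comp_map (f := pr) (V := fun z => mfderiv (𝓡 3) (𝓡 2) pr z (Y z)) hf
      (h.smoothAlong_mfderiv_comp (f := fun z : M => z) hYs) v

end IsBoothbyWangFibration

end BoothbyWang

theorem _root_.Orthonormal.eq_sum_inner_smul {V : Type*} [NormedAddCommGroup V]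
    [InnerProductSpace ℝ V] [FiniteDimensional ℝ V] {n : ℕ} {b : Fin n → V} (hb : Orthonormal ℝ b)
    (hn : Module.finrank ℝ V = n) (w : V) : w = ∑ i, ⟪b i, w⟫_ℝ • b i := by
  have h := hb.linearIndependent.span_eq_top_of_card_eq_finrank' (by simp [hn])
  have := (OrthonormalBasis.mk hb h.ge).sum_repr' w
  simpa using this.symm

theorem mvfderiv_inner_covCurve {E : Type*} [NormedAddCommGroup E] [NormedSpace ℝ E]
    [FiniteDimensional ℝ E] {H : Type*} [TopologicalSpace H] {I : ModelWithCorners ℝ E H}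
    {M : Type*} [TopologicalSpace M] [ChartedSpace H M] [IsManifold I ∞ M]
    [RiemannianBundle (fun x : M => TangentSpace I x)]
    [IsContMDiffRiemannianBundle I ∞ E (fun x : M => TangentSpace I x)]
    {γ : ℝ → M} {A A' : Π s : ℝ, TangentSpace I (γ s)} {s : ℝ}
    (hA : SmoothAlong I 𝓘(ℝ, ℝ) γ A s) (hA' : SmoothAlong I 𝓘(ℝ, ℝ) γ A' s) :
    mvfderiv 𝓘(ℝ, ℝ) (fun s => ⟪A s, A' s⟫_ℝ) s (1 : ℝ) =
      ⟪covCurve I γ A s, A' s⟫_ℝ + ⟪A s, covCurve I γ A' s⟫_ℝ :=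
  mvfderiv_inner_along hA hA' _

section UnitSpeed

variable {B : Type*} [TopologicalSpace B] [ChartedSpace (EuclideanSpace ℝ (Fin 2)) B]
  [IsManifold (𝓡 2) ∞ B]
  [RiemannianBundle (fun x : B => TangentSpace (𝓡 2) x)]
  [IsContMDiffRiemannianBundle (𝓡 2) ∞ (EuclideanSpace ℝ (Fin 2))
    (fun x : B => TangentSpace (𝓡 2) x)]
  {γ : ℝ → B} {J : Set ℝ}

theorem inner_velocity_acceleration (hJ : IsOpen J) (hγ : IsUnitSpeedOn (𝓡 2) γ J) {s : ℝ}
    (hs : s ∈ J) : ⟪velocity (𝓡 2) γ s, covCurve (𝓡 2) γ (velocity (𝓡 2) γ) s⟫_ℝ = 0 := by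
  have hv := smoothAlong_velocity hJ hγ.1 hs
  have h1 := mvfderiv_inner_covCurve hv hv
  have h2 : (fun s => ⟪velocity (𝓡 2) γ s, velocity (𝓡 2) γ s⟫_ℝ) =ᶠ[𝓝 s] fun _ => (1 : ℝ) := by
    filter_upwards [hJ.mem_nhds hs] with t ht
    rw [real_inner_self_eq_norm_sq, hγ.2 t ht, one_pow]
  have h4 := h2.mfderiv_eq (I := 𝓘(ℝ, ℝ)) (I' := 𝓘(ℝ, ℝ))
  rw [mfderiv_const] at h4
  rw [show mvfderiv 𝓘(ℝ, ℝ) (fun s => ⟪velocity (𝓡 2) γ s, velocity (𝓡 2) γ s⟫_ℝ) s (1 : ℝ) = 0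
    from congrArg (fun L : ℝ →L[ℝ] ℝ => L 1) h4, real_inner_comm] at h1
  linarith

end UnitSpeed

section HopfCylinder

variable {M : Type*} [TopologicalSpace M] [ChartedSpace (EuclideanSpace ℝ (Fin 3)) M]
  [IsManifold (𝓡 3) ∞ M]
  [RiemannianBundle (fun x : M => TangentSpace (𝓡 3) x)]
  [IsContMDiffRiemannianBundle (𝓡 3) ∞ (EuclideanSpace ℝ (Fin 3))
    (fun x : M => TangentSpace (𝓡 3) x)]
  {B : Type*} [TopologicalSpace B] [ChartedSpace (EuclideanSpace ℝ (Fin 2)) B]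
  [IsManifold (𝓡 2) ∞ B]
  [RiemannianBundle (fun x : B => TangentSpace (𝓡 2) x)]
  [IsContMDiffRiemannianBundle (𝓡 2) ∞ (EuclideanSpace ℝ (Fin 2))
    (fun x : B => TangentSpace (𝓡 2) x)]
  {S : Type*} [TopologicalSpace S] [ChartedSpace (EuclideanSpace ℝ (Fin 2)) S]
  [IsManifold (𝓡 2) ∞ S]
  [RiemannianBundle (fun x : S => TangentSpace (𝓡 2) x)]

/-- The Hopf cylinder over a unit speed curve in the base of a regular Sasaki manifold, together
with a local parameter. -/
structure HopfChart (C : ContactRiemannianStructure M) (pr : M → B) (γ : ℝ → B) (J : Set ℝ)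
    (ι : S → M) (x : S) (U : Set S) (σ : S → ℝ) : Prop where
  sasaki : C.IsSasaki
  fibration : IsBoothbyWangFibration C pr
  isOpen : IsOpen J
  unitSpeed : IsUnitSpeedOn (𝓡 2) γ J
  cylinder : IsHopfCylinder pr γ J ι
  near : IsParameterNear pr γ J ι x U σ

/-- The section of `(pr ∘ ι)^*TB` induced by a vector field along `γ`. -/
def pullCurve (pr : M → B) {γ : ℝ → B} (ι : S → M) (σ : S → ℝ)
    (A : Π s : ℝ, TangentSpace (𝓡 2) (γ s)) (y : S) : TangentSpace (𝓡 2) (pr (ι y)) :=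
  castTangent (pr (ι y)) (A (σ y))

/-- The horizontal lift of the velocity of `γ` to the Hopf cylinder. -/
def hopfTangent (pr : M → B) (γ : ℝ → B) (ι : S → M) (σ : S → ℝ) (y : S) :
    TangentSpace (𝓡 3) (ι y) :=
  (InnerProductSpace.toDual ℝ (TangentSpace (𝓡 3) (ι y))).symm
    ((innerSL ℝ (pullCurve pr ι σ (velocity (𝓡 2) γ) y)).comp (mfderiv (𝓡 3) (𝓡 2) pr (ι y)))

/-- The unit normal of the Hopf cylinder. -/
def hopfNormal (C : ContactRiemannianStructure M) (pr : M → B) (γ : ℝ → B) (ι : S → M) (σ : S → ℝ)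
    (y : S) : TangentSpace (𝓡 3) (ι y) :=
  C.φ (ι y) (hopfTangent pr γ ι σ y)

/-- The component of a vector field along `γ` in the direction of the projected normal of the
Hopf cylinder. -/
def hopfComponent (C : ContactRiemannianStructure M) (pr : M → B) {γ : ℝ → B} (ι : S → M)
    (σ : S → ℝ) (A : Π s : ℝ, TangentSpace (𝓡 2) (γ s)) (y : S) : ℝ :=
  ⟪pullCurve pr ι σ A y, mfderiv (𝓡 3) (𝓡 2) pr (ι y) (hopfNormal C pr γ ι σ y)⟫_ℝ

namespace HopfChart

variable {C : ContactRiemannianStructure M} {pr : M → B} {γ : ℝ → B} {J : Set ℝ} {ι : S → M}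
  {x : S} {U : Set S} {σ : S → ℝ}

theorem of_mem (h : HopfChart C pr γ J ι x U σ) {y : S} (hy : y ∈ U) :
    HopfChart C pr γ J ι y U σ :=
  { h with near := { h.near with mem := hy } }

theorem eventually (h : HopfChart C pr γ J ι x U σ) :
    ∀ᶠ y in 𝓝 x, HopfChart C pr γ J ι y U σ :=
  Filter.mem_of_superset (h.near.isOpen.mem_nhds h.near.mem) fun _ hy => h.of_mem hy

theorem mem_parameter (h : HopfChart C pr γ J ι x U σ) : σ x ∈ J := h.near.mapsTo h.near.mem

theorem lift_eventuallyEq (h : HopfChart C pr γ J ι x U σ) :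
    (fun y => γ (σ y)) =ᶠ[𝓝 x] fun y => pr (ι y) :=
  h.eventually.mono fun y hy => (hy.near.lift y hy.near.mem).symm

theorem contMDiffAt_parameter (h : HopfChart C pr γ J ι x U σ) :
    ContMDiffAt (𝓡 2) 𝓘(ℝ, ℝ) ∞ σ x :=
  h.near.smooth.contMDiffAt (h.near.isOpen.mem_nhds h.near.mem)

theorem mdiffAt_parameter (h : HopfChart C pr γ J ι x U σ) : MDifferentiableAt (𝓡 2) 𝓘(ℝ, ℝ) σ x :=
  h.contMDiffAt_parameter.mdifferentiableAt (by simp)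

theorem contMDiffAt (h : HopfChart C pr γ J ι x U σ) : ContMDiffAt (𝓡 2) (𝓡 3) ∞ ι x :=
  h.cylinder.smooth.contMDiffAt

theorem smoothAlong_velocity (h : HopfChart C pr γ J ι x U σ) :
    ∀ s ∈ J, SmoothAlong (𝓡 2) 𝓘(ℝ, ℝ) γ (velocity (𝓡 2) γ) s :=
  fun _ hs => RiemGeom.smoothAlong_velocity h.isOpen h.unitSpeed.1 hs

theorem inner_pullCurve (h : HopfChart C pr γ J ι x U σ)
    (A A' : Π s : ℝ, TangentSpace (𝓡 2) (γ s)) :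
    ⟪pullCurve pr ι σ A x, pullCurve pr ι σ A' x⟫_ℝ = ⟪A (σ x), A' (σ x)⟫_ℝ :=
  inner_castTangent (h.near.lift x h.near.mem).symm _ _

theorem smoothAlong_pullCurve (h : HopfChart C pr γ J ι x U σ)
    {A : Π s : ℝ, TangentSpace (𝓡 2) (γ s)}
    (hA : ∀ s ∈ J, SmoothAlong (𝓡 2) 𝓘(ℝ, ℝ) γ A s) :
    SmoothAlong (𝓡 2) (𝓡 2) (fun y => pr (ι y)) (pullCurve pr ι σ A) x :=
  SmoothAlong.cast (f := fun y => γ (σ y)) (V := fun y => A (σ y)) h.lift_eventuallyEq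
    (ContMDiffAt.comp x (hA _ h.mem_parameter) h.contMDiffAt_parameter)

theorem covAlong_pullCurve (h : HopfChart C pr γ J ι x U σ)
    {A : Π s : ℝ, TangentSpace (𝓡 2) (γ s)}
    (hA : ∀ s ∈ J, SmoothAlong (𝓡 2) 𝓘(ℝ, ℝ) γ A s) (v : TangentSpace (𝓡 2) x) :
    covAlong (𝓡 2) (𝓡 2) (fun y => pr (ι y)) (pullCurve pr ι σ A) x v =
      mvfderiv (𝓡 2) σ x v • pullCurve pr ι σ (covCurve (𝓡 2) γ A) x := by
  have h1 := covAlong_cast (I := 𝓡 2) (J := 𝓡 2) h.lift_eventuallyEq (fun y => A (σ y)) v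
  refine h1.trans ?_
  rw [covAlong_comp_map h.mdiffAt_parameter (hA _ h.mem_parameter)]
  have h2 : mfderiv (𝓡 2) 𝓘(ℝ, ℝ) σ x v = (mvfderiv (𝓡 2) σ x v) • (1 : ℝ) := by
    rw [smul_eq_mul, mul_one]; rfl
  rw [h2]
  have h3 := (covAlong (𝓡 2) 𝓘(ℝ, ℝ) γ A (σ x)).map_smul (mvfderiv (𝓡 2) σ x v) (1 : ℝ)
  exact (congrArg (castTangent (pr (ι x))) h3).trans (castTangent_smul _ _)

theorem mfderiv_mfderiv (h : HopfChart C pr γ J ι x U σ) (v : TangentSpace (𝓡 2) x) :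
    mfderiv (𝓡 3) (𝓡 2) pr (ι x) (mfderiv (𝓡 2) (𝓡 3) ι x v) =
      mvfderiv (𝓡 2) σ x v • pullCurve pr ι σ (velocity (𝓡 2) γ) x := by
  have h1 := mfderiv_comp_apply x (f := ι) (g := pr)
    (h.fibration.smooth.contMDiffAt.mdifferentiableAt (by simp))
    (h.contMDiffAt.mdifferentiableAt (by simp)) v
  have h2 := mfderiv_comp_apply x (f := σ) (g := γ)
    ((h.unitSpeed.1.contMDiffAt (h.isOpen.mem_nhds h.mem_parameter)).mdifferentiableAt (by simp))
    h.mdiffAt_parameter v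
  have h3 := h.lift_eventuallyEq.mfderiv_eq (I := 𝓡 2) (I' := 𝓡 2)
  have h4 : mfderiv (𝓡 2) 𝓘(ℝ, ℝ) σ x v = (mvfderiv (𝓡 2) σ x v) • (1 : ℝ) := by
    rw [smul_eq_mul, mul_one]; rfl
  rw [h4] at h2
  have h5 := (mfderiv 𝓘(ℝ, ℝ) (𝓡 2) γ (σ x)).map_smul (mvfderiv (𝓡 2) σ x v) (1 : ℝ)
  have h6 := congrArg (fun L : EuclideanSpace ℝ (Fin 2) →L[ℝ] EuclideanSpace ℝ (Fin 2) => L v) h3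
  exact h1.symm.trans (h6.symm.trans (h2.trans h5))

theorem inner_hopfTangent (y : S) (w : TangentSpace (𝓡 3) (ι y)) :
    ⟪hopfTangent pr γ ι σ y, w⟫_ℝ =
      ⟪pullCurve pr ι σ (velocity (𝓡 2) γ) y, mfderiv (𝓡 3) (𝓡 2) pr (ι y) w⟫_ℝ := by
  rw [hopfTangent, InnerProductSpace.toDual_symm_apply]; rfl

theorem η_hopfTangent (h : HopfChart C pr γ J ι x U σ) :
    C.η (ι x) (hopfTangent pr γ ι σ x) = 0 := by
  rw [← C.inner_ξ, real_inner_comm, inner_hopfTangent, h.fibration.mfderiv_ξ, inner_zero_right]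

theorem mfderiv_hopfTangent (h : HopfChart C pr γ J ι x U σ) :
    mfderiv (𝓡 3) (𝓡 2) pr (ι x) (hopfTangent pr γ ι σ x) =
      pullCurve pr ι σ (velocity (𝓡 2) γ) x := by
  obtain ⟨v, hv, hd⟩ := h.fibration.exists_horizontal (ι x)
    (pullCurve pr ι σ (velocity (𝓡 2) γ) x)
  have : hopfTangent pr γ ι σ x = v := ext_inner_right ℝ fun w => by
    rw [inner_hopfTangent, ← hd, h.fibration.inner_mfderiv, hv, zero_mul, sub_zero]
  rw [this, hd]

theorem smoothAlong_hopfTangent (h : HopfChart C pr γ J ι x U σ) :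
    SmoothAlong (𝓡 3) (𝓡 2) ι (hopfTangent pr γ ι σ) x := by
  refine smoothAlong_of_inner h.contMDiffAt fun Y hY => ?_
  simp only [inner_hopfTangent]
  exact (h.smoothAlong_pullCurve h.smoothAlong_velocity).inner
    (h.fibration.smoothAlong_mfderiv_comp (.comp_section h.contMDiffAt hY.self_of_nhds))

theorem inner_velocity (h : HopfChart C pr γ J ι x U σ) :
    ⟪velocity (𝓡 2) γ (σ x), velocity (𝓡 2) γ (σ x)⟫_ℝ = 1 := by
  rw [real_inner_self_eq_norm_sq, h.unitSpeed.2 _ h.mem_parameter, one_pow]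

theorem inner_hopfTangent_self (h : HopfChart C pr γ J ι x U σ) :
    ⟪hopfTangent pr γ ι σ x, hopfTangent pr γ ι σ x⟫_ℝ = 1 := by
  rw [inner_hopfTangent, h.mfderiv_hopfTangent, h.inner_pullCurve, h.inner_velocity]

theorem smoothAlong_hopfNormal (h : HopfChart C pr γ J ι x U σ) :
    SmoothAlong (𝓡 3) (𝓡 2) ι (hopfNormal C pr γ ι σ) x :=
  C.smoothAlong_φ h.smoothAlong_hopfTangent

theorem smoothAlong_ξ (h : HopfChart C pr γ J ι x U σ) :
    SmoothAlong (𝓡 3) (𝓡 2) ι (fun y => C.ξ (ι y)) x := C.smoothAlong_ξ h.contMDiffAt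

theorem η_hopfNormal (y : S) : C.η (ι y) (hopfNormal C pr γ ι σ y) = 0 := C.η_φ _ _

theorem inner_hopfTangent_hopfNormal (y : S) :
    ⟪hopfTangent pr γ ι σ y, hopfNormal C pr γ ι σ y⟫_ℝ = 0 := C.inner_φ_self _ _

theorem inner_hopfNormal_self (h : HopfChart C pr γ J ι x U σ) :
    ⟪hopfNormal C pr γ ι σ x, hopfNormal C pr γ ι σ x⟫_ℝ = 1 := by
  rw [hopfNormal, C.inner_φ_φ, h.inner_hopfTangent_self, h.η_hopfTangent]; ring

theorem φ_hopfNormal (h : HopfChart C pr γ J ι x U σ) :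
    C.φ (ι x) (hopfNormal C pr γ ι σ x) = -hopfTangent pr γ ι σ x := by
  rw [hopfNormal, C.φ_φ, h.η_hopfTangent, zero_smul, add_zero]

/-- The differential of a Hopf cylinder. -/
theorem mfderiv_eq (h : HopfChart C pr γ J ι x U σ) (v : TangentSpace (𝓡 2) x) :
    mfderiv (𝓡 2) (𝓡 3) ι x v = mvfderiv (𝓡 2) σ x v • hopfTangent pr γ ι σ x +
      C.η (ι x) (mfderiv (𝓡 2) (𝓡 3) ι x v) • C.ξ (ι x) := by
  rw [← sub_eq_iff_eq_add]
  refine h.fibration.eq_of_horizontal ?_ ?_ ?_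
  · rw [map_sub, map_smul, C.η_ξ, smul_eq_mul, mul_one, sub_self]
  · rw [map_smul, h.η_hopfTangent, smul_zero]
  · rw [map_sub, map_smul, h.fibration.mfderiv_ξ, smul_zero, sub_zero, h.mfderiv_mfderiv, map_smul,
      h.mfderiv_hopfTangent]

theorem inner_mfderiv_hopfTangent (h : HopfChart C pr γ J ι x U σ) (v : TangentSpace (𝓡 2) x) :
    ⟪mfderiv (𝓡 2) (𝓡 3) ι x v, hopfTangent pr γ ι σ x⟫_ℝ = mvfderiv (𝓡 2) σ x v := by
  rw [h.mfderiv_eq, inner_add_left, real_inner_smul_left, real_inner_smul_left,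
    h.inner_hopfTangent_self, C.inner_ξ, h.η_hopfTangent]
  ring

theorem inner_mfderiv_hopfNormal (h : HopfChart C pr γ J ι x U σ) (v : TangentSpace (𝓡 2) x) :
    ⟪mfderiv (𝓡 2) (𝓡 3) ι x v, hopfNormal C pr γ ι σ x⟫_ℝ = 0 := by
  rw [h.mfderiv_eq, inner_add_left, real_inner_smul_left, real_inner_smul_left,
    inner_hopfTangent_hopfNormal, C.inner_ξ, η_hopfNormal]
  ring

theorem φ_mfderiv (h : HopfChart C pr γ J ι x U σ) (v : TangentSpace (𝓡 2) x) :
    C.φ (ι x) (mfderiv (𝓡 2) (𝓡 3) ι x v) =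
      mvfderiv (𝓡 2) σ x v • hopfNormal C pr γ ι σ x := by
  rw [h.mfderiv_eq, map_add, map_smul, map_smul, C.φ_ξ, smul_zero, add_zero]; rfl

/-- The frame `hopfTangent, hopfNormal, ξ` is orthonormal. -/
theorem eq_sum_frame (h : HopfChart C pr γ J ι x U σ) (w : TangentSpace (𝓡 3) (ι x)) :
    w = ⟪hopfTangent pr γ ι σ x, w⟫_ℝ • hopfTangent pr γ ι σ x +
      ⟪hopfNormal C pr γ ι σ x, w⟫_ℝ • hopfNormal C pr γ ι σ x + C.η (ι x) w • C.ξ (ι x) := by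
  let b : Fin 3 → TangentSpace (𝓡 3) (ι x) :=
    ![hopfTangent pr γ ι σ x, hopfNormal C pr γ ι σ x, C.ξ (ι x)]
  have h1 := h.inner_hopfTangent_self
  have h2 := h.inner_hopfNormal_self
  have h3 := C.inner_ξ_ξ (ι x)
  have h4 := inner_hopfTangent_hopfNormal (C := C) (pr := pr) (γ := γ) (ι := ι) (σ := σ) x
  have h5 : ⟪C.ξ (ι x), hopfTangent pr γ ι σ x⟫_ℝ = 0 := by rw [C.inner_ξ, h.η_hopfTangent]
  have h6 : ⟪C.ξ (ι x), hopfNormal C pr γ ι σ x⟫_ℝ = 0 := by rw [C.inner_ξ, η_hopfNormal]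
  have hb : Orthonormal ℝ b := by
    rw [orthonormal_iff_ite]
    intro i j
    fin_cases i <;> fin_cases j <;> simp [b, -inner_self_eq_norm_sq_to_K, h1, h2, h3, h4, h5, h6, real_inner_comm (C.ξ (ι x)), real_inner_comm (hopfTangent pr γ ι σ x)]
  have hs := hb.eq_sum_inner_smul (finrank_euclideanSpace_fin (𝕜 := ℝ) (n := 3)) w
  rw [Fin.sum_univ_three] at hs
  rw [← C.inner_ξ]
  exact hs

theorem mfderiv_hopfNormal_inner (h : HopfChart C pr γ J ι x U σ) (w : TangentSpace (𝓡 3) (ι x)) :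
    ⟪mfderiv (𝓡 3) (𝓡 2) pr (ι x) w,
      mfderiv (𝓡 3) (𝓡 2) pr (ι x) (hopfNormal C pr γ ι σ x)⟫_ℝ =
      ⟪w, hopfNormal C pr γ ι σ x⟫_ℝ := by
  rw [h.fibration.inner_mfderiv, η_hopfNormal, mul_zero, sub_zero]

/-- Vector fields along `γ` in terms of the velocity and the projected normal. -/
theorem pullCurve_eq (h : HopfChart C pr γ J ι x U σ) (A : Π s : ℝ, TangentSpace (𝓡 2) (γ s)) :
    pullCurve pr ι σ A x =
      ⟪velocity (𝓡 2) γ (σ x), A (σ x)⟫_ℝ • pullCurve pr ι σ (velocity (𝓡 2) γ) x +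
      hopfComponent C pr ι σ A x • mfderiv (𝓡 3) (𝓡 2) pr (ι x) (hopfNormal C pr γ ι σ x) := by
  obtain ⟨v, hv, hd⟩ := h.fibration.exists_horizontal (ι x) (pullCurve pr ι σ A x)
  have h1 := congrArg (mfderiv (𝓡 3) (𝓡 2) pr (ι x)) (h.eq_sum_frame v)
  rw [map_add, map_add, map_smul, map_smul, map_smul, h.fibration.mfderiv_ξ, smul_zero, add_zero,
    h.mfderiv_hopfTangent, hd, inner_hopfTangent, hd, h.inner_pullCurve,
    real_inner_comm v (hopfNormal C pr γ ι σ x), ← h.mfderiv_hopfNormal_inner, hd] at h1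
  exact h1

theorem hopfComponent_velocity (y : S) :
    hopfComponent C pr ι σ (velocity (𝓡 2) γ) y = 0 := by
  rw [hopfComponent, ← inner_hopfTangent, inner_hopfTangent_hopfNormal]

theorem contMDiffAt_hopfComponent (h : HopfChart C pr γ J ι x U σ)
    {A : Π s : ℝ, TangentSpace (𝓡 2) (γ s)}
    (hA : ∀ s ∈ J, SmoothAlong (𝓡 2) 𝓘(ℝ, ℝ) γ A s) :
    ContMDiffAt (𝓡 2) 𝓘(ℝ, ℝ) ∞ (hopfComponent C pr ι σ A) x :=
  (h.smoothAlong_pullCurve hA).inner (h.fibration.smoothAlong_mfderiv_comp h.smoothAlong_hopfNormal)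

theorem smoothAlong_covCurve (h : HopfChart C pr γ J ι x U σ)
    {A : Π s : ℝ, TangentSpace (𝓡 2) (γ s)}
    (hA : ∀ s ∈ J, SmoothAlong (𝓡 2) 𝓘(ℝ, ℝ) γ A s) :
    ∀ s ∈ J, SmoothAlong (𝓡 2) 𝓘(ℝ, ℝ) γ (covCurve (𝓡 2) γ A) s :=
  fun _ hs => RiemGeom.smoothAlong_covCurve h.isOpen hA hs

theorem smoothAlong_acceleration (h : HopfChart C pr γ J ι x U σ) :
    ∀ s ∈ J, SmoothAlong (𝓡 2) 𝓘(ℝ, ℝ) γ (covCurve (𝓡 2) γ (velocity (𝓡 2) γ)) s :=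
  h.smoothAlong_covCurve h.smoothAlong_velocity

theorem covAlong_ξ (h : HopfChart C pr γ J ι x U σ) (v : TangentSpace (𝓡 2) x) :
    covAlong (𝓡 3) (𝓡 2) ι (fun y => C.ξ (ι y)) x v =
      -(mvfderiv (𝓡 2) σ x v • hopfNormal C pr γ ι σ x) := by
  rw [h.sasaki.covAlong_ξ h.contMDiffAt, h.φ_mfderiv]

theorem covAlong_hopfTangent (h : HopfChart C pr γ J ι x U σ) (v : TangentSpace (𝓡 2) x) :
    covAlong (𝓡 3) (𝓡 2) ι (hopfTangent pr γ ι σ) x v =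
      (mvfderiv (𝓡 2) σ x v * hopfComponent C pr ι σ (covCurve (𝓡 2) γ (velocity (𝓡 2) γ)) x -
        C.η (ι x) (mfderiv (𝓡 2) (𝓡 3) ι x v)) • hopfNormal C pr γ ι σ x := by
  refine h.fibration.eq_of_horizontal ?_ ?_ ?_
  · have h1 := mvfderiv_inner_along h.smoothAlong_ξ h.smoothAlong_hopfTangent v
    have h2 : mvfderiv (𝓡 2) (fun y => ⟪C.ξ (ι y), hopfTangent pr γ ι σ y⟫_ℝ) x v = 0 := by
      have h3 : (fun y => ⟪C.ξ (ι y), hopfTangent pr γ ι σ y⟫_ℝ) =ᶠ[𝓝 x] fun _ => (0 : ℝ) :=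
        h.eventually.mono fun y hy => by simp only [C.inner_ξ, hy.η_hopfTangent]
      have h4 := h3.mfderiv_eq (I := 𝓡 2) (I' := 𝓘(ℝ, ℝ))
      rw [mfderiv_const] at h4
      exact congrArg (fun L : EuclideanSpace ℝ (Fin 2) →L[ℝ] ℝ => L v) h4
    rw [h2, h.covAlong_ξ, inner_neg_left, real_inner_smul_left, real_inner_comm,
      inner_hopfTangent_hopfNormal, C.inner_ξ] at h1
    linarith
  · rw [map_smul, η_hopfNormal, smul_zero]
  · have h1 := h.fibration.covAlong_mfderiv_comp h.sasaki h.smoothAlong_hopfTangent v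
    rw [h.η_hopfTangent, zero_smul, add_zero, covAlong_congr (W := pullCurve pr ι σ (velocity (𝓡 2) γ))
      (h.eventually.mono fun y hy => hy.mfderiv_hopfTangent),
      h.covAlong_pullCurve h.smoothAlong_velocity, h.pullCurve_eq (C := C),
      inner_velocity_acceleration h.isOpen h.unitSpeed h.mem_parameter, zero_smul, zero_add, map_add, map_smul,
      ← sub_eq_iff_eq_add] at h1
    rw [← h1, map_smul, sub_smul, smul_smul]
    rfl

theorem covAlong_hopfNormal (h : HopfChart C pr γ J ι x U σ) (v : TangentSpace (𝓡 2) x) :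
    covAlong (𝓡 3) (𝓡 2) ι (hopfNormal C pr γ ι σ) x v =
      (C.η (ι x) (mfderiv (𝓡 2) (𝓡 3) ι x v) -
        mvfderiv (𝓡 2) σ x v * hopfComponent C pr ι σ (covCurve (𝓡 2) γ (velocity (𝓡 2) γ)) x) •
          hopfTangent pr γ ι σ x + mvfderiv (𝓡 2) σ x v • C.ξ (ι x) := by
  have h1 := h.sasaki.covAlong_φ h.smoothAlong_hopfTangent v
  rw [h.covAlong_hopfTangent, h.η_hopfTangent, h.inner_mfderiv_hopfTangent, map_smul,
    h.φ_hopfNormal] at h1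
  refine h1.trans ?_
  module

theorem mvfderiv_hopfComponent (h : HopfChart C pr γ J ι x U σ)
    {A : Π s : ℝ, TangentSpace (𝓡 2) (γ s)}
    (hA : ∀ s ∈ J, SmoothAlong (𝓡 2) 𝓘(ℝ, ℝ) γ A s) (v : TangentSpace (𝓡 2) x) :
    mvfderiv (𝓡 2) (hopfComponent C pr ι σ A) x v =
      mvfderiv (𝓡 2) σ x v * (hopfComponent C pr ι σ (covCurve (𝓡 2) γ A) x -
        hopfComponent C pr ι σ (covCurve (𝓡 2) γ (velocity (𝓡 2) γ)) x *
          ⟪velocity (𝓡 2) γ (σ x), A (σ x)⟫_ℝ) := by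
  have h1 := mvfderiv_inner_along (h.smoothAlong_pullCurve hA)
    (h.fibration.smoothAlong_mfderiv_comp h.smoothAlong_hopfNormal) v
  rw [h.covAlong_pullCurve hA, h.fibration.covAlong_mfderiv_comp h.sasaki h.smoothAlong_hopfNormal,
    h.covAlong_hopfNormal, η_hopfNormal, h.φ_hopfNormal, zero_smul, add_zero] at h1
  refine h1.trans ?_
  simp only [map_add, map_smul, map_neg, h.fibration.mfderiv_ξ, h.mfderiv_hopfTangent,
    inner_add_right, real_inner_smul_left, real_inner_smul_right, inner_neg_right, smul_zero,
    inner_zero_right, h.inner_pullCurve, real_inner_comm (velocity (𝓡 2) γ (σ x))]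
  simp only [hopfComponent]
  ring

end HopfChart
end HopfCylinder

section HopfCylinderCurvature

variable {M : Type*} [TopologicalSpace M] [ChartedSpace (EuclideanSpace ℝ (Fin 3)) M]
  [IsManifold (𝓡 3) ∞ M]
  [RiemannianBundle (fun x : M => TangentSpace (𝓡 3) x)]
  [IsContMDiffRiemannianBundle (𝓡 3) ∞ (EuclideanSpace ℝ (Fin 3))
    (fun x : M => TangentSpace (𝓡 3) x)]
  {B : Type*} [TopologicalSpace B] [ChartedSpace (EuclideanSpace ℝ (Fin 2)) B]
  [IsManifold (𝓡 2) ∞ B]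
  [RiemannianBundle (fun x : B => TangentSpace (𝓡 2) x)]
  [IsContMDiffRiemannianBundle (𝓡 2) ∞ (EuclideanSpace ℝ (Fin 2))
    (fun x : B => TangentSpace (𝓡 2) x)]
  {S : Type*} [TopologicalSpace S] [ChartedSpace (EuclideanSpace ℝ (Fin 2)) S]
  [IsManifold (𝓡 2) ∞ S]
  [RiemannianBundle (fun x : S => TangentSpace (𝓡 2) x)]

namespace HopfChart

variable {C : ContactRiemannianStructure M} {pr : M → B} {γ : ℝ → B} {J : Set ℝ} {ι : S → M}
  {x : S} {U : Set S} {σ : S → ℝ}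

theorem η_mfderiv_eq_inner (v : TangentSpace (𝓡 2) x) :
    C.η (ι x) (mfderiv (𝓡 2) (𝓡 3) ι x v) = ⟪mfderiv (𝓡 2) (𝓡 3) ι x v, C.ξ (ι x)⟫_ℝ := by
  rw [real_inner_comm, C.inner_ξ]

/-- The tangent space of a Hopf cylinder is spanned by `hopfTangent` and `ξ`. -/
theorem exists_mfderiv_eq (h : HopfChart C pr γ J ι x U σ) (a b : ℝ) :
    ∃ v, mfderiv (𝓡 2) (𝓡 3) ι x v = a • hopfTangent pr γ ι σ x + b • C.ξ (ι x) := by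
  let L : EuclideanSpace ℝ (Fin 2) →ₗ[ℝ] ℝ × ℝ :=
    ((mvfderiv (𝓡 2) σ x).toLinearMap).prod
      ((C.η (ι x)).toLinearMap ∘ₗ (mfderiv (𝓡 2) (𝓡 3) ι x).toLinearMap)
  have hL : Function.Injective L := by
    rw [injective_iff_map_eq_zero]
    intro v hv
    have h1 : mvfderiv (𝓡 2) σ x v = 0 := congrArg Prod.fst hv
    have h2 : C.η (ι x) (mfderiv (𝓡 2) (𝓡 3) ι x v) = 0 := congrArg Prod.snd hv
    have h3 := h.mfderiv_eq v
    rw [h1, h2, zero_smul, zero_smul, add_zero] at h3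
    have h4 := h.cylinder.isometric x v v
    rw [h3, inner_zero_left] at h4
    exact inner_self_eq_zero (E := TangentSpace (𝓡 2) x).1 h4.symm
  obtain ⟨v, hv⟩ := (LinearMap.injective_iff_surjective_of_finrank_eq_finrank
    (f := L) (by simp)).1 hL (a, b)
  have h1 : mvfderiv (𝓡 2) σ x v = a := congrArg Prod.fst hv
  have h2 : C.η (ι x) (mfderiv (𝓡 2) (𝓡 3) ι x v) = b := congrArg Prod.snd hv
  exact ⟨v, (h.mfderiv_eq v).trans (congrArg₂ (fun s t : ℝ =>
    s • hopfTangent pr γ ι σ x + t • C.ξ (ι x)) h1 h2)⟩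

theorem exists_adapted_basis (h : HopfChart C pr γ J ι x U σ) :
    ∃ e₁ e₀ : TangentSpace (𝓡 2) x, ⟪e₁, e₁⟫_ℝ = 1 ∧ ⟪e₁, e₀⟫_ℝ = 0 ∧ ⟪e₀, e₀⟫_ℝ = 1 ∧
      mfderiv (𝓡 2) (𝓡 3) ι x e₁ = hopfTangent pr γ ι σ x ∧
      mfderiv (𝓡 2) (𝓡 3) ι x e₀ = C.ξ (ι x) ∧
      (∀ v, mvfderiv (𝓡 2) σ x v = ⟪v, e₁⟫_ℝ) ∧
      ∀ v, C.η (ι x) (mfderiv (𝓡 2) (𝓡 3) ι x v) = ⟪v, e₀⟫_ℝ := by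
  obtain ⟨e₁, h1⟩ := h.exists_mfderiv_eq 1 0
  obtain ⟨e₀, h0⟩ := h.exists_mfderiv_eq 0 1
  rw [one_smul, zero_smul, add_zero] at h1
  rw [one_smul, zero_smul, zero_add] at h0
  refine ⟨e₁, e₀, ?_, ?_, ?_, h1, h0, fun v => ?_, fun v => ?_⟩
  · rw [← h.cylinder.isometric, h1, h.inner_hopfTangent_self]
  · rw [← h.cylinder.isometric, h1, h0, real_inner_comm, C.inner_ξ, h.η_hopfTangent]
  · rw [← h.cylinder.isometric, h0, C.inner_ξ_ξ]
  · rw [← h.cylinder.isometric, h1, h.inner_mfderiv_hopfTangent]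
  · rw [← h.cylinder.isometric, h0, η_mfderiv_eq_inner]

/-- The trace of a quadratic expression in the coframe of a Hopf cylinder. -/
theorem sum_stdOrthonormalBasis (h : HopfChart C pr γ J ι x U σ) {V : Type*} [AddCommGroup V]
    [Module ℝ V] {Q : TangentSpace (𝓡 2) x → V} (a b c : V)
    (hQ : ∀ v, Q v = mvfderiv (𝓡 2) σ x v ^ 2 • a +
      (mvfderiv (𝓡 2) σ x v * C.η (ι x) (mfderiv (𝓡 2) (𝓡 3) ι x v)) • b +
      C.η (ι x) (mfderiv (𝓡 2) (𝓡 3) ι x v) ^ 2 • c) :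
    ∑ i, Q (stdOrthonormalBasis ℝ (TangentSpace (𝓡 2) x) i) = a + c := by
  obtain ⟨e₁, e₀, h11, h10, h00, -, -, hσ, hη⟩ := h.exists_adapted_basis
  have key : ∀ u w, ∑ i, ⟪stdOrthonormalBasis ℝ (TangentSpace (𝓡 2) x) i, u⟫_ℝ *
      ⟪stdOrthonormalBasis ℝ (TangentSpace (𝓡 2) x) i, w⟫_ℝ = ⟪u, w⟫_ℝ := fun u w => by
    rw [← (stdOrthonormalBasis ℝ (TangentSpace (𝓡 2) x)).sum_inner_mul_inner u w]
    exact Finset.sum_congr rfl fun i _ => by rw [real_inner_comm u]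
  simp only [hQ, hσ, hη, Finset.sum_add_distrib, ← Finset.sum_smul, sq]
  rw [key, key, key, h11, h10, h00]
  module

variable [IsContMDiffRiemannianBundle (𝓡 2) ∞ (EuclideanSpace ℝ (Fin 2))
    (fun x : S => TangentSpace (𝓡 2) x)]

theorem inner_covAlong_mfderiv_extend (h : HopfChart C pr γ J ι x U σ)
    (v w z : TangentSpace (𝓡 2) x) :
    ⟪covAlong (𝓡 3) (𝓡 2) ι (fun y => mfderiv (𝓡 2) (𝓡 3) ι y
        (FiberBundle.extend (EuclideanSpace ℝ (Fin 2)) w y)) x v, mfderiv (𝓡 2) (𝓡 3) ι x z⟫_ℝ =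
      ⟪mfderiv (𝓡 2) (𝓡 3) ι x
        (leviCivita (𝓡 2) S (FiberBundle.extend (EuclideanSpace ℝ (Fin 2)) w) x v),
        mfderiv (𝓡 2) (𝓡 3) ι x z⟫_ℝ := by
  have hs : ∀ u : TangentSpace (𝓡 2) x, ContMDiffAt (𝓡 2) (𝓡 2).tangent ∞ (fun y => (⟨y,
      FiberBundle.extend (EuclideanSpace ℝ (Fin 2)) u y⟩ : TangentBundle (𝓡 2) S)) x := fun u =>
    contMDiffAt_extend (k := ∞) _ _ u
  have key := inner_covAlong_mfderiv h.cylinder.smooth (hs v) (hs w) (hs z)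
    (.of_forall fun _ _ => h.cylinder.isometric _ _ _)
    (.of_forall fun _ _ => h.cylinder.isometric _ _ _)
    (.of_forall fun _ _ => h.cylinder.isometric _ _ _)
  rw [extend_apply_self, extend_apply_self] at key
  rw [key, h.cylinder.isometric]

theorem smoothAlong_mfderiv_extend (h : HopfChart C pr γ J ι x U σ) (w : TangentSpace (𝓡 2) x) :
    SmoothAlong (𝓡 3) (𝓡 2) ι (fun y => mfderiv (𝓡 2) (𝓡 3) ι y
      (FiberBundle.extend (EuclideanSpace ℝ (Fin 2)) w y)) x :=
  smoothAlong_mfderiv h.cylinder.smooth (contMDiffAt_extend (k := ∞) _ _ w)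

theorem contMDiffAt_coframe_tangent (h : HopfChart C pr γ J ι x U σ) (w : TangentSpace (𝓡 2) x) :
    ContMDiffAt (𝓡 2) 𝓘(ℝ, ℝ) ∞
      (fun y => mvfderiv (𝓡 2) σ y (FiberBundle.extend (EuclideanSpace ℝ (Fin 2)) w y)) x :=
  ((h.smoothAlong_mfderiv_extend w).inner h.smoothAlong_hopfTangent).congr_of_eventuallyEq
    (h.eventually.mono fun _ hy => (hy.inner_mfderiv_hopfTangent _).symm)

theorem contMDiffAt_coframe_ξ (h : HopfChart C pr γ J ι x U σ) (w : TangentSpace (𝓡 2) x) :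
    ContMDiffAt (𝓡 2) 𝓘(ℝ, ℝ) ∞
      (fun y => C.η (ι y) (mfderiv (𝓡 2) (𝓡 3) ι y
        (FiberBundle.extend (EuclideanSpace ℝ (Fin 2)) w y))) x :=
  C.contMDiffAt_η (h.smoothAlong_mfderiv_extend w)

theorem mvfderiv_coframe_tangent (h : HopfChart C pr γ J ι x U σ) (v w : TangentSpace (𝓡 2) x) :
    mvfderiv (𝓡 2)
        (fun y => mvfderiv (𝓡 2) σ y (FiberBundle.extend (EuclideanSpace ℝ (Fin 2)) w y)) x v =
      mvfderiv (𝓡 2) σ x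
        (leviCivita (𝓡 2) S (FiberBundle.extend (EuclideanSpace ℝ (Fin 2)) w) x v) := by
  have h1 := mvfderiv_inner_along (h.smoothAlong_mfderiv_extend w) h.smoothAlong_hopfTangent v
  have h2 : (fun y => ⟪mfderiv (𝓡 2) (𝓡 3) ι y (FiberBundle.extend (EuclideanSpace ℝ (Fin 2)) w y),
      hopfTangent pr γ ι σ y⟫_ℝ) =ᶠ[𝓝 x]
      fun y => mvfderiv (𝓡 2) σ y (FiberBundle.extend (EuclideanSpace ℝ (Fin 2)) w y) :=
    h.eventually.mono fun _ hy => hy.inner_mfderiv_hopfTangent _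
  have h3 := congrArg (fun L : EuclideanSpace ℝ (Fin 2) →L[ℝ] ℝ => L v)
    (h2.mfderiv_eq (I := 𝓡 2) (I' := 𝓘(ℝ, ℝ)))
  refine h3.symm.trans (h1.trans ?_)
  obtain ⟨e₁, e₀, -, -, -, he₁, -⟩ := h.exists_adapted_basis
  rw [← h.inner_mfderiv_hopfTangent, ← he₁, h.inner_covAlong_mfderiv_extend, he₁,
    h.covAlong_hopfTangent, real_inner_smul_right, h.inner_mfderiv_hopfNormal, mul_zero, add_zero]

theorem mvfderiv_coframe_ξ (h : HopfChart C pr γ J ι x U σ) (v w : TangentSpace (𝓡 2) x) :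
    mvfderiv (𝓡 2) (fun y => C.η (ι y) (mfderiv (𝓡 2) (𝓡 3) ι y
        (FiberBundle.extend (EuclideanSpace ℝ (Fin 2)) w y))) x v =
      C.η (ι x) (mfderiv (𝓡 2) (𝓡 3) ι x
        (leviCivita (𝓡 2) S (FiberBundle.extend (EuclideanSpace ℝ (Fin 2)) w) x v)) := by
  have h1 := mvfderiv_inner_along (h.smoothAlong_mfderiv_extend w) h.smoothAlong_ξ v
  simp only [← η_mfderiv_eq_inner] at h1
  rw [h1]
  obtain ⟨e₁, e₀, -, -, -, -, he₀, -⟩ := h.exists_adapted_basis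
  rw [η_mfderiv_eq_inner, ← he₀, h.inner_covAlong_mfderiv_extend, he₀,
    h.covAlong_ξ, inner_neg_right, real_inner_smul_right, h.inner_mfderiv_hopfNormal, mul_zero,
    neg_zero, add_zero]

/-- The second fundamental form of a Hopf cylinder. -/
theorem secondFundamentalForm_eq (h : HopfChart C pr γ J ι x U σ) (v w : TangentSpace (𝓡 2) x) :
    secondFundamentalForm (𝓡 3) (𝓡 2) ι x v w =
      (hopfComponent C pr ι σ (covCurve (𝓡 2) γ (velocity (𝓡 2) γ)) x *
          (mvfderiv (𝓡 2) σ x v * mvfderiv (𝓡 2) σ x w) -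
        C.η (ι x) (mfderiv (𝓡 2) (𝓡 3) ι x v) * mvfderiv (𝓡 2) σ x w -
        mvfderiv (𝓡 2) σ x v * C.η (ι x) (mfderiv (𝓡 2) (𝓡 3) ι x w)) •
          hopfNormal C pr γ ι σ x := by
  have h1 := h.contMDiffAt_coframe_tangent w
  have h2 := h.contMDiffAt_coframe_ξ w
  rw [secondFundamentalForm, covAlong_congr (h.eventually.mono fun y hy => hy.mfderiv_eq _),
    covAlong_add (h.smoothAlong_hopfTangent.smul h1) (h.smoothAlong_ξ.smul h2), add_apply,
    covAlong_smul h1 h.smoothAlong_hopfTangent, covAlong_smul h2 h.smoothAlong_ξ,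
    h.mfderiv_eq (leviCivita (𝓡 2) S _ x v), h.covAlong_hopfTangent, h.covAlong_ξ,
    h.mvfderiv_coframe_tangent, h.mvfderiv_coframe_ξ]
  simp only [extend_apply_self]
  module

/-- The mean curvature vector of a Hopf cylinder. -/
theorem meanCurvatureVector_eq (h : HopfChart C pr γ J ι x U σ) :
    meanCurvatureVector (𝓡 3) (𝓡 2) ι x =
      (hopfComponent C pr ι σ (covCurve (𝓡 2) γ (velocity (𝓡 2) γ)) x / 2) •
        hopfNormal C pr γ ι σ x := by
  rw [meanCurvatureVector]
  rw [h.sum_stdOrthonormalBasis (Q := fun v => secondFundamentalForm (𝓡 3) (𝓡 2) ι x v v)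
    (hopfComponent C pr ι σ (covCurve (𝓡 2) γ (velocity (𝓡 2) γ)) x • hopfNormal C pr γ ι σ x)
    ((-2 : ℝ) • hopfNormal C pr γ ι σ x) 0
    fun v => by rw [h.secondFundamentalForm_eq]; module]
  rw [finrank_euclideanSpace_fin, add_zero, smul_smul]
  congr 1
  push_cast
  ring

theorem mvfderiv_curvature (h : HopfChart C pr γ J ι x U σ) (v : TangentSpace (𝓡 2) x) :
    mvfderiv (𝓡 2) (hopfComponent C pr ι σ (covCurve (𝓡 2) γ (velocity (𝓡 2) γ))) x v =
      mvfderiv (𝓡 2) σ x v *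
        hopfComponent C pr ι σ (covCurve (𝓡 2) γ (covCurve (𝓡 2) γ (velocity (𝓡 2) γ))) x := by
  rw [h.mvfderiv_hopfComponent h.smoothAlong_acceleration,
    inner_velocity_acceleration h.isOpen h.unitSpeed h.mem_parameter, mul_zero, sub_zero]

theorem contMDiffAt_curvature (h : HopfChart C pr γ J ι x U σ) :
    ContMDiffAt (𝓡 2) 𝓘(ℝ, ℝ) ∞
      (hopfComponent C pr ι σ (covCurve (𝓡 2) γ (velocity (𝓡 2) γ))) x :=
  h.contMDiffAt_hopfComponent h.smoothAlong_acceleration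

theorem contMDiffAt_curvature_deriv (h : HopfChart C pr γ J ι x U σ) :
    ContMDiffAt (𝓡 2) 𝓘(ℝ, ℝ) ∞
      (hopfComponent C pr ι σ (covCurve (𝓡 2) γ (covCurve (𝓡 2) γ (velocity (𝓡 2) γ)))) x :=
  h.contMDiffAt_hopfComponent (h.smoothAlong_covCurve h.smoothAlong_acceleration)

/-- The covariant derivative of twice the mean curvature vector. -/
theorem covAlong_curvature_smul_hopfNormal (h : HopfChart C pr γ J ι x U σ)
    (v : TangentSpace (𝓡 2) x) :
    covAlong (𝓡 3) (𝓡 2) ι (fun y =>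
      hopfComponent C pr ι σ (covCurve (𝓡 2) γ (velocity (𝓡 2) γ)) y •
        hopfNormal C pr γ ι σ y) x v =
      (mvfderiv (𝓡 2) σ x v *
        hopfComponent C pr ι σ (covCurve (𝓡 2) γ (covCurve (𝓡 2) γ (velocity (𝓡 2) γ))) x) •
          hopfNormal C pr γ ι σ x +
      (hopfComponent C pr ι σ (covCurve (𝓡 2) γ (velocity (𝓡 2) γ)) x *
        (C.η (ι x) (mfderiv (𝓡 2) (𝓡 3) ι x v) - mvfderiv (𝓡 2) σ x v *
          hopfComponent C pr ι σ (covCurve (𝓡 2) γ (velocity (𝓡 2) γ)) x)) •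
          hopfTangent pr γ ι σ x +
      (hopfComponent C pr ι σ (covCurve (𝓡 2) γ (velocity (𝓡 2) γ)) x *
        mvfderiv (𝓡 2) σ x v) • C.ξ (ι x) := by
  rw [covAlong_smul h.contMDiffAt_curvature h.smoothAlong_hopfNormal, h.mvfderiv_curvature,
    h.covAlong_hopfNormal]
  module

end HopfChart
end HopfCylinderCurvature

section HopfCylinderLaplacian

variable {M : Type*} [TopologicalSpace M] [ChartedSpace (EuclideanSpace ℝ (Fin 3)) M]
  [IsManifold (𝓡 3) ∞ M]
  [RiemannianBundle (fun x : M => TangentSpace (𝓡 3) x)]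
  [IsContMDiffRiemannianBundle (𝓡 3) ∞ (EuclideanSpace ℝ (Fin 3))
    (fun x : M => TangentSpace (𝓡 3) x)]
  {B : Type*} [TopologicalSpace B] [ChartedSpace (EuclideanSpace ℝ (Fin 2)) B]
  [IsManifold (𝓡 2) ∞ B]
  [RiemannianBundle (fun x : B => TangentSpace (𝓡 2) x)]
  [IsContMDiffRiemannianBundle (𝓡 2) ∞ (EuclideanSpace ℝ (Fin 2))
    (fun x : B => TangentSpace (𝓡 2) x)]
  {S : Type*} [TopologicalSpace S] [ChartedSpace (EuclideanSpace ℝ (Fin 2)) S]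
  [IsManifold (𝓡 2) ∞ S]
  [RiemannianBundle (fun x : S => TangentSpace (𝓡 2) x)]
  [IsContMDiffRiemannianBundle (𝓡 2) ∞ (EuclideanSpace ℝ (Fin 2))
    (fun x : S => TangentSpace (𝓡 2) x)]

namespace HopfChart

variable {C : ContactRiemannianStructure M} {pr : M → B} {γ : ℝ → B} {J : Set ℝ} {ι : S → M}
  {x : S} {U : Set S} {σ : S → ℝ}

theorem covAlong_meanCurvatureVector (h : HopfChart C pr γ J ι x U σ)
    (v : TangentSpace (𝓡 2) x) :
    covAlong (𝓡 3) (𝓡 2) ι (meanCurvatureVector (𝓡 3) (𝓡 2) ι) x v = (1 / 2 : ℝ) •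
      (mvfderiv (𝓡 2) σ x v •
        (hopfComponent C pr ι σ (covCurve (𝓡 2) γ (covCurve (𝓡 2) γ (velocity (𝓡 2) γ))) x •
          hopfNormal C pr γ ι σ x) +
      hopfComponent C pr ι σ (covCurve (𝓡 2) γ (velocity (𝓡 2) γ)) x •
        (C.η (ι x) (mfderiv (𝓡 2) (𝓡 3) ι x v) • hopfTangent pr γ ι σ x +
          mvfderiv (𝓡 2) σ x v • (C.ξ (ι x) + (-1 : ℝ) •
            (hopfComponent C pr ι σ (covCurve (𝓡 2) γ (velocity (𝓡 2) γ)) x •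
              hopfTangent pr γ ι σ x)))) := by
  have h1 : ∀ᶠ y in 𝓝 x, meanCurvatureVector (𝓡 3) (𝓡 2) ι y = (1 / 2 : ℝ) •
      (hopfComponent C pr ι σ (covCurve (𝓡 2) γ (velocity (𝓡 2) γ)) y •
        hopfNormal C pr γ ι σ y) := h.eventually.mono fun y hy => by
    rw [hy.meanCurvatureVector_eq, smul_smul, one_div_mul_eq_div]
  rw [covAlong_congr h1,
    covAlong_const_smul _ (h.smoothAlong_hopfNormal.smul h.contMDiffAt_curvature),
    h.covAlong_curvature_smul_hopfNormal]
  module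

theorem covAlong₂_meanCurvatureVector (h : HopfChart C pr γ J ι x U σ)
    (v : TangentSpace (𝓡 2) x) {κ κ' κ'' θ₁ θ₀ : ℝ}
    (hκ : hopfComponent C pr ι σ (covCurve (𝓡 2) γ (velocity (𝓡 2) γ)) x = κ)
    (hκ' : hopfComponent C pr ι σ
      (covCurve (𝓡 2) γ (covCurve (𝓡 2) γ (velocity (𝓡 2) γ))) x = κ')
    (hκ'' : hopfComponent C pr ι σ
        (covCurve (𝓡 2) γ (covCurve (𝓡 2) γ (covCurve (𝓡 2) γ (velocity (𝓡 2) γ)))) x -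
      κ * ⟪velocity (𝓡 2) γ (σ x),
        covCurve (𝓡 2) γ (covCurve (𝓡 2) γ (velocity (𝓡 2) γ)) (σ x)⟫_ℝ = κ'')
    (hθ₁ : mvfderiv (𝓡 2) σ x v = θ₁)
    (hθ₀ : C.η (ι x) (mfderiv (𝓡 2) (𝓡 3) ι x v) = θ₀) :
    covAlong₂ (𝓡 3) (𝓡 2) ι (meanCurvatureVector (𝓡 3) (𝓡 2) ι) x v v =
      θ₁ ^ 2 • ((1 / 2 : ℝ) • ((κ'' - κ ^ 3 - κ) • hopfNormal C pr γ ι σ x -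
        (3 * κ * κ') • hopfTangent pr γ ι σ x + (2 * κ') • C.ξ (ι x))) +
      (θ₁ * θ₀) • ((κ ^ 2 : ℝ) • hopfNormal C pr γ ι σ x + κ' • hopfTangent pr γ ι σ x) +
      θ₀ ^ 2 • ((-(κ / 2)) • hopfNormal C pr γ ι σ x) := by
  have hs1 := h.contMDiffAt_coframe_tangent v
  have hs0 := h.contMDiffAt_coframe_ξ v
  have hX := h.smoothAlong_hopfTangent
  have hN := h.smoothAlong_hopfNormal
  have hξ := h.smoothAlong_ξ
  have hk := h.contMDiffAt_curvature
  have hk' := h.contMDiffAt_curvature_deriv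
  have hA := (hN.smul hk').smul hs1
  have hB := hX.smul hs0
  have hD := (hX.smul hk).const_smul (-1)
  have hE := (hξ.add hD).smul hs1
  rw [covAlong₂, covAlong_congr (h.eventually.mono fun y hy => hy.covAlong_meanCurvatureVector _),
    covAlong_const_smul _ (hA.add ((hB.add hE).smul hk)), covAlong_add hA ((hB.add hE).smul hk),
    add_apply, covAlong_smul hs1 (hN.smul hk'), covAlong_smul hk' hN, covAlong_smul hk (hB.add hE),
    covAlong_add hB hE, add_apply, covAlong_smul hs0 hX, covAlong_smul hs1 (hξ.add hD),
    covAlong_add hξ hD, add_apply, covAlong_const_smul _ (hX.smul hk), covAlong_smul hk hX,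
    h.covAlong_meanCurvatureVector, h.covAlong_hopfTangent, h.covAlong_hopfNormal, h.covAlong_ξ,
    h.mvfderiv_coframe_tangent, h.mvfderiv_coframe_ξ, h.mvfderiv_curvature,
    h.mvfderiv_hopfComponent (h.smoothAlong_covCurve h.smoothAlong_acceleration)]
  simp only [extend_apply_self, hκ, hκ', hκ'', hθ₁, hθ₀]
  module

/-- The Laplacian of the mean curvature vector of a Hopf cylinder. -/
theorem roughLaplacian_meanCurvatureVector (h : HopfChart C pr γ J ι x U σ) {κ κ' κ'' : ℝ}
    (hκ : hopfComponent C pr ι σ (covCurve (𝓡 2) γ (velocity (𝓡 2) γ)) x = κ)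
    (hκ' : hopfComponent C pr ι σ
      (covCurve (𝓡 2) γ (covCurve (𝓡 2) γ (velocity (𝓡 2) γ))) x = κ')
    (hκ'' : hopfComponent C pr ι σ
        (covCurve (𝓡 2) γ (covCurve (𝓡 2) γ (covCurve (𝓡 2) γ (velocity (𝓡 2) γ)))) x -
      κ * ⟪velocity (𝓡 2) γ (σ x),
        covCurve (𝓡 2) γ (covCurve (𝓡 2) γ (velocity (𝓡 2) γ)) (σ x)⟫_ℝ = κ'') :
    roughLaplacian (𝓡 3) (𝓡 2) ι (meanCurvatureVector (𝓡 3) (𝓡 2) ι) x =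
      ((κ ^ 3 + 2 * κ - κ'') / 2) • hopfNormal C pr γ ι σ x +
        (3 * κ * κ' / 2) • hopfTangent pr γ ι σ x - κ' • C.ξ (ι x) := by
  rw [roughLaplacian, h.sum_stdOrthonormalBasis
    (Q := fun v => covAlong₂ (𝓡 3) (𝓡 2) ι (meanCurvatureVector (𝓡 3) (𝓡 2) ι) x v v) _ _ _
    fun v => h.covAlong₂_meanCurvatureVector v hκ hκ' hκ'' rfl rfl]
  module

end HopfChart
end HopfCylinderLaplacian

section Circles

variable {B : Type*} [TopologicalSpace B] [ChartedSpace (EuclideanSpace ℝ (Fin 2)) B]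
  [IsManifold (𝓡 2) ∞ B]
  [RiemannianBundle (fun x : B => TangentSpace (𝓡 2) x)]
  [IsContMDiffRiemannianBundle (𝓡 2) ∞ (EuclideanSpace ℝ (Fin 2))
    (fun x : B => TangentSpace (𝓡 2) x)]
  {γ : ℝ → B} {J : Set ℝ}

theorem inner_velocity_jerk (hJ : IsOpen J) (hγ : IsUnitSpeedOn (𝓡 2) γ J) {s : ℝ} (hs : s ∈ J) :
    ⟪velocity (𝓡 2) γ s, covCurve (𝓡 2) γ (covCurve (𝓡 2) γ (velocity (𝓡 2) γ)) s⟫_ℝ =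
      -⟪covCurve (𝓡 2) γ (velocity (𝓡 2) γ) s, covCurve (𝓡 2) γ (velocity (𝓡 2) γ) s⟫_ℝ := by
  have hv : ∀ s ∈ J, _ := fun s hs => smoothAlong_velocity hJ hγ.1 hs
  have h1 := mvfderiv_inner_covCurve (hv s hs) (smoothAlong_covCurve hJ hv hs)
  have h2 : (fun s => ⟪velocity (𝓡 2) γ s, covCurve (𝓡 2) γ (velocity (𝓡 2) γ) s⟫_ℝ) =ᶠ[𝓝 s]
      fun _ => (0 : ℝ) := by
    filter_upwards [hJ.mem_nhds hs] with t ht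
    exact inner_velocity_acceleration hJ hγ ht
  have h4 := h2.mfderiv_eq (I := 𝓘(ℝ, ℝ)) (I' := 𝓘(ℝ, ℝ))
  rw [mfderiv_const] at h4
  rw [show mvfderiv 𝓘(ℝ, ℝ) (fun s => ⟪velocity (𝓡 2) γ s,
    covCurve (𝓡 2) γ (velocity (𝓡 2) γ) s⟫_ℝ) s (1 : ℝ) = 0
    from congrArg (fun L : ℝ →L[ℝ] ℝ => L 1) h4] at h1
  linarith

/-- A unit speed curve whose acceleration `A` satisfies `A' = -|A|²γ'` is a geodesic or a Riemannian
circle. -/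
theorem isGeodesicOn_or_isRiemannianCircleOn (hJ : IsOpen J) (hJc : IsPreconnected J)
    (hJn : J.Nonempty) (hγ : IsUnitSpeedOn (𝓡 2) γ J)
    (hA : ∀ s ∈ J, covCurve (𝓡 2) γ (covCurve (𝓡 2) γ (velocity (𝓡 2) γ)) s =
      ⟪velocity (𝓡 2) γ s, covCurve (𝓡 2) γ (covCurve (𝓡 2) γ (velocity (𝓡 2) γ)) s⟫_ℝ •
        velocity (𝓡 2) γ s) :
    IsGeodesicOn (𝓡 2) γ J ∨ IsRiemannianCircleOn (𝓡 2) γ J := by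
  have hv : ∀ s ∈ J, SmoothAlong (𝓡 2) 𝓘(ℝ, ℝ) γ (velocity (𝓡 2) γ) s :=
    fun s hs => smoothAlong_velocity hJ hγ.1 hs
  have ha : ∀ s ∈ J, SmoothAlong (𝓡 2) 𝓘(ℝ, ℝ) γ (covCurve (𝓡 2) γ (velocity (𝓡 2) γ)) s :=
    fun s hs => smoothAlong_covCurve hJ hv hs
  let f : ℝ → ℝ := fun s =>
    ⟪covCurve (𝓡 2) γ (velocity (𝓡 2) γ) s, covCurve (𝓡 2) γ (velocity (𝓡 2) γ) s⟫_ℝ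
  have hf : DifferentiableOn ℝ f J := fun s hs =>
    ((((ha s hs).inner (ha s hs)).mdifferentiableAt
      (by simp)).differentiableAt).differentiableWithinAt
  have hf' : J.EqOn (deriv f) 0 := fun s hs => by
    have h1 := mvfderiv_inner_covCurve (ha s hs) (ha s hs)
    rw [hA s hs, real_inner_smul_left, real_inner_smul_right,
      real_inner_comm (velocity (𝓡 2) γ s), inner_velocity_acceleration hJ hγ hs, mul_zero,
      add_zero] at h1
    have h2 : deriv f s = mfderiv 𝓘(ℝ, ℝ) 𝓘(ℝ, ℝ) f s (1 : ℝ) := by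
      rw [mfderiv_eq_fderiv]; exact fderiv_apply_one_eq_deriv.symm
    exact h2.trans h1
  obtain ⟨a, hfa⟩ := hJ.exists_is_const_of_deriv_eq_zero hJc hf hf'
  obtain ⟨s₀, hs₀⟩ := hJn
  have hnn : 0 ≤ a := by rw [← hfa s₀ hs₀]; exact real_inner_self_nonneg
  rcases hnn.eq_or_lt with h0 | hpos
  · exact .inl fun s hs => inner_self_eq_zero.1 ((hfa s hs).trans h0.symm)
  · right
    have hc : 0 < √a := Real.sqrt_pos.2 hpos
    have hcc : √a * √a = a := Real.mul_self_sqrt hnn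
    refine ⟨√a, hc, fun s => (√a)⁻¹ • covCurve (𝓡 2) γ (velocity (𝓡 2) γ) s,
      fun s hs => ((ha s hs).const_smul _).contMDiffWithinAt, fun s hs => ⟨?_, ?_, ?_, ?_⟩⟩
    · rw [norm_smul, norm_inv, Real.norm_of_nonneg hc.le, norm_eq_sqrt_real_inner]
      rw [show ⟪_, _⟫_ℝ = a from hfa s hs, inv_mul_cancel₀ hc.ne']
    · rw [real_inner_smul_right, inner_velocity_acceleration hJ hγ hs, mul_zero]
    · rw [smul_smul, mul_inv_cancel₀ hc.ne', one_smul]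
    · have h1 : covCurve (𝓡 2) γ (fun s => (√a)⁻¹ • covCurve (𝓡 2) γ (velocity (𝓡 2) γ) s) s =
          (√a)⁻¹ • covCurve (𝓡 2) γ (covCurve (𝓡 2) γ (velocity (𝓡 2) γ)) s :=
        covAlong_const_smul _ (ha s hs) _
      rw [h1, hA s hs, inner_velocity_jerk hJ hγ hs,
        show ⟪covCurve (𝓡 2) γ (velocity (𝓡 2) γ) s, _⟫_ℝ = a from hfa s hs, smul_smul, ← neg_smul]
      congr 1
      rw [mul_neg, neg_inj, inv_mul_eq_iff_eq_mul₀ hc.ne']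
      exact hcc.symm

theorem covCurve_acceleration_of_circle (hJ : IsOpen J) {k : ℝ}
    {Y : Π s : ℝ, TangentSpace (𝓡 2) (γ s)}
    (hYs : ContMDiffOn 𝓘(ℝ, ℝ) (𝓡 2).tangent ∞ (fun s => (⟨γ s, Y s⟩ : TangentBundle (𝓡 2) B)) J)
    (hY : ∀ s ∈ J, ‖Y s‖ = 1 ∧ ⟪velocity (𝓡 2) γ s, Y s⟫_ℝ = 0 ∧
      covCurve (𝓡 2) γ (velocity (𝓡 2) γ) s = k • Y s ∧
      covCurve (𝓡 2) γ Y s = -(k • velocity (𝓡 2) γ s)) {s : ℝ} (hs : s ∈ J) :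
    covCurve (𝓡 2) γ (covCurve (𝓡 2) γ (velocity (𝓡 2) γ)) s =
      (-k ^ 2) • velocity (𝓡 2) γ s := by
  have h1 : covAlong (𝓡 2) 𝓘(ℝ, ℝ) γ (covCurve (𝓡 2) γ (velocity (𝓡 2) γ)) s =
      covAlong (𝓡 2) 𝓘(ℝ, ℝ) γ (fun s => k • Y s) s :=
    covAlong_congr (Filter.mem_of_superset (hJ.mem_nhds hs) fun t ht => (hY t ht).2.2.1)
  have h2 : covAlong (𝓡 2) 𝓘(ℝ, ℝ) γ (fun s => k • Y s) s (1 : ℝ) = k • covCurve (𝓡 2) γ Y s :=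
    covAlong_const_smul k (hYs.contMDiffAt (hJ.mem_nhds hs)) _
  rw [covCurve, h1, h2, (hY s hs).2.2.2]
  module

theorem covCurve_jerk_of_circle (hJ : IsOpen J) (hγ : IsUnitSpeedOn (𝓡 2) γ J) {k : ℝ}
    {Y : Π s : ℝ, TangentSpace (𝓡 2) (γ s)}
    (hYs : ContMDiffOn 𝓘(ℝ, ℝ) (𝓡 2).tangent ∞ (fun s => (⟨γ s, Y s⟩ : TangentBundle (𝓡 2) B)) J)
    (hY : ∀ s ∈ J, ‖Y s‖ = 1 ∧ ⟪velocity (𝓡 2) γ s, Y s⟫_ℝ = 0 ∧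
      covCurve (𝓡 2) γ (velocity (𝓡 2) γ) s = k • Y s ∧
      covCurve (𝓡 2) γ Y s = -(k • velocity (𝓡 2) γ s)) {s : ℝ} (hs : s ∈ J) :
    covCurve (𝓡 2) γ (covCurve (𝓡 2) γ (covCurve (𝓡 2) γ (velocity (𝓡 2) γ))) s =
      (-k ^ 2) • covCurve (𝓡 2) γ (velocity (𝓡 2) γ) s := by
  have h1 : covAlong (𝓡 2) 𝓘(ℝ, ℝ) γ (covCurve (𝓡 2) γ (covCurve (𝓡 2) γ (velocity (𝓡 2) γ))) s =
      covAlong (𝓡 2) 𝓘(ℝ, ℝ) γ (fun s => (-k ^ 2) • velocity (𝓡 2) γ s) s :=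
    covAlong_congr (Filter.mem_of_superset (hJ.mem_nhds hs) fun t ht =>
      covCurve_acceleration_of_circle hJ hYs hY ht)
  rw [covCurve, h1]
  exact covAlong_const_smul (-k ^ 2) (smoothAlong_velocity hJ hγ.1 hs) _

end Circles

section HopfCylinderEigen

variable {M : Type*} [TopologicalSpace M] [ChartedSpace (EuclideanSpace ℝ (Fin 3)) M]
  [IsManifold (𝓡 3) ∞ M]
  [RiemannianBundle (fun x : M => TangentSpace (𝓡 3) x)]
  [IsContMDiffRiemannianBundle (𝓡 3) ∞ (EuclideanSpace ℝ (Fin 3))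
    (fun x : M => TangentSpace (𝓡 3) x)]
  {B : Type*} [TopologicalSpace B] [ChartedSpace (EuclideanSpace ℝ (Fin 2)) B]
  [IsManifold (𝓡 2) ∞ B]
  [RiemannianBundle (fun x : B => TangentSpace (𝓡 2) x)]
  [IsContMDiffRiemannianBundle (𝓡 2) ∞ (EuclideanSpace ℝ (Fin 2))
    (fun x : B => TangentSpace (𝓡 2) x)]
  {S : Type*} [TopologicalSpace S] [ChartedSpace (EuclideanSpace ℝ (Fin 2)) S]
  [IsManifold (𝓡 2) ∞ S]
  [RiemannianBundle (fun x : S => TangentSpace (𝓡 2) x)]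
  [IsContMDiffRiemannianBundle (𝓡 2) ∞ (EuclideanSpace ℝ (Fin 2))
    (fun x : S => TangentSpace (𝓡 2) x)]

theorem meanCurvatureEigen_of_eq_zero {ι : S → M} (hι : ContMDiff (𝓡 2) (𝓡 3) ∞ ι)
    (h : ∀ x, meanCurvatureVector (𝓡 3) (𝓡 2) ι x = 0) (μ : ℝ) : MeanCurvatureEigen ι μ := by
  intro x
  have h1 : ∀ y, covAlong (𝓡 3) (𝓡 2) ι (meanCurvatureVector (𝓡 3) (𝓡 2) ι) y = 0 := fun y =>
    (covAlong_congr (.of_forall h)).trans (covAlong_zero hι.contMDiffAt)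
  have h2 : ∀ v w, covAlong₂ (𝓡 3) (𝓡 2) ι (meanCurvatureVector (𝓡 3) (𝓡 2) ι) x v w = 0 :=
    fun v w => by
      rw [covAlong₂, h1, covAlong_congr (W := fun y => 0) (.of_forall fun y => by rw [h1]; rfl),
        covAlong_zero hι.contMDiffAt, zero_apply, zero_apply, sub_zero]
  rw [roughLaplacian, h x, smul_zero, Finset.sum_eq_zero fun i _ => h2 _ _, neg_zero]

namespace HopfChart

variable {C : ContactRiemannianStructure M} {pr : M → B} {γ : ℝ → B} {J : Set ℝ} {ι : S → M}
  {x : S} {U : Set S} {σ : S → ℝ}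

theorem inner_mfderiv_hopfNormal_self (h : HopfChart C pr γ J ι x U σ) :
    ⟪mfderiv (𝓡 3) (𝓡 2) pr (ι x) (hopfNormal C pr γ ι σ x),
      mfderiv (𝓡 3) (𝓡 2) pr (ι x) (hopfNormal C pr γ ι σ x)⟫_ℝ = 1 := by
  rw [h.mfderiv_hopfNormal_inner, h.inner_hopfNormal_self]

theorem hopfComponent_sq (h : HopfChart C pr γ J ι x U σ) :
    hopfComponent C pr ι σ (covCurve (𝓡 2) γ (velocity (𝓡 2) γ)) x ^ 2 =
      ⟪covCurve (𝓡 2) γ (velocity (𝓡 2) γ) (σ x), covCurve (𝓡 2) γ (velocity (𝓡 2) γ) (σ x)⟫_ℝ := by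
  rw [← h.inner_pullCurve, h.pullCurve_eq (C := C), inner_velocity_acceleration h.isOpen h.unitSpeed h.mem_parameter,
    zero_smul, zero_add, real_inner_smul_left, real_inner_smul_right,
    h.inner_mfderiv_hopfNormal_self]
  ring

theorem hopfComponent_of_eq_smul {A A' : Π s : ℝ, TangentSpace (𝓡 2) (γ s)} {c : ℝ}
    (hA : A (σ x) = c • A' (σ x)) :
    hopfComponent C pr ι σ A x = c * hopfComponent C pr ι σ A' x := by
  have h1 : pullCurve pr ι σ A x = c • pullCurve pr ι σ A' x := by
    rw [pullCurve, hA, castTangent_smul]; rfl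
  rw [hopfComponent, h1, real_inner_smul_left]; rfl

theorem meanCurvatureVector_eq_zero (h : HopfChart C pr γ J ι x U σ)
    (hg : covCurve (𝓡 2) γ (velocity (𝓡 2) γ) (σ x) = 0) :
    meanCurvatureVector (𝓡 3) (𝓡 2) ι x = 0 := by
  have h1 := h.hopfComponent_sq
  rw [hg, inner_zero_left, sq_eq_zero_iff] at h1
  rw [h.meanCurvatureVector_eq, h1, zero_div, zero_smul]

theorem inner_meanCurvatureVector_self (h : HopfChart C pr γ J ι x U σ) :
    ⟪meanCurvatureVector (𝓡 3) (𝓡 2) ι x, meanCurvatureVector (𝓡 3) (𝓡 2) ι x⟫_ℝ =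
      ⟪covCurve (𝓡 2) γ (velocity (𝓡 2) γ) (σ x), covCurve (𝓡 2) γ (velocity (𝓡 2) γ) (σ x)⟫_ℝ /
        4 := by
  rw [h.meanCurvatureVector_eq, ← h.hopfComponent_sq, real_inner_smul_left, real_inner_smul_right,
    h.inner_hopfNormal_self]
  ring

theorem meanCurvature_sq (h : HopfChart C pr γ J ι x U σ) {n : TangentSpace (𝓡 3) (ι x)}
    (hn : IsUnitNormal ι x n) :
    meanCurvature ι x n ^ 2 =
      ⟪covCurve (𝓡 2) γ (velocity (𝓡 2) γ) (σ x), covCurve (𝓡 2) γ (velocity (𝓡 2) γ) (σ x)⟫_ℝ /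
        4 := by
  obtain ⟨e₁, e₀, -, -, -, h1, h0, -⟩ := h.exists_adapted_basis
  have hn1 := hn.2 e₁
  have hn0 := hn.2 e₀
  rw [h1] at hn1
  rw [h0, C.inner_ξ] at hn0
  have h2 := h.eq_sum_frame n
  rw [hn1, hn0, zero_smul, zero_smul, zero_add, add_zero] at h2
  have h3 : ⟪n, n⟫_ℝ = 1 := by rw [real_inner_self_eq_norm_sq, hn.1, one_pow]
  rw [h2, real_inner_smul_left, real_inner_smul_right, h.inner_hopfNormal_self, mul_one] at h3
  rw [meanCurvature, h.meanCurvatureVector_eq, real_inner_smul_left, mul_pow, sq ⟪_, n⟫_ℝ, h3,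
    ← h.hopfComponent_sq]
  ring

theorem inner_jerk_eq_zero (h : HopfChart C pr γ J ι x U σ) {μ : ℝ}
    (hμ : roughLaplacian (𝓡 3) (𝓡 2) ι (meanCurvatureVector (𝓡 3) (𝓡 2) ι) x =
      μ • meanCurvatureVector (𝓡 3) (𝓡 2) ι x) :
    covCurve (𝓡 2) γ (covCurve (𝓡 2) γ (velocity (𝓡 2) γ)) (σ x) =
      ⟪velocity (𝓡 2) γ (σ x),
        covCurve (𝓡 2) γ (covCurve (𝓡 2) γ (velocity (𝓡 2) γ)) (σ x)⟫_ℝ •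
          velocity (𝓡 2) γ (σ x) := by
  have h1 := congrArg (C.η (ι x)) hμ
  rw [h.roughLaplacian_meanCurvatureVector rfl rfl rfl, h.meanCurvatureVector_eq, map_sub, map_add,
    map_smul, map_smul, map_smul, map_smul, map_smul, h.η_hopfTangent, η_hopfNormal, C.η_ξ] at h1
  simp only [smul_eq_mul, mul_zero, add_zero, zero_sub, mul_one, neg_eq_zero] at h1
  have h2 := h.pullCurve_eq (C := C) (covCurve (𝓡 2) γ (covCurve (𝓡 2) γ (velocity (𝓡 2) γ)))
  rw [h1, zero_smul, add_zero] at h2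
  exact h2

theorem roughLaplacian_of_circle (h : HopfChart C pr γ J ι x U σ) {k : ℝ}
    {Y : Π s : ℝ, TangentSpace (𝓡 2) (γ s)}
    (hYs : ContMDiffOn 𝓘(ℝ, ℝ) (𝓡 2).tangent ∞ (fun s => (⟨γ s, Y s⟩ : TangentBundle (𝓡 2) B)) J)
    (hY : ∀ s ∈ J, ‖Y s‖ = 1 ∧ ⟪velocity (𝓡 2) γ s, Y s⟫_ℝ = 0 ∧
      covCurve (𝓡 2) γ (velocity (𝓡 2) γ) s = k • Y s ∧
      covCurve (𝓡 2) γ Y s = -(k • velocity (𝓡 2) γ s)) :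
    roughLaplacian (𝓡 3) (𝓡 2) ι (meanCurvatureVector (𝓡 3) (𝓡 2) ι) x =
        (k ^ 2 + 2) • meanCurvatureVector (𝓡 3) (𝓡 2) ι x ∧
      ⟪covCurve (𝓡 2) γ (velocity (𝓡 2) γ) (σ x),
        covCurve (𝓡 2) γ (velocity (𝓡 2) γ) (σ x)⟫_ℝ = k ^ 2 := by
  have hs := h.mem_parameter
  have h2 := covCurve_acceleration_of_circle h.isOpen hYs hY hs
  have h3 := covCurve_jerk_of_circle h.isOpen h.unitSpeed hYs hY hs
  have hk : ⟪covCurve (𝓡 2) γ (velocity (𝓡 2) γ) (σ x),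
      covCurve (𝓡 2) γ (velocity (𝓡 2) γ) (σ x)⟫_ℝ = k ^ 2 := by
    rw [(hY _ hs).2.2.1, real_inner_smul_left, real_inner_smul_right, real_inner_self_eq_norm_sq,
      (hY _ hs).1]
    ring
  refine ⟨?_, hk⟩
  have hsq := h.hopfComponent_sq
  rw [hk] at hsq
  have hκ' : hopfComponent C pr ι σ
      (covCurve (𝓡 2) γ (covCurve (𝓡 2) γ (velocity (𝓡 2) γ))) x = 0 := by
    rw [hopfComponent_of_eq_smul h2, hopfComponent_velocity, mul_zero]
  rw [h.roughLaplacian_meanCurvatureVector rfl hκ' rfl, h.meanCurvatureVector_eq,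
    hopfComponent_of_eq_smul h3, h2, real_inner_smul_right, h.inner_velocity, ← hsq]
  module

end HopfChart
end HopfCylinderEigen

end RiemGeom

end

theorem mainTheorem4
    {M : Type*} [TopologicalSpace M] [T2Space M] [ChartedSpace (EuclideanSpace ℝ (Fin 3)) M]
    [IsManifold (𝓡 3) ∞ M]
    [RiemannianBundle (fun x : M => TangentSpace (𝓡 3) x)]
    [IsContMDiffRiemannianBundle (𝓡 3) ∞ (EuclideanSpace ℝ (Fin 3))
      (fun x : M => TangentSpace (𝓡 3) x)]
    {B : Type*} [TopologicalSpace B] [T2Space B] [ChartedSpace (EuclideanSpace ℝ (Fin 2)) B]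
    [IsManifold (𝓡 2) ∞ B]
    [RiemannianBundle (fun x : B => TangentSpace (𝓡 2) x)]
    [IsContMDiffRiemannianBundle (𝓡 2) ∞ (EuclideanSpace ℝ (Fin 2))
      (fun x : B => TangentSpace (𝓡 2) x)]
    {S : Type*} [TopologicalSpace S] [T2Space S] [ChartedSpace (EuclideanSpace ℝ (Fin 2)) S]
    [IsManifold (𝓡 2) ∞ S]
    [RiemannianBundle (fun x : S => TangentSpace (𝓡 2) x)]
    [IsContMDiffRiemannianBundle (𝓡 2) ∞ (EuclideanSpace ℝ (Fin 2))
      (fun x : S => TangentSpace (𝓡 2) x)]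
    (C : ContactRiemannianStructure M) (hC : C.IsSasaki)
    (pr : M → B) (hpr : IsBoothbyWangFibration C pr)
    (J : Set ℝ) (hJ : IsOpen J) (hJc : IsPreconnected J) (hJn : J.Nonempty)
    (γ : ℝ → B) (hγ : IsUnitSpeedOn (𝓡 2) γ J)
    (ι : S → M) (hι : IsHopfCylinder pr γ J ι) :
    ((∃ μ : ℝ, MeanCurvatureEigen ι μ) ↔
      IsGeodesicOn (𝓡 2) γ J ∨ IsRiemannianCircleOn (𝓡 2) γ J) ∧
    (MeanCurvatureEigen ι 0 ↔ IsGeodesicOn (𝓡 2) γ J) ∧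
    (IsGeodesicOn (𝓡 2) γ J → ∀ x : S, meanCurvatureVector (𝓡 3) (𝓡 2) ι x = 0) ∧
    (IsRiemannianCircleOn (𝓡 2) γ J → ∃ μ : ℝ, 2 < μ ∧
      (∀ ν : ℝ, MeanCurvatureEigen ι ν ↔ ν = μ) ∧
      ∀ (x : S) (n : TangentSpace (𝓡 3) (ι x)), IsUnitNormal ι x n →
        μ = 4 * meanCurvature ι x n ^ 2 + 2) := by
  
  have hchart : ∀ x : S, ∃ U σ, HopfChart C pr γ J ι x U σ := fun x => by
    obtain ⟨U, σ, hσ⟩ := hι.parameter x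
    exact ⟨U, σ, hC, hpr, hJ, hγ, hι, hσ⟩
  have hpoint : ∀ s ∈ J, ∃ x U σ, HopfChart C pr γ J ι x U σ ∧ σ x = s := fun s hs => by
    obtain ⟨p, hp⟩ := hpr.surjective (γ s)
    obtain ⟨x, -, U, σ, hσ, hx⟩ := hι.attained s hs p hp
    exact ⟨x, U, σ, ⟨hC, hpr, hJ, hγ, hι, hσ⟩, hx⟩
  have hgeo : IsGeodesicOn (𝓡 2) γ J → ∀ x : S, meanCurvatureVector (𝓡 3) (𝓡 2) ι x = 0 :=
    fun hg x => by
      obtain ⟨U, σ, h⟩ := hchart x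
      exact h.meanCurvatureVector_eq_zero (hg _ h.mem_parameter)
  have hzero : IsGeodesicOn (𝓡 2) γ J → ∀ μ, MeanCurvatureEigen ι μ := fun hg μ =>
    meanCurvatureEigen_of_eq_zero hι.smooth (hgeo hg) μ
  have hcirc : IsRiemannianCircleOn (𝓡 2) γ J → ∃ μ : ℝ, 2 < μ ∧
      (∀ ν : ℝ, MeanCurvatureEigen ι ν ↔ ν = μ) ∧
      ∀ (x : S) (n : TangentSpace (𝓡 3) (ι x)), IsUnitNormal ι x n →
        μ = 4 * meanCurvature ι x n ^ 2 + 2 := by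
    rintro ⟨k, hk, Y, hYs, hY⟩
    have hL : ∀ x, roughLaplacian (𝓡 3) (𝓡 2) ι (meanCurvatureVector (𝓡 3) (𝓡 2) ι) x =
        (k ^ 2 + 2) • meanCurvatureVector (𝓡 3) (𝓡 2) ι x := fun x => by
      obtain ⟨U, σ, h⟩ := hchart x
      exact (h.roughLaplacian_of_circle hYs hY).1
    refine ⟨k ^ 2 + 2, by nlinarith [sq_nonneg k, sq_pos_of_pos hk], fun ν => ⟨fun hν => ?_, ?_⟩,
      fun x n hn => ?_⟩
    · obtain ⟨s, hs⟩ := hJn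
      obtain ⟨x, U, σ, h, -⟩ := hpoint s hs
      have h1 := hν x
      rw [hL x, ← sub_eq_zero, ← sub_smul] at h1
      have h2 : meanCurvatureVector (𝓡 3) (𝓡 2) ι x ≠ 0 := fun h0 => by
        have h3 := h.inner_meanCurvatureVector_self
        rw [h0, inner_zero_left, (h.roughLaplacian_of_circle hYs hY).2] at h3
        nlinarith [sq_pos_of_pos hk]
      linarith [(smul_eq_zero.1 h1).resolve_right h2]
    · rintro rfl
      exact hL
    · obtain ⟨U, σ, h⟩ := hchart x
      rw [h.meanCurvature_sq hn, (h.roughLaplacian_of_circle hYs hY).2]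
      ring
  have heig : (∃ μ : ℝ, MeanCurvatureEigen ι μ) →
      IsGeodesicOn (𝓡 2) γ J ∨ IsRiemannianCircleOn (𝓡 2) γ J := by
    rintro ⟨μ, hμ⟩
    refine isGeodesicOn_or_isRiemannianCircleOn hJ hJc hJn hγ fun s hs => ?_
    obtain ⟨x, U, σ, h, rfl⟩ := hpoint s hs
    exact h.inner_jerk_eq_zero (hμ x)
  refine ⟨⟨heig, ?_⟩, ⟨fun h0 => ?_, fun hg => hzero hg 0⟩, hgeo, hcirc⟩
  · rintro (hg | hc)
    · exact ⟨0, hzero hg 0⟩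
    · obtain ⟨μ, -, hμ, -⟩ := hcirc hc
      exact ⟨μ, (hμ μ).2 rfl⟩
  · refine (heig ⟨0, h0⟩).resolve_right fun hc => ?_
    obtain ⟨μ, hμ2, hμ, -⟩ := hcirc hc
    linarith [(hμ 0).1 h0]
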